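/- **Setting.** Write $\mathbb G_m=\operatorname{Spec}\mathbb C[z,z^{-1}]$ and $w=1/z$. Let $f(x,z)=x+z/x$, and let $$\mathrm{Kl}_2=\operatorname{coker}\bigl[\,x\partial_x+(x-z/x):\ \mathbb C[x^{\pm1},z^{\pm1}]\to\mathbb C[x^{\pm1},z^{\pm1}]\,\bigr]$$ be the Kloosterman module with its Gauss–Manin connection $\nabla$, in which $z\nabla_{\partial_z}$ is induced by $z\partial_z+z/x$. It is free over $\mathbb C[z^{\pm1}]$ on the classes $v_0=[dx/x]$, $v_1=[dx]$, and $z\nabla_{\partial_z}v_0=v_1$, $z\nabla_{\partial_z}v_1=z\,v_0$. Fibrewise Poincaré duality in $x$, together with the involution $x\mapsto -x$, gives a horizontal skew-symmetric pairing on $\mathrm{Kl}_2$ with $\langle v_0,v_1\rangle=1$. For $k\ge 1$, $\mathrm{Sym}^k\mathrm{Kl}_2$ has basis $u_a=v_0^{k-a}v_1^a$ ($0\le a\le k$), carries the induced connection, and carries the induced pairing $\langle u_a,u_b\rangle=(-1)^a\frac{a!\,b!}{k!}$ if $a+b=k$ and $0$ otherwise. Let $H^1_{\mathrm{dR}}$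 be the cokernel of $\nabla$ on global sections of $\mathrm{Sym}^k\mathrm{Kl}_2$. Let $H^1_{\mathrm{dR},c}$ be the space of triples $(\widehat m_0,\widehat m_\infty,\omega)$, where $\omega$ is a one-form with values in $\mathrm{Sym}^k\mathrm{Kl}_2$ and $\widehat m_0$, $\widehat m_\infty$ are formal solutions of $\widehat\nabla\widehat m=\omega$ at $z=0$ (coefficients in $\mathbb C((z))$) and at $z=\infty$ (coefficients in $\mathbb C((w))$), modulo the triples $(\varphi,\varphi,\nabla\varphi)$. Let $H^1_{\mathrm{dR},\mathrm{mid}}$ be the image of $H^1_{\mathrm{dR},c}\to H^1_{\mathrm{dR}}$, $(\widehat m_0,\widehat m_\infty,\omega)\mapsto\omega$. The de Rham intersection pairing $H^1_{\mathrm{dR},c}\otimes H^1_{\mathrm{dR}}\to\mathbb C$ is $$\bigl((\widehat m_0,\widehat m_\infty,\omega),\eta\bigr)\mapsto \operatorname{res}_{z=0}\langle\widehat m_0,\eta\rangle+\operatorname{res}_{z=\infty}\langle\widehat m_\infty,\eta\rangle ,$$ and it induces a pairing $\mathsf S_k^{\mathrm{mid}}$ on $H^1_{\mathrm{dR},\mathrm{mid}}$.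 Put $k'=\lfloor (k-1)/2\rfloor$ and let $I_k=\{1,\dots,k'\}$ if $4\nmid k$, $I_k=\{1,\dots,k'\}\setminus\{k/4\}$ if $4\mid k$. Let $\omega_i=[z^iv_0^k\,dz/z]\in H^1_{\mathrm{dR}}$. Let $\gamma_{k,i}=0$ if $4\nmid k$; if $4\mid k$, let $\gamma_{k,i}$ be the coefficient of $w^i$ in $$w^{k/4}\Bigl(\sum_{n\ge0}\frac{((2n-1)!!)^3}{2^{5n}\,n!}\,w^n\Bigr)^{k/2},$$ which (with $w=4/t^2$) is the asymptotic expansion of $2^k(I_0(t)K_0(t))^{k/2}$ as $t\to+\infty$, where $I_0,K_0$ are the modified Bessel functions. Set $\omega_i'=\omega_i-\gamma_{k,i}\,\omega_{k/4}$, which is $\omega_i$ if $4\nmid k$. Here $m!=m!!=1$ for $m\le 0$. **Theorem.** For every integer $k\ge1$, the classes $\omega_i'$ ($i\in I_k$) form a basis of $H^1_{\mathrm{dR},\mathrm{mid}}(\mathbb G_m,\mathrm{Sym}^k\mathrm{Kl}_2)$. With respect to this basis the matrix of $\mathsf S_k^{\mathrm{mid}}$ is lower-right triangular, that is, $\mathsf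 S_k^{\mathrm{mid}}(\omega'_i,\omega'_j)=0$ for $i,j\in I_k$ with $i+j\le k'$, and for $i,j\in I_k$ with $i+j=k'+1$ one has $$\mathsf S_k^{\mathrm{mid}}(\omega'_i,\omega'_j)=\begin{cases}(-2)^{k'}\,\dfrac{k'!}{k!!}&\text{if $k$ is odd},\\[8pt]\dfrac{(-1)^{k'+1}}{2^{k'}(k'+1-2i)}\cdot\dfrac{(k-1)!!}{(k'+1)!}&\text{if $k$ is even}.\end{cases}$$ -/

import Mathlib

noncomputable section

namespace SymKl

open LaurentPolynomial

section Laurent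

variable {A : Type*} [CommRing A]

/-- The Euler derivation `T d/dT` on Laurent polynomials. -/
def lpEuler : A[T;T⁻¹] →ₗ[A] A[T;T⁻¹] where
  toFun f := .ofCoeff (Finsupp.onFinset f.coeff.support (fun n => (n : A) * f.coeff n)
    (fun n h => by
      rw [Finsupp.mem_support_iff]
      intro h0
      exact h (by rw [h0, mul_zero])))
  map_add' f g := by
    ext n
    simp [mul_add]
  map_smul' a f := by
    ext n
    simp [mul_left_comm]

@[simp] theorem coeff_lpEuler (f : A[T;T⁻¹]) (n : ℤ) :
    (lpEuler f).coeff n = (n : A) * f.coeff n := rfl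

/-- The Euler derivation `X d/dX` on formal Laurent series. -/
def lsEuler : LaurentSeries A →ₗ[A] LaurentSeries A where
  toFun f := ⟨fun n => (n : A) * f.coeff n, f.isPWO_support.mono (fun n h => by
    rw [HahnSeries.mem_support]
    intro h0
    exact h (by simp [h0]))⟩
  map_add' f g := by
    ext n
    simp [mul_add]
  map_smul' a f := by
    ext n
    simp [mul_left_comm]

@[simp] theorem coeff_lsEuler (f : LaurentSeries A) (n : ℤ) :
    (lsEuler f).coeff n = (n : A) * f.coeff n := rfl

theorem support_lsEuler (f : LaurentSeries A) : (lsEuler f).support ⊆ f.support := by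
  intro n h
  rw [HahnSeries.mem_support] at h ⊢
  intro h0
  exact h (by simp [h0])

theorem lsEuler_mul (f g : LaurentSeries A) :
    lsEuler (f * g) = lsEuler f * g + f * lsEuler g := by
  ext n
  rw [HahnSeries.coeff_add, coeff_lsEuler, HahnSeries.coeff_mul,
    HahnSeries.coeff_mul_left' f.isPWO_support (support_lsEuler f),
    HahnSeries.coeff_mul_right' g.isPWO_support (support_lsEuler g),
    Finset.mul_sum, ← Finset.sum_add_distrib]
  refine Finset.sum_congr rfl fun ij hij => ?_
  rw [Finset.mem_antidiagonal] at hij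
  rw [coeff_lsEuler, coeff_lsEuler, ← hij.2.2]
  push_cast
  ring

/-- The expansion at `T = 0`: the inclusion `A[T,T⁻¹] → A((X))`, `T ↦ X`. -/
def expandZero : A[T;T⁻¹] →+* LaurentSeries A :=
  AddMonoidAlgebra.liftNCRingHom HahnSeries.C
    { toFun := fun n => HahnSeries.single n.toAdd 1
      map_one' := rfl
      map_mul' := fun m n => by simp }
    (fun _ _ => Commute.all _ _)

/-- The expansion at `T = ∞`: the homomorphism `A[T,T⁻¹] → A((X))`, `T ↦ X⁻¹`. -/
def expandInf : A[T;T⁻¹] →+* LaurentSeries A :=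
  expandZero.comp (invert (R := A) : A[T;T⁻¹] →+* A[T;T⁻¹])

/-- The involution `T ↦ -T` of `A[T,T⁻¹]`. -/
def lpNeg : A[T;T⁻¹] →ₐ[A] A[T;T⁻¹] :=
  AddMonoidAlgebra.lift A A[T;T⁻¹] ℤ
    { toFun := fun n => C ((n.toAdd.negOnePow : ℤ) : A) * T n.toAdd
      map_one' := by simp
      map_mul' := fun m n => by
        simp only [toAdd_mul, Int.negOnePow_add, Units.val_mul, Int.cast_mul, map_mul, T_add]
        ring }

theorem expandZero_single (n : ℤ) (a : A) :
    expandZero (AddMonoidAlgebra.single n a) = HahnSeries.single n a :=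
  (AddMonoidAlgebra.liftNC_single _ _ _ _).trans (by simp)

@[simp] theorem expandZero_T (n : ℤ) :
    expandZero (T n : A[T;T⁻¹]) = HahnSeries.single n 1 := expandZero_single n 1

@[simp] theorem expandInf_T (n : ℤ) :
    expandInf (T n : A[T;T⁻¹]) = HahnSeries.single (-n) 1 := by
  simp [expandInf]

@[simp] theorem coeff_expandZero (f : A[T;T⁻¹]) (n : ℤ) :
    (expandZero f).coeff n = f.coeff n := by
  induction f using LaurentPolynomial.induction_on' with
  | add p q hp hq => simp [hp, hq]
  | C_mul_T m a =>
    rw [← single_eq_C_mul_T, expandZero_single]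
    by_cases h : n = m
    · simp [h, -single_eq_C_mul_T]
    · simp [HahnSeries.coeff_single_of_ne h, Finsupp.single_eq_of_ne h, -single_eq_C_mul_T]

@[simp] theorem coeff_expandInf (f : A[T;T⁻¹]) (n : ℤ) :
    (expandInf f).coeff n = f.coeff (-n) := by
  simp [expandInf]

theorem expandZero_smul (a : A) (f : A[T;T⁻¹]) : expandZero (a • f) = a • expandZero f := by
  ext n
  simp

theorem expandInf_smul (a : A) (f : A[T;T⁻¹]) : expandInf (a • f) = a • expandInf f := by
  ext n
  simp

theorem expandZero_injective : Function.Injective (expandZero : A[T;T⁻¹] → LaurentSeries A) := by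
  intro f g h
  ext n
  rw [← coeff_expandZero, h, coeff_expandZero]

theorem expandZero_euler (f : A[T;T⁻¹]) : expandZero (lpEuler f) = lsEuler (expandZero f) := by
  ext n
  simp

theorem expandInf_euler (f : A[T;T⁻¹]) : expandInf (lpEuler f) = -lsEuler (expandInf f) := by
  ext n
  simp

theorem lpEuler_mul (f g : A[T;T⁻¹]) : lpEuler (f * g) = lpEuler f * g + f * lpEuler g := by
  apply expandZero_injective
  simp [expandZero_euler, lsEuler_mul]

@[simp] theorem lpEuler_T (n : ℤ) : lpEuler (T n : A[T;T⁻¹]) = (n : A) • T n := by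
  ext m
  by_cases h : n = m
  · simp [h]
  · simp [h]

theorem coeff_T_mul (f : A[T;T⁻¹]) (m n : ℤ) : (T m * f).coeff n = f.coeff (n - m) := by
  rw [T, AddMonoidAlgebra.coeff_single_mul_apply, one_mul, neg_add_eq_sub]

theorem coeff_C_mul (a : A) (f : A[T;T⁻¹]) (n : ℤ) : (C a * f).coeff n = a * f.coeff n := by
  rw [← smul_eq_C_mul]
  simp

theorem lpNeg_T (n : ℤ) : lpNeg (T n : A[T;T⁻¹]) = C ((n.negOnePow : ℤ) : A) * T n := by
  rw [lpNeg, T, AddMonoidAlgebra.lift_single, one_smul]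
  rfl

theorem lpNeg_euler (f : A[T;T⁻¹]) : lpNeg (lpEuler f) = lpEuler (lpNeg f) := by
  induction f using LaurentPolynomial.induction_on' with
  | add p q hp hq => simp [hp, hq]
  | C_mul_T m a =>
    rw [← smul_eq_C_mul, map_smul, map_smul, map_smul, map_smul, lpEuler_T, map_smul, lpNeg_T,
      ← smul_eq_C_mul, map_smul, lpEuler_T, smul_comm (m : A)]

theorem smul_mul_ls (a : A) (f g : LaurentSeries A) : (a • f) * g = a • (f * g) := by
  rw [← HahnSeries.single_zero_mul_eq_smul, ← HahnSeries.single_zero_mul_eq_smul, mul_assoc]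

theorem mul_smul_ls (a : A) (f g : LaurentSeries A) : f * (a • g) = a • (f * g) := by
  rw [mul_comm, smul_mul_ls, mul_comm]

instance smulCommClass_ls : SMulCommClass A (LaurentSeries A) (LaurentSeries A) where
  smul_comm a f g := (mul_smul_ls a f g).symm

theorem smul_single_ls (a : A) (n : ℤ) :
    a • (HahnSeries.single n 1 : LaurentSeries A) = HahnSeries.single n a := by
  rw [← HahnSeries.single_zero_mul_eq_smul, HahnSeries.single_mul_single, zero_add, mul_one]

/-- The operator `X d/dX + (b X + u X⁻¹)` on formal Laurent series. -/
def twist (b u : A) : LaurentSeries A →ₗ[A] LaurentSeries A :=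
  lsEuler +
    { toFun := fun f => (HahnSeries.single 1 b + HahnSeries.single (-1) u) * f
      map_add' := fun f g => mul_add _ f g
      map_smul' := fun a f => by
        ext n
        simp [add_mul, HahnSeries.coeff_single_mul, mul_left_comm] }

theorem twist_apply (b u : A) (f : LaurentSeries A) :
    twist b u f = lsEuler f + (HahnSeries.single 1 b + HahnSeries.single (-1) u) * f := rfl

theorem coeff_twist (b u : A) (f : LaurentSeries A) (n : ℤ) :
    (twist b u f).coeff n = n * f.coeff n + (b * f.coeff (n - 1) + u * f.coeff (n + 1)) := by
  simp [twist_apply, add_mul, HahnSeries.coeff_single_mul]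

theorem coeff_eq_zero_of_twist {b u : A} (hu : IsUnit u) (f : LaurentSeries A) (N : ℤ)
    (h : ∀ n < N, (twist b u f).coeff n = 0) : ∀ n ≤ N, f.coeff n = 0 := by
  by_contra! hc
  obtain ⟨n, hn, hf⟩ := hc
  have hf0 : f ≠ 0 := by
    rintro rfl
    simp at hf
  have h1 : f.order ≤ n := HahnSeries.order_le_of_coeff_ne_zero hf
  have h2 := h (f.order - 1) (by omega)
  rw [coeff_twist, HahnSeries.coeff_eq_zero_of_lt_order (i := f.order - 1) (by omega),
    HahnSeries.coeff_eq_zero_of_lt_order (i := f.order - 1 - 1) (by omega)] at h2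
  simp only [mul_zero, zero_add, sub_add_cancel] at h2
  exact (HahnSeries.coeff_order_eq_zero.not.mpr hf0) ((hu.mul_right_eq_zero).mp h2)

/-- Coefficients, from the lowest one on, of the solution `f` of `twist b u f = g`. -/
def twistSol (b v : A) (g : ℤ → A) (N : ℤ) : ℕ → A
  | 0 => 0
  | 1 => v * g N
  | m + 2 => v * (g (N + m + 1) - ((N + m + 1 : ℤ) : A) * twistSol b v g N (m + 1)
      - b * twistSol b v g N m)

theorem twist_bijective (b : A) {u : A} (hu : IsUnit u) : Function.Bijective (twist b u) := by
  constructor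
  · rw [injective_iff_map_eq_zero]
    intro f hf
    ext n
    exact coeff_eq_zero_of_twist hu f n (fun m _ => by rw [hf, HahnSeries.coeff_zero]) n le_rfl
  · intro g
    obtain ⟨v, hv⟩ := hu.exists_right_inv
    obtain ⟨N, hN⟩ : ∃ N : ℤ, ∀ n < N, g.coeff n = 0 :=
      ⟨g.order, fun n hn => HahnSeries.coeff_eq_zero_of_lt_order hn⟩
    let s : ℤ → A := fun n => if N ≤ n then twistSol b v g.coeff N (n - N).toNat else 0
    have hs : BddBelow (Function.support s) := ⟨N, fun n hn => by
      by_contra hlt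
      exact hn (if_neg hlt)⟩
    refine ⟨HahnSeries.ofSuppBddBelow s hs, ?_⟩
    ext n
    rw [coeff_twist]
    simp only [HahnSeries.coeff_ofSuppBddBelow]
    have hneg : ∀ m < N, s m = 0 := fun m hm => if_neg (by omega)
    have hpos : ∀ m : ℕ, s (N + m) = twistSol b v g.coeff N m := fun m => by
      simp [s]
    have hN0 : s N = 0 := by
      have := hpos 0
      simpa [twistSol] using this
    rcases lt_trichotomy n N with h | h | h
    · rw [hneg n h, hneg (n - 1) (by omega), hN n h]
      rcases (show n + 1 ≤ N by omega).lt_or_eq with h' | h'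
      · simp [hneg _ h']
      · simp [h', hN0]
    · subst h
      have h1 := hpos 1
      simp only [Nat.cast_one, twistSol] at h1
      rw [hN0, hneg (n - 1) (by omega), h1]
      linear_combination g.coeff n * hv
    · obtain ⟨m, rfl⟩ : ∃ m : ℕ, n = N + m + 1 := ⟨(n - N - 1).toNat, by omega⟩
      have h0 := hpos m
      have h1 := hpos (m + 1)
      have h2 := hpos (m + 2)
      simp only [twistSol] at h2
      push_cast at h1 h2
      rw [show N + (m : ℤ) + 1 - 1 = N + m by ring, show N + (m : ℤ) + 1 + 1 = N + (m + 2) by ring,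
        show N + (m : ℤ) + 1 = N + (m + 1) by ring, h0, h1, h2]
      rw [show N + ((m : ℤ) + 1) = N + m + 1 by ring]
      push_cast
      linear_combination (g.coeff (N + m + 1) - (N + m + 1) * twistSol b v g.coeff N (m + 1)
      - b * twistSol b v g.coeff N m) * hv

end Laurent

section Kloosterman

/-- The coordinate ring `ℂ[z,z⁻¹]` of the torus with coordinate `z`. -/
abbrev Rz : Type := ℂ[T;T⁻¹]

/-- The coordinate ring `ℂ[x,x⁻¹,z,z⁻¹]`, as Laurent polynomials in `x` over `ℂ[z,z⁻¹]`. -/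
abbrev Rxz : Type := Rz[T;T⁻¹]

/-- The coordinate `z`. -/
abbrev z : Rz := T 1

/-- The function `z / x`. -/
abbrev zDivX : Rxz := C z * T (-1)

/-- The relative twisted differential `x ∂/∂x + (x - z/x)` of `E^f`, `f = x + z/x`,
in the basis `dx/x` of relative differentials. -/
def relDiff : Rxz →ₗ[Rz] Rxz := lpEuler + LinearMap.mulLeft Rz (T 1 - zDivX)

/-- The Kloosterman module `Kl₂`, the cokernel of the relative twisted differential. -/
abbrev Kl2 : Type := Rxz ⧸ LinearMap.range relDiff

/-- The derivation `z ∂/∂z` of `ℂ[x,x⁻¹,z,z⁻¹]`. -/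
def eulerZ : Rxz →ₗ[ℂ] Rxz where
  toFun f := .ofCoeff (f.coeff.mapRange lpEuler (map_zero lpEuler))
  map_add' f g := by
    ext1 n
    simp
  map_smul' a f := by
    ext1 n
    simp

/-- The operator `z ∂/∂z + z ∂f/∂z = z ∂/∂z + z/x` on `ℂ[x,x⁻¹,z,z⁻¹]`. -/
def gaussManin : Rxz →ₗ[ℂ] Rxz := eulerZ + LinearMap.mulLeft ℂ zDivX

@[simp] theorem coeff_eulerZ (f : Rxz) (n : ℤ) : (eulerZ f).coeff n = lpEuler (f.coeff n) := by
  simp [eulerZ]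

theorem relDiff_apply (f : Rxz) : relDiff f = lpEuler f + (T 1 - zDivX) * f := rfl

theorem coeff_relDiff (f : Rxz) (n : ℤ) :
    (relDiff f).coeff n = n * f.coeff n + f.coeff (n - 1) - z * f.coeff (n + 1) := by
  rw [relDiff_apply, sub_mul, mul_assoc]
  simp only [AddMonoidAlgebra.coeff_add, AddMonoidAlgebra.coeff_sub, Finsupp.add_apply,
    Finsupp.sub_apply, coeff_lpEuler, coeff_C_mul, coeff_T_mul, sub_neg_eq_add]
  ring

theorem coeff_gaussManin (f : Rxz) (n : ℤ) :
    (gaussManin f).coeff n = lpEuler (f.coeff n) + z * f.coeff (n + 1) := by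
  change (eulerZ f + C z * T (-1) * f).coeff n = _
  rw [mul_assoc]
  simp only [AddMonoidAlgebra.coeff_add, Finsupp.add_apply, coeff_eulerZ, coeff_C_mul,
    coeff_T_mul, sub_neg_eq_add]

theorem gaussManin_relDiff (f : Rxz) : gaussManin (relDiff f) = relDiff (gaussManin f) := by
  ext1 n
  have h : ∀ (m : ℤ) (g : Rz), lpEuler ((m : Rz) * g) = m * lpEuler g := fun m g => by
    rw [← zsmul_eq_mul, map_zsmul, zsmul_eq_mul]
  have hz : ∀ g : Rz, lpEuler (z * g) = z * g + z * lpEuler g := fun g => by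
    rw [lpEuler_mul, lpEuler_T]
    simp
  simp only [coeff_gaussManin, coeff_relDiff, map_add, map_sub, h, hz]
  rw [show n + 1 - 1 = n by ring, show n - 1 + 1 = n by ring]
  push_cast
  ring

/-- The operator `z ∇_{∂/∂z}` on `Kl₂` given by the Gauss–Manin connection. -/
def kl2Nabla : Kl2 →ₗ[ℂ] Kl2 :=
  ((LinearMap.range relDiff).restrictScalars ℂ).mapQ ((LinearMap.range relDiff).restrictScalars ℂ)
      gaussManin (by
    rintro _ ⟨f, rfl⟩
    exact ⟨gaussManin f, (gaussManin_relDiff f).symm⟩)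

/-- The class `v₀` of `dx/x`. -/
def v0 : Kl2 := Submodule.Quotient.mk 1

/-- The class `v₁` of `dx`. -/
def v1 : Kl2 := Submodule.Quotient.mk (T 1)

/-- The coordinates of the class of `xⁿ dx/x` for `n ≥ 0`. -/
def redUp : ℕ → Fin 2 → Rz
  | 0 => ![1, 0]
  | 1 => ![0, 1]
  | n + 2 => z • redUp n - ((n + 1 : ℕ) : Rz) • redUp (n + 1)

/-- The coordinates of the class of `x⁻ⁿ dx/x` for `n ≥ 0`. -/
def redDown : ℕ → Fin 2 → Rz
  | 0 => ![1, 0]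
  | 1 => ![0, T (-1)]
  | n + 2 => (T (-1) : Rz) • (redDown n - ((n + 1 : ℕ) : Rz) • redDown (n + 1))

/-- The coordinates of the class of `xⁿ dx/x` on `v₀, v₁`. -/
def red : ℤ → Fin 2 → Rz
  | .ofNat n => redUp n
  | .negSucc n => redDown (n + 1)

theorem z_mul_inv : z * (T (-1) : Rz) = 1 := by
  rw [← T_add]
  simp

theorem red_rec (n : ℤ) : (n : Rz) • red n + red (n + 1) - z • red (n - 1) = 0 := by
  have up : ∀ m : ℕ, red (m : ℤ) = redUp m := fun m => rfl
  have down : ∀ m : ℕ, red (-(m : ℤ)) = redDown m := by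
    rintro (_ | m)
    · rfl
    · rfl
  obtain ⟨m, rfl | rfl⟩ := n.eq_nat_or_neg
  · rcases m with _ | m
    · have h1 : red (((0 : ℕ) : ℤ) + 1) = ![0, 1] := by
        have := up 1
        rw [redUp] at this
        exact this
      have h2 : red (((0 : ℕ) : ℤ) - 1) = ![0, T (-1)] := by
        have := down 1
        rw [redDown] at this
        exact this
      rw [h1, h2, Matrix.smul_cons, Matrix.smul_cons, smul_eq_mul, smul_eq_mul, z_mul_inv]
      simp
    · have h1 : red (((m + 1 : ℕ) : ℤ) + 1) = redUp (m + 2) := by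
        rw [← up]
        congr 1
      have h2 : red (((m + 1 : ℕ) : ℤ) - 1) = redUp m := by
        rw [← up]
        congr 1
        omega
      rw [h1, h2, up, redUp, Int.cast_natCast]
      abel
  · rcases m with _ | m
    · have h1 : red (-((0 : ℕ) : ℤ) + 1) = ![0, 1] := by
        have := up 1
        rw [redUp] at this
        exact this
      have h2 : red (-((0 : ℕ) : ℤ) - 1) = ![0, T (-1)] := by
        have := down 1
        rw [redDown] at this
        exact this
      rw [h1, h2, Matrix.smul_cons, Matrix.smul_cons, smul_eq_mul, smul_eq_mul, z_mul_inv]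
      simp
    · have h1 : red (-((m + 1 : ℕ) : ℤ) + 1) = redDown m := by
        rw [← down]
        congr 1
        omega
      have h2 : red (-((m + 1 : ℕ) : ℤ) - 1) = redDown (m + 2) := by
        rw [← down]
        congr 1
      rw [h1, h2, down, redDown, smul_smul, z_mul_inv, one_smul, Int.cast_neg, Int.cast_natCast,
        neg_smul]
      abel

/-- Coordinates on `v₀, v₁`, as a linear map on representatives. -/
def coordAux : Rxz →ₗ[Rz] Fin 2 → Rz :=
  Finsupp.linearCombination Rz red ∘ₗ (AddMonoidAlgebra.coeffLinearEquiv Rz).toLinearMap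

theorem coordAux_single (n : ℤ) (a : Rz) :
    coordAux (AddMonoidAlgebra.single n a) = a • red n :=
  Finsupp.linearCombination_single Rz a n

theorem coordAux_T (n : ℤ) : coordAux (T n) = red n := by
  rw [T, coordAux_single, one_smul]

theorem relDiff_T (n : ℤ) :
    relDiff (T n) = (n : Rz) • T n + T (n + 1) - z • T (n - 1) := by
  rw [relDiff_apply, lpEuler_T, sub_mul, ← T_add, mul_assoc, ← T_add, ← smul_eq_C_mul,
    add_comm 1 n, neg_add_eq_sub, add_sub_assoc]

theorem coordAux_relDiff (f : Rxz) : coordAux (relDiff f) = 0 := by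
  induction f using LaurentPolynomial.induction_on' with
  | add p q hp hq => rw [map_add, map_add, hp, hq, add_zero]
  | C_mul_T n a =>
    rw [← smul_eq_C_mul, map_smul, map_smul, relDiff_T, map_sub, map_add, map_smul, map_smul,
      coordAux_T, coordAux_T, coordAux_T, red_rec, smul_zero]

theorem red_zero : red 0 = ![1, 0] := by
  have : red 0 = redUp 0 := rfl
  rw [this, redUp]

theorem red_one : red 1 = ![0, 1] := by
  have : red 1 = redUp 1 := rfl
  rw [this, redUp]

/-- The class in `Kl₂` of `η dx/x`. -/
abbrev cls : Rxz →ₗ[Rz] Kl2 := (LinearMap.range relDiff).mkQ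

theorem cls_rec (n : ℤ) : (n : Rz) • cls (T n) + cls (T (n + 1)) - z • cls (T (n - 1)) = 0 := by
  rw [← map_smul, ← map_smul, ← map_add, ← map_sub, ← relDiff_T]
  exact (Submodule.Quotient.mk_eq_zero _).mpr ⟨_, rfl⟩

/-- The combination of `v₀, v₁` with given coefficients. -/
def combo : (Fin 2 → Rz) →ₗ[Rz] Kl2 := Fintype.linearCombination Rz ![v0, v1]

theorem combo_apply (c : Fin 2 → Rz) : combo c = c 0 • v0 + c 1 • v1 := by
  simp [combo, Fintype.linearCombination_apply, Fin.sum_univ_two]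

theorem cls_T (n : ℤ) : combo (red n) = cls (T n) := by
  have h0 : combo (red 0) = cls (T 0) := by
    rw [red_zero, combo_apply, T_zero]
    simp [v0]
  have h1 : combo (red 1) = cls (T 1) := by
    rw [red_one, combo_apply]
    simp [v1]
  have step : ∀ m : ℤ, combo (red (m + 1)) - cls (T (m + 1)) =
      z • (combo (red (m - 1)) - cls (T (m - 1))) - (m : Rz) • (combo (red m) - cls (T m)) := by
    intro m
    have e1 := congrArg combo (red_rec m)
    have e2 := cls_rec m
    rw [map_sub, map_add, map_smul, map_smul, map_zero] at e1
    rw [smul_sub, smul_sub, ← sub_eq_zero]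
    rw [← sub_eq_zero, sub_zero] at e1
    calc _ = ((m : Rz) • combo (red m) + combo (red (m + 1)) - z • combo (red (m - 1)))
          - ((m : Rz) • cls (T m) + cls (T (m + 1)) - z • cls (T (m - 1))) := by abel
      _ = 0 := by rw [e1, e2, sub_zero]
  have key : ∀ m : ℕ, (combo (red m) - cls (T m) = 0 ∧
      combo (red (m + 1)) - cls (T (m + 1)) = 0) := by
    intro m
    induction m with
    | zero => exact ⟨sub_eq_zero.mpr h0, sub_eq_zero.mpr h1⟩
    | succ m ih =>
      have e := step (m + 1)
      rw [add_sub_cancel_right, ih.1, ih.2, smul_zero, smul_zero, sub_zero] at e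
      push_cast
      exact ⟨ih.2, e⟩
  have key' : ∀ m : ℕ, (combo (red (-m)) - cls (T (-m)) = 0 ∧
      combo (red (-m + 1)) - cls (T (-m + 1)) = 0) := by
    intro m
    induction m with
    | zero => exact ⟨sub_eq_zero.mpr h0, sub_eq_zero.mpr h1⟩
    | succ m ih =>
      have e := step (-m)
      rw [ih.1, ih.2, smul_zero, sub_zero] at e
      have e' := congrArg (fun y => (T (-1) : Rz) • y) e
      rw [smul_smul, mul_comm, z_mul_inv, one_smul, smul_zero] at e'
      push_cast
      rw [neg_add, neg_add_cancel_right, ← sub_eq_add_neg]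
      exact ⟨e'.symm, ih.1⟩
  obtain ⟨m, rfl | rfl⟩ := n.eq_nat_or_neg
  · exact sub_eq_zero.mp (key m).1
  · exact sub_eq_zero.mp (key' m).1

/-- The coordinates on `v₀, v₁`. -/
def kl2Coord : Kl2 ≃ₗ[Rz] Fin 2 → Rz :=
  LinearEquiv.ofLinearMap
    ((LinearMap.range relDiff).liftQ coordAux (by
      rintro _ ⟨f, rfl⟩
      exact coordAux_relDiff f))
    combo
    (by
      refine LinearMap.ext fun c => ?_
      have h0 := coordAux_T 0
      rw [T_zero, red_zero] at h0
      have h1 := coordAux_T 1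
      rw [red_one] at h1
      rw [LinearMap.comp_apply, combo_apply, map_add, map_smul, map_smul, v0, v1,
        Submodule.liftQ_apply, Submodule.liftQ_apply, h0, h1]
      ext1 i
      fin_cases i <;> simp)
    (by
      refine Submodule.linearMap_qext _ (LinearMap.ext fun f => ?_)
      rw [LinearMap.comp_apply, LinearMap.comp_apply, LinearMap.comp_apply, LinearMap.id_apply,
        Submodule.mkQ_apply, Submodule.liftQ_apply]
      induction f using LaurentPolynomial.induction_on' with
      | add p q hp hq => rw [map_add, map_add, hp, hq, Submodule.Quotient.mk_add]
      | C_mul_T n a =>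
        rw [← smul_eq_C_mul, map_smul, map_smul, coordAux_T, cls_T, ← map_smul]
        rfl)

/-- The basis `v₀, v₁` of `Kl₂` over `ℂ[z,z⁻¹]`. -/
def kl2Basis : Module.Basis (Fin 2) Rz Kl2 := Module.Basis.ofEquivFun kl2Coord

theorem kl2Basis_zero : kl2Basis 0 = v0 := by
  rw [kl2Basis, Module.Basis.coe_ofEquivFun]
  change combo _ = _
  rw [combo_apply]
  simp

theorem kl2Basis_one : kl2Basis 1 = v1 := by
  rw [kl2Basis, Module.Basis.coe_ofEquivFun]
  change combo _ = _
  rw [combo_apply]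
  simp

/-- The matrix of `z ∇_{∂/∂z}` on `Kl₂` in the basis `v₀, v₁`. -/
def kl2Conn : Matrix (Fin 2) (Fin 2) Rz :=
  Matrix.of fun i j => kl2Basis.repr (kl2Nabla (kl2Basis j)) i

theorem gaussManin_T (n : ℤ) : gaussManin (T n) = z • T (n - 1) := by
  have h : ∀ m : ℤ, lpEuler ((T n : Rxz).coeff m) = 0 := by
    intro m
    rw [T_apply]
    split_ifs
    · rw [← T_zero, lpEuler_T]
      simp
    · exact map_zero _
  ext1 m
  rw [coeff_gaussManin, h, T_apply, zero_add]
  simp only [AddMonoidAlgebra.coeff_smul, Finsupp.smul_apply, T_apply, smul_eq_mul]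
  congr 1
  by_cases hm : n = m + 1
  · rw [if_pos hm, if_pos (by omega)]
  · rw [if_neg hm, if_neg (by omega)]

theorem kl2Nabla_v0 : kl2Nabla v0 = v1 := by
  change cls (gaussManin 1) = cls (T 1)
  have h := cls_rec 0
  rw [← T_zero, gaussManin_T, map_smul]
  rw [Int.cast_zero, zero_smul, zero_add, zero_add] at h
  exact (sub_eq_zero.mp h).symm

theorem kl2Nabla_v1 : kl2Nabla v1 = z • v0 := by
  change cls (gaussManin (T 1)) = z • cls 1
  rw [gaussManin_T, map_smul, sub_self, T_zero]

theorem kl2Conn_eq : kl2Conn = !![0, z; 1, 0] := by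
  have h0 : kl2Nabla (kl2Basis 0) = kl2Basis 1 := by
    rw [kl2Basis_zero, kl2Basis_one, kl2Nabla_v0]
  have h1 : kl2Nabla (kl2Basis 1) = z • kl2Basis 0 := by
    rw [kl2Basis_zero, kl2Basis_one, kl2Nabla_v1]
  ext1 i j
  rw [kl2Conn, Matrix.of_apply]
  fin_cases i <;> fin_cases j <;> simp [h0, h1]



/-- The operator `x ∂/∂x + (x - z/x)` on formal Laurent series in `x`, which is invertible. -/
def solveZero : LaurentSeries Rz ≃ₗ[Rz] LaurentSeries Rz :=
  LinearEquiv.ofBijective (twist 1 (-z)) (twist_bijective 1 (isUnit_T 1).neg)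

/-- The operator `x' ∂/∂x' + (z x' - 1/x')` on formal Laurent series in `x' = 1/x`,
which is invertible. -/
def solveInf : LaurentSeries Rz ≃ₗ[Rz] LaurentSeries Rz :=
  LinearEquiv.ofBijective (twist z (-1)) (twist_bijective z isUnit_one.neg)

/-- The formal solution `ψ₀` at `x = 0` of `(x ∂/∂x + (x - z/x)) ψ₀ = η`. -/
def psiZero (η : Rxz) : LaurentSeries Rz := solveZero.symm (expandZero η)

/-- The formal solution `ψ∞` at `x' = 0`, `x' = 1/x`, of
`(x' ∂/∂x' + (z x' - 1/x')) ψ∞ = -η`. -/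
def psiInf (η : Rxz) : LaurentSeries Rz := solveInf.symm (-expandInf η)

theorem twist_psiZero (η : Rxz) : twist 1 (-z) (psiZero η) = expandZero η :=
  solveZero.apply_symm_apply _

theorem twist_psiInf (η : Rxz) : twist z (-1) (psiInf η) = -expandInf η :=
  solveInf.apply_symm_apply _

/-- The sum of the residues at `x = 0` and `x = ∞` of `ψ · η'(-x) dx/x`, where `ψ` is the pair of
formal solutions attached to `η`; note that `dx/x = -dx'/x'` for `x' = 1/x`. -/
def kl2PairAux : Rxz →ₗ[Rz] Rxz →ₗ[Rz] Rz :=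
  LinearMap.mk₂ Rz
    (fun η η' => (psiZero η * expandZero (lpNeg η')).coeff 0
      - (psiInf η * expandInf (lpNeg η')).coeff 0)
    (fun η₁ η₂ η' => by
      simp only [psiZero, psiInf, map_add, neg_add, add_mul, HahnSeries.coeff_add]
      abel)
    (fun a η η' => by
      simp only [psiZero, psiInf, expandZero_smul, expandInf_smul, ← smul_neg, map_smul,
        smul_mul_ls, HahnSeries.coeff_smul, smul_sub])
    (fun η η₁ η₂ => by
      simp only [map_add, mul_add, HahnSeries.coeff_add]
      abel)
    (fun a η η' => by
      simp only [map_smul, expandZero_smul, expandInf_smul, mul_smul_ls,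
        HahnSeries.coeff_smul, smul_sub])

theorem kl2PairAux_apply (η η' : Rxz) : kl2PairAux η η' =
    (psiZero η * expandZero (lpNeg η')).coeff 0
      - (psiInf η * expandInf (lpNeg η')).coeff 0 := rfl

theorem coeff_zero_expand (f : Rxz) :
    (expandZero f).coeff 0 = (expandInf f).coeff 0 := by
  rw [coeff_expandZero, coeff_expandInf, neg_zero]

theorem coeff_zero_euler (f : LaurentSeries Rz) : (lsEuler f).coeff 0 = 0 := by
  rw [coeff_lsEuler, Int.cast_zero, zero_mul]

theorem expandZero_relDiff (f : Rxz) : expandZero (relDiff f) = twist 1 (-z) (expandZero f) := by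
  ext n
  rw [coeff_expandZero, coeff_relDiff, coeff_twist]
  simp only [coeff_expandZero]
  ring_nf

theorem expandInf_relDiff (f : Rxz) : expandInf (relDiff f) = -twist z (-1) (expandInf f) := by
  ext n
  rw [coeff_expandInf, coeff_relDiff, HahnSeries.coeff_neg, coeff_twist]
  simp only [coeff_expandInf]
  rw [show -(n - 1) = -n + 1 by ring, show -(n + 1) = -n - 1 by ring]
  push_cast
  ring_nf

theorem psiZero_relDiff (f : Rxz) : psiZero (relDiff f) = expandZero f := by
  rw [psiZero, expandZero_relDiff]
  exact solveZero.symm_apply_apply _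

theorem psiInf_relDiff (f : Rxz) : psiInf (relDiff f) = expandInf f := by
  rw [psiInf, expandInf_relDiff, neg_neg]
  exact solveInf.symm_apply_apply _

theorem lpNeg_relDiff (f : Rxz) :
    lpNeg (relDiff f) = lpEuler (lpNeg f) - (T 1 - zDivX) * lpNeg f := by
  have h1 : lpNeg (T 1 - zDivX : Rxz) = -(T 1 - zDivX) := by
    rw [map_sub, zDivX, ← smul_eq_C_mul, map_smul, lpNeg_T, lpNeg_T]
    simp only [Int.negOnePow_one, Int.negOnePow_neg, Units.val_neg, Units.val_one, Int.cast_neg,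
      Int.cast_one, map_neg, map_one, neg_mul, one_mul, smul_neg]
    ring
  rw [relDiff_apply, map_add, map_mul, lpNeg_euler, h1]
  ring

theorem psi_mul_relDiff (η f : Rxz) :
    (psiZero η * expandZero (lpNeg (relDiff f))).coeff 0 =
      -(expandZero (η * lpNeg f)).coeff 0 := by
  have hc : expandZero (T 1 - zDivX : Rxz) = HahnSeries.single 1 1 + HahnSeries.single (-1) (-z) := by
    rw [map_sub, zDivX, ← smul_eq_C_mul, expandZero_smul, expandZero_T, expandZero_T, smul_single_ls,
      HahnSeries.single_neg, sub_eq_add_neg]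
  have e : psiZero η * expandZero (lpNeg (relDiff f)) =
      lsEuler (psiZero η * expandZero (lpNeg f)) - expandZero (η * lpNeg f) := by
    rw [lpNeg_relDiff, map_sub, RingHom.map_mul expandZero, RingHom.map_mul expandZero, hc, expandZero_euler, lsEuler_mul,
      ← twist_psiZero η, twist_apply]
    ring_nf
  rw [e, HahnSeries.coeff_sub, coeff_zero_euler, zero_sub]

theorem psi_mul_relDiff' (η f : Rxz) :
    (psiInf η * expandInf (lpNeg (relDiff f))).coeff 0 =
      -(expandInf (η * lpNeg f)).coeff 0 := by
  have hc : expandInf (T 1 - zDivX : Rxz) =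
      -(HahnSeries.single 1 z + HahnSeries.single (-1) (-1)) := by
    rw [map_sub, zDivX, ← smul_eq_C_mul, expandInf_smul, expandInf_T, expandInf_T, neg_neg,
      smul_single_ls, HahnSeries.single_neg, neg_add, neg_neg, sub_eq_add_neg, add_comm]
  have e : psiInf η * expandInf (lpNeg (relDiff f)) =
      -lsEuler (psiInf η * expandInf (lpNeg f)) - expandInf (η * lpNeg f) := by
    have h2 : expandInf η = -twist z (-1) (psiInf η) := by rw [twist_psiInf, neg_neg]
    rw [lpNeg_relDiff, map_sub, RingHom.map_mul expandInf, RingHom.map_mul expandInf, hc, expandInf_euler, lsEuler_mul, h2,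
      twist_apply]
    ring_nf
  rw [e, HahnSeries.coeff_sub, HahnSeries.coeff_neg, coeff_zero_euler, neg_zero, zero_sub]

theorem kl2PairAux_left (f η' : Rxz) : kl2PairAux (relDiff f) η' = 0 := by
  rw [kl2PairAux_apply, psiZero_relDiff, psiInf_relDiff, ← map_mul, ← map_mul, coeff_zero_expand,
    sub_self]

theorem kl2PairAux_right (η f : Rxz) : kl2PairAux η (relDiff f) = 0 := by
  rw [kl2PairAux_apply, psi_mul_relDiff, psi_mul_relDiff', coeff_zero_expand, sub_self]

/-- The duality pairing on `Kl₂`, induced by Poincaré duality along the fibres and by the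
involution `x ↦ -x`. -/
def kl2Pair : Kl2 →ₗ[Rz] Kl2 →ₗ[Rz] Rz :=
  (LinearMap.range relDiff).liftQ
    (LinearMap.flip ((LinearMap.range relDiff).liftQ kl2PairAux.flip (by
      rintro _ ⟨f, rfl⟩
      exact LinearMap.ext fun η => kl2PairAux_right η f)))
    (by
      rintro _ ⟨f, rfl⟩
      refine LinearMap.ext fun y => ?_
      induction y using Submodule.Quotient.induction_on with
      | _ η' => exact kl2PairAux_left f η')

/-- The Gram matrix of the duality pairing of `Kl₂` in the basis `v₀, v₁`. -/
def kl2Gram : Matrix (Fin 2) (Fin 2) Rz :=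
  Matrix.of fun i j => kl2Pair (kl2Basis i) (kl2Basis j)

theorem kl2Pair_cls (η η' : Rxz) : kl2Pair (Submodule.Quotient.mk η) (Submodule.Quotient.mk η') =
    kl2PairAux η η' := rfl

theorem kl2Gram_eq : kl2Gram = !![0, 1; -1, 0] := by
  have a0 : ∀ n ≤ 0, (psiZero 1).coeff n = 0 := by
    refine coeff_eq_zero_of_twist (b := 1) (u := -z) (isUnit_T 1).neg _ 0 fun n hn => ?_
    rw [twist_psiZero, map_one, HahnSeries.coeff_one, if_neg (by omega)]
  have b0 : ∀ n ≤ 0, (psiInf 1).coeff n = 0 := by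
    refine coeff_eq_zero_of_twist (b := z) (u := -1) isUnit_one.neg _ 0 fun n hn => ?_
    rw [twist_psiInf, map_one, HahnSeries.coeff_neg, HahnSeries.coeff_one, if_neg (by omega),
      neg_zero]
  have b1 : (psiInf 1).coeff 1 = 1 := by
    have h := congrArg (fun f => HahnSeries.coeff f 0) (twist_psiInf 1)
    simp only [coeff_twist, map_one, HahnSeries.coeff_neg, HahnSeries.coeff_one, if_true] at h
    rw [b0 (0 - 1) (by omega), b0 0 le_rfl, zero_add] at h
    linear_combination -h
  have c0 : ∀ n ≤ 1, (psiZero (T 1)).coeff n = 0 := by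
    refine coeff_eq_zero_of_twist (b := 1) (u := -z) (isUnit_T 1).neg _ 1 fun n hn => ?_
    rw [twist_psiZero, expandZero_T, HahnSeries.coeff_single_of_ne (by omega)]
  have d0 : ∀ n ≤ -1, (psiInf (T 1)).coeff n = 0 := by
    refine coeff_eq_zero_of_twist (b := z) (u := -1) isUnit_one.neg _ (-1) fun n hn => ?_
    rw [twist_psiInf, expandInf_T, HahnSeries.coeff_neg, HahnSeries.coeff_single_of_ne (by omega),
      neg_zero]
  have d1 : (psiInf (T 1)).coeff 0 = 1 := by
    have h := congrArg (fun f => HahnSeries.coeff f (-1)) (twist_psiInf (T 1))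
    simp only [coeff_twist, expandInf_T, HahnSeries.coeff_neg, HahnSeries.coeff_single_same] at h
    rw [d0 (-1) le_rfl, d0 (-1 - 1) (by omega), neg_add_cancel] at h
    linear_combination -h
  have d2 : (psiInf (T 1)).coeff 1 = 0 := by
    have h := congrArg (fun f => HahnSeries.coeff f 0) (twist_psiInf (T 1))
    simp only [coeff_twist, expandInf_T, HahnSeries.coeff_neg] at h
    rw [HahnSeries.coeff_single_of_ne (by omega), d0 (0 - 1) (by omega), d1, zero_add,
      Int.cast_zero] at h
    linear_combination -h
  have neg1 : lpNeg (T 1 : Rxz) = (-1 : Rz) • T 1 := by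
    rw [lpNeg_T, smul_eq_C_mul]
    simp
  have p00 : kl2PairAux 1 1 = 0 := by
    rw [kl2PairAux_apply, map_one, map_one, map_one, mul_one, mul_one, a0 0 le_rfl, b0 0 le_rfl,
      sub_zero]
  have p01 : kl2PairAux 1 (T 1) = 1 := by
    rw [kl2PairAux_apply, neg1, expandZero_smul, expandInf_smul, expandZero_T, expandInf_T,
      mul_smul_ls, mul_smul_ls, HahnSeries.coeff_smul, HahnSeries.coeff_smul,
      HahnSeries.coeff_mul_single,
      HahnSeries.coeff_mul_single, a0 (0 - 1) (by omega), sub_neg_eq_add, zero_add, b1]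
    simp
  have p10 : kl2PairAux (T 1) 1 = -1 := by
    rw [kl2PairAux_apply, map_one, map_one, map_one, mul_one, mul_one, c0 0 (by omega), d1,
      zero_sub]
  have p11 : kl2PairAux (T 1) (T 1) = 0 := by
    rw [kl2PairAux_apply, neg1, expandZero_smul, expandInf_smul, expandZero_T, expandInf_T,
      mul_smul_ls, mul_smul_ls, HahnSeries.coeff_smul, HahnSeries.coeff_smul,
      HahnSeries.coeff_mul_single,
      HahnSeries.coeff_mul_single, c0 (0 - 1) (by omega), sub_neg_eq_add, zero_add, d2]
    simp
  ext1 i j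
  rw [kl2Gram, Matrix.of_apply]
  fin_cases i <;> fin_cases j
  · simpa [kl2Basis_zero, v0, kl2Pair_cls] using p00
  · simpa [kl2Basis_zero, kl2Basis_one, v0, v1, kl2Pair_cls] using p01
  · simpa [kl2Basis_zero, kl2Basis_one, v0, v1, kl2Pair_cls] using p10
  · simpa [kl2Basis_one, v1, kl2Pair_cls] using p11

end Kloosterman

section Symmetric

/-- For a rank-two connection with basis `v₀, v₁` and matrix `M` (that is,
`∇ v_j = ∑ i, M i j • v_i`), the matrix of the induced connection on the `k`-th symmetric power in
the basis `u_a = v₀^(k-a) v₁^a`, `0 ≤ a ≤ k`; the entry `(b, a)` is the coefficient of `u_b` in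
`∇ u_a = (k-a) v₀^(k-a-1) v₁^a ∇ v₀ + a v₀^(k-a) v₁^(a-1) ∇ v₁`. -/
def symConn (k : ℕ) (M : Matrix (Fin 2) (Fin 2) Rz) : Matrix (Fin (k + 1)) (Fin (k + 1)) Rz :=
  Matrix.of fun b a =>
    (if b = a then ((k - a : ℕ) : Rz) * M 0 0 + ((a : ℕ) : Rz) * M 1 1 else 0)
      + (if (b : ℕ) = a + 1 then ((k - a : ℕ) : Rz) * M 1 0 else 0)
      + (if (b : ℕ) + 1 = a then ((a : ℕ) : Rz) * M 0 1 else 0)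

/-- For an alternating pairing on a rank-two module with basis `v₀, v₁` and Gram matrix `G`, the
Gram matrix, in the basis `u_a = v₀^(k-a) v₁^a`, of the induced pairing on the `k`-th symmetric
power, viewed as the symmetric tensors in the `k`-th tensor power. -/
def symGram (k : ℕ) (G : Matrix (Fin 2) (Fin 2) Rz) : Matrix (Fin (k + 1)) (Fin (k + 1)) Rz :=
  Matrix.of fun a b =>
    if (a : ℕ) + b = k then
      C (((a : ℕ).factorial * (b : ℕ).factorial : ℂ) / k.factorial)
        * (G 0 1 ^ (k - a : ℕ) * G 1 0 ^ (a : ℕ))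
    else 0

/-- The matrix of `z ∇_{∂/∂z}` on `Sym^k Kl₂` in the basis `u_a = v₀^(k-a) v₁^a`. -/
def connMat (k : ℕ) : Matrix (Fin (k + 1)) (Fin (k + 1)) Rz := symConn k kl2Conn

/-- The Gram matrix of the duality pairing on `Sym^k Kl₂` in the basis `u_a = v₀^(k-a) v₁^a`. -/
def gramMat (k : ℕ) : Matrix (Fin (k + 1)) (Fin (k + 1)) Rz := symGram k kl2Gram

theorem kl2Gram_zero_one : kl2Gram 0 1 = C 1 := by
  rw [kl2Gram_eq]
  simp

theorem kl2Gram_one_zero : kl2Gram 1 0 = C (-1) := by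
  rw [kl2Gram_eq]
  simp

/-- The pairing of `Sym^k Kl₂` is horizontal. -/
theorem gram_conn (k : ℕ) :
    (connMat k).transpose * gramMat k + gramMat k * connMat k = 0 := by
  have entry : ∀ p q : Fin (k + 1),
      ((connMat k).transpose * gramMat k + gramMat k * connMat k) p q = 0 := by
    intro p q
    have g : ∀ a b : Fin (k + 1), gramMat k a b = if (a : ℕ) + b = k then
        C ((-1) ^ (a : ℕ) * ((a : ℕ).factorial * (b : ℕ).factorial : ℂ) / k.factorial) else 0 := by
      intro a b
      simp only [gramMat, symGram, Matrix.of_apply, kl2Gram_zero_one, kl2Gram_one_zero]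
      split_ifs
      · rw [← map_pow, ← map_pow, ← map_mul, ← map_mul]
        congr 1
        rw [one_pow]
        ring
      · rfl
    have c : ∀ a b : Fin (k + 1), connMat k b a =
        (if (b : ℕ) = a + 1 then ((k - a : ℕ) : Rz) else 0)
          + (if (b : ℕ) + 1 = a then ((a : ℕ) : Rz) * z else 0) := by
      intro a b
      simp [connMat, symConn, kl2Conn_eq]
    rw [Matrix.add_apply, Matrix.mul_apply, Matrix.mul_apply]
    have hp : (p : ℕ) ≤ k := by omega
    have hq : (q : ℕ) ≤ k := by omega
    have e1 : ∀ a : Fin (k + 1), (connMat k).transpose p a * gramMat k a q =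
        if a = (⟨k - q, by omega⟩ : Fin (k + 1)) then connMat k a p * gramMat k a q else 0 := by
      intro a
      rw [Matrix.transpose_apply]
      split_ifs with h
      · rfl
      · rw [g, if_neg, mul_zero]
        intro h'
        exact h (Fin.ext (by simp only; omega))
    have e2 : ∀ a : Fin (k + 1), gramMat k p a * connMat k a q =
        if a = (⟨k - p, by omega⟩ : Fin (k + 1)) then gramMat k p a * connMat k a q else 0 := by
      intro a
      split_ifs with h
      · rfl
      · rw [g, if_neg, zero_mul]
        intro h'
        exact h (Fin.ext (by simp only; omega))
    rw [Finset.sum_congr rfl fun a _ => e1 a, Finset.sum_congr rfl fun a _ => e2 a,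
      Finset.sum_ite_eq', Finset.sum_ite_eq', if_pos (Finset.mem_univ _),
      if_pos (Finset.mem_univ _), g, g, c, c]
    simp only
    rw [if_pos (show k - (q : ℕ) + q = k by omega), if_pos (show (p : ℕ) + (k - p) = k by omega)]
    by_cases h1 : (p : ℕ) + q + 1 = k
    · rw [if_pos (show k - (q : ℕ) = p + 1 by omega), if_neg (show ¬ k - (q : ℕ) + 1 = p by omega),
        if_pos (show k - (p : ℕ) = q + 1 by omega), if_neg (show ¬ k - (p : ℕ) + 1 = q by omega),
        show k - (q : ℕ) = p + 1 by omega, show k - (p : ℕ) = q + 1 by omega, add_zero, add_zero,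
        ← map_natCast (C : ℂ →+* Rz), ← map_natCast (C : ℂ →+* Rz), ← map_mul, ← map_mul, ← map_add]
      rw [Nat.factorial_succ, Nat.factorial_succ]
      convert map_zero (C : ℂ →+* Rz) using 2
      push_cast
      ring
    · by_cases h2 : (p : ℕ) + q = k + 1
      · obtain ⟨p', hp'⟩ : ∃ p', (p : ℕ) = p' + 1 := ⟨p - 1, by omega⟩
        obtain ⟨q', hq'⟩ : ∃ q', (q : ℕ) = q' + 1 := ⟨q - 1, by omega⟩
        rw [if_neg (show ¬ k - (q : ℕ) = p + 1 by omega), if_pos (show k - (q : ℕ) + 1 = p by omega),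
          if_neg (show ¬ k - (p : ℕ) = q + 1 by omega), if_pos (show k - (p : ℕ) + 1 = q by omega),
          show k - (q : ℕ) = p' by omega, show k - (p : ℕ) = q' by omega, zero_add, zero_add,
          hp', hq', ← map_natCast (C : ℂ →+* Rz), ← map_natCast (C : ℂ →+* Rz),
          mul_right_comm, ← mul_assoc _ _ z, ← add_mul, ← map_mul, ← map_mul,
          ← map_add]
        rw [Nat.factorial_succ, Nat.factorial_succ]
        convert zero_mul z using 2
        convert map_zero (C : ℂ →+* Rz) using 2
        push_cast
        ring
      · rw [if_neg (show ¬ k - (q : ℕ) = p + 1 by omega), if_neg (show ¬ k - (q : ℕ) + 1 = p by omega),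
          if_neg (show ¬ k - (p : ℕ) = q + 1 by omega), if_neg (show ¬ k - (p : ℕ) + 1 = q by omega)]
        simp
  ext1 p q
  exact entry p q

theorem euler_gram (k : ℕ) (a b : Fin (k + 1)) : lpEuler (gramMat k a b) = 0 := by
  have h : ∀ c : ℂ, lpEuler (C c : Rz) = 0 := by
    intro c
    rw [← mul_one (C c), ← smul_eq_C_mul, map_smul, ← T_zero, lpEuler_T, Int.cast_zero, zero_smul,
      smul_zero]
  rw [gramMat, symGram, Matrix.of_apply, kl2Gram_zero_one, kl2Gram_one_zero]
  split_ifs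
  · rw [← map_pow, ← map_pow,
      ← map_mul, ← map_mul, h]
  · exact map_zero _

end Symmetric

section Connection

variable {K : Type*} [CommRing K] {ι : Type*} [Fintype ι]

/-- The connection with matrix `M` on a free module over a ring `K` with derivation `δ`, acting on
coordinate vectors by `f ↦ δ f + M f`. -/
def connOp [Module ℂ K] [SMulCommClass ℂ K K] (δ : K →ₗ[ℂ] K) (M : Matrix ι ι K) :
    (ι → K) →ₗ[ℂ] (ι → K) where
  toFun f := (fun i => δ (f i)) + M.mulVec f
  map_add' f g := by
    ext i
    simp [Matrix.mulVec_add]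
    abel
  map_smul' c f := by
    ext i
    simp [Matrix.mulVec_smul]

/-- The bilinear form with Gram matrix `G`. -/
def gramPair (G : Matrix ι ι K) (f g : ι → K) : K := f ⬝ᵥ G.mulVec g

end Connection
section Cohomology

/-- Algebraic sections of `Sym^k Kl₂` on the torus, in coordinates on the basis
`u_a = v₀^(k-a) v₁^a`. A section `m` also stands for the one-form `m dz/z`. -/
abbrev Sec (k : ℕ) : Type := Fin (k + 1) → Rz

/-- The formalization of `Sym^k Kl₂` at `z = 0` (in the variable `z`), or at `z = ∞` (in the variable
`w = 1/z`), in coordinates on the basis `u_a = v₀^(k-a) v₁^a`. -/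
abbrev Formal (k : ℕ) : Type := Fin (k + 1) → LaurentSeries ℂ

/-- The connection `z ∇_{∂/∂z}` of `Sym^k Kl₂`. -/
def nabla (k : ℕ) : Sec k →ₗ[ℂ] Sec k := connOp lpEuler (connMat k)

/-- The formal connection `z ∇_{∂/∂z}` at `z = 0`. -/
def nablaZero (k : ℕ) : Formal k →ₗ[ℂ] Formal k := connOp lsEuler ((connMat k).map expandZero)

/-- The formal connection `z ∇_{∂/∂z}` at `z = ∞`; there `z ∂/∂z = -w ∂/∂w`. -/
def nablaInf (k : ℕ) : Formal k →ₗ[ℂ] Formal k := connOp (-lsEuler) ((connMat k).map expandInf)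

/-- The formalization of sections at `z = 0`. -/
def secZero (k : ℕ) : Sec k →ₗ[ℂ] Formal k where
  toFun f a := expandZero (f a)
  map_add' f g := by
    ext1 a
    exact map_add _ _ _
  map_smul' c f := by
    ext1 a
    exact expandZero_smul _ _

/-- The formalization of sections at `z = ∞`. -/
def secInf (k : ℕ) : Sec k →ₗ[ℂ] Formal k where
  toFun f a := expandInf (f a)
  map_add' f g := by
    ext1 a
    exact map_add _ _ _
  map_smul' c f := by
    ext1 a
    exact expandInf_smul _ _

theorem nablaZero_secZero (k : ℕ) (f : Sec k) :
    nablaZero k (secZero k f) = secZero k (nabla k f) := by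
  ext1 a
  simp only [nablaZero, connOp, secZero, nabla, LinearMap.coe_mk, AddHom.coe_mk, Pi.add_apply,
    map_add, expandZero_euler, Matrix.mulVec, dotProduct, map_sum, map_mul, Matrix.map_apply]

theorem nablaInf_secInf (k : ℕ) (f : Sec k) :
    nablaInf k (secInf k f) = secInf k (nabla k f) := by
  ext1 a
  simp only [nablaInf, connOp, secInf, nabla, LinearMap.coe_mk, AddHom.coe_mk, Pi.add_apply,
    map_add, expandInf_euler, Matrix.mulVec, dotProduct, map_sum, map_mul, Matrix.map_apply,
    LinearMap.neg_apply]

/-- The de Rham cohomology `H¹_dR(𝔾ₘ, Sym^k Kl₂)`. -/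
abbrev H1dR (k : ℕ) : Type := Sec k ⧸ LinearMap.range (nabla k)

/-- The cocycles `(m̂₀, m̂_∞, ω)` representing classes with compact support: `m̂₀` and `m̂_∞` are
formal primitives of `ω` at `0` and at `∞`. -/
def cocycles (k : ℕ) : Submodule ℂ (Formal k × Formal k × Sec k) where
  carrier := {m | nablaZero k m.1 = secZero k m.2.2 ∧ nablaInf k m.2.1 = secInf k m.2.2}
  zero_mem' := by simp
  add_mem' := by
    rintro a b ⟨h1, h2⟩ ⟨h3, h4⟩
    simp [h1, h2, h3, h4]
  smul_mem' := by
    rintro c a ⟨h1, h2⟩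
    simp [h1, h2]

/-- The space of cocycles, with its structure of complex vector space. -/
def Cocycle (k : ℕ) : Type := cocycles k

instance (k : ℕ) : AddCommGroup (Cocycle k) := (cocycles k).addCommGroup

instance (k : ℕ) : Module ℂ (Cocycle k) := (cocycles k).module

/-- The coboundary `φ ↦ (φ, φ, ∇ φ)`. -/
def coboundary (k : ℕ) : Sec k →ₗ[ℂ] Cocycle k where
  toFun φ := ⟨(secZero k φ, secInf k φ, nabla k φ), nablaZero_secZero k φ, nablaInf_secInf k φ⟩
  map_add' φ ψ := Subtype.ext (by simp only [map_add]; rfl)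
  map_smul' c φ := Subtype.ext (by simp only [map_smul]; rfl)

/-- The de Rham cohomology with compact support `H¹_{dR,c}(𝔾ₘ, Sym^k Kl₂)`. -/
abbrev H1c (k : ℕ) : Type := Cocycle k ⧸ LinearMap.range (coboundary k)

/-- The form underlying a cocycle. -/
def cocycleForm (k : ℕ) : Cocycle k →ₗ[ℂ] Sec k where
  toFun m := m.1.2.2
  map_add' _ _ := rfl
  map_smul' _ _ := rfl

/-- The natural map from cohomology with compact support to cohomology. -/
def forget (k : ℕ) : H1c k →ₗ[ℂ] H1dR k :=
  (LinearMap.range (coboundary k)).mapQ (LinearMap.range (nabla k)) (cocycleForm k) (by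
    rintro _ ⟨φ, rfl⟩
    exact ⟨φ, rfl⟩)

/-- The middle de Rham cohomology `H¹_{dR,mid}(𝔾ₘ, Sym^k Kl₂)`. -/
abbrev H1mid (k : ℕ) : Submodule ℂ (H1dR k) := LinearMap.range (forget k)

/-- The duality pairing of formal sections at `z = 0`. -/
def pairZero (k : ℕ) : Formal k → Formal k → LaurentSeries ℂ :=
  gramPair ((gramMat k).map expandZero)

/-- The duality pairing of formal sections at `z = ∞`. -/
def pairInf (k : ℕ) : Formal k → Formal k → LaurentSeries ℂ :=
  gramPair ((gramMat k).map expandInf)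

theorem gramPair_add_left {K ι : Type*} [CommRing K] [Fintype ι] (G : Matrix ι ι K)
    (f g h : ι → K) : gramPair G (f + g) h = gramPair G f h + gramPair G g h :=
  add_dotProduct _ _ _

theorem gramPair_add_right {K ι : Type*} [CommRing K] [Fintype ι] (G : Matrix ι ι K)
    (f g h : ι → K) : gramPair G f (g + h) = gramPair G f g + gramPair G f h := by
  rw [gramPair, Matrix.mulVec_add, dotProduct_add]
  rfl

theorem gramPair_smul_left {ι : Type*} [Fintype ι] (G : Matrix ι ι (LaurentSeries ℂ))
    (c : ℂ) (f g : ι → LaurentSeries ℂ) : gramPair G (c • f) g = c • gramPair G f g := by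
  simp only [gramPair, dotProduct, Pi.smul_apply, Finset.smul_sum, smul_mul_ls]

theorem gramPair_smul_right {ι : Type*} [Fintype ι] (G : Matrix ι ι (LaurentSeries ℂ))
    (c : ℂ) (f g : ι → LaurentSeries ℂ) : gramPair G f (c • g) = c • gramPair G f g := by
  simp only [gramPair, dotProduct, Matrix.mulVec, Pi.smul_apply, mul_smul_ls, ← Finset.smul_sum]

/-- Leibniz rule for a horizontal pairing. -/
theorem gramPair_connOp {ι : Type*} [Fintype ι]
    (δ : LaurentSeries ℂ →ₗ[ℂ] LaurentSeries ℂ)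
    (hδ : ∀ f g, δ (f * g) = δ f * g + f * δ g) (M G : Matrix ι ι (LaurentSeries ℂ))
    (hG : ∀ a b, δ (G a b) = 0) (hM : M.transpose * G + G * M = 0) (f g : ι → LaurentSeries ℂ) :
    gramPair G (connOp δ M f) g + gramPair G f (connOp δ M g) = δ (gramPair G f g) := by
  have h1 : δ (gramPair G f g) =
      gramPair G (fun i => δ (f i)) g + gramPair G f (fun i => δ (g i)) := by
    simp only [gramPair, dotProduct, Matrix.mulVec, map_sum, hδ, hG, zero_mul, zero_add,
      Finset.sum_add_distrib]
  have h2 : gramPair G (M.mulVec f) g + gramPair G f (M.mulVec g) = 0 := by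
    have e : gramPair (M.transpose * G + G * M) f g = 0 := by
      rw [hM, gramPair, Matrix.zero_mulVec, dotProduct_zero]
    rw [← e, gramPair, gramPair, gramPair, Matrix.add_mulVec, dotProduct_add,
      ← Matrix.mulVec_mulVec, ← Matrix.mulVec_mulVec, Matrix.dotProduct_mulVec f M.transpose,
      Matrix.vecMul_transpose]
  change gramPair G ((fun i => δ (f i)) + M.mulVec f) g
    + gramPair G f ((fun i => δ (g i)) + M.mulVec g) = _
  rw [gramPair_add_left, gramPair_add_right, h1]
  linear_combination h2

theorem pairZero_nabla (k : ℕ) (f g : Formal k) :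
    pairZero k (nablaZero k f) g + pairZero k f (nablaZero k g) = lsEuler (pairZero k f g) := by
  refine gramPair_connOp lsEuler lsEuler_mul _ _ (fun a b => ?_) ?_ f g
  · rw [Matrix.map_apply, ← expandZero_euler, euler_gram, map_zero]
  · rw [← Matrix.transpose_map, ← Matrix.map_mul, ← Matrix.map_mul,
      ← Matrix.map_add _ (map_add expandZero), gram_conn, Matrix.map_zero _ (map_zero expandZero)]

theorem pairInf_nabla (k : ℕ) (f g : Formal k) :
    pairInf k (nablaInf k f) g + pairInf k f (nablaInf k g) = -lsEuler (pairInf k f g) := by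
  refine gramPair_connOp (-lsEuler) (fun f g => ?_) _ _ (fun a b => ?_) ?_ f g
  · rw [LinearMap.neg_apply, LinearMap.neg_apply, LinearMap.neg_apply, lsEuler_mul]
    ring
  · rw [LinearMap.neg_apply, Matrix.map_apply, ← expandInf_euler, euler_gram, map_zero]
  · rw [← Matrix.transpose_map, ← Matrix.map_mul, ← Matrix.map_mul,
      ← Matrix.map_add _ (map_add expandInf), gram_conn, Matrix.map_zero _ (map_zero expandInf)]

theorem pairZero_sec (k : ℕ) (f g : Sec k) :
    pairZero k (secZero k f) (secZero k g) = expandZero (gramPair (gramMat k) f g) := by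
  simp only [pairZero, secZero, gramPair, LinearMap.coe_mk, AddHom.coe_mk, Matrix.mulVec,
    dotProduct, map_sum, map_mul, Matrix.map_apply]

theorem pairInf_sec (k : ℕ) (f g : Sec k) :
    pairInf k (secInf k f) (secInf k g) = expandInf (gramPair (gramMat k) f g) := by
  simp only [pairInf, secInf, gramPair, LinearMap.coe_mk, AddHom.coe_mk, Matrix.mulVec,
    dotProduct, map_sum, map_mul, Matrix.map_apply]

theorem const_euler (f : LaurentSeries ℂ) : (lsEuler f).coeff 0 = 0 := by
  rw [coeff_lsEuler, Int.cast_zero, zero_mul]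

/-- The sum of the residues at `0` and at `∞` of `⟨m̂, ω⟩`, where `ω` stands for `ω dz/z`;
note that `dz/z = -dw/w` for `w = 1/z`. -/
def pairAux (k : ℕ) : Cocycle k →ₗ[ℂ] Sec k →ₗ[ℂ] ℂ :=
  LinearMap.mk₂ ℂ
    (fun m ω => (pairZero k m.1.1 (secZero k ω)).coeff 0
      - (pairInf k m.1.2.1 (secInf k ω)).coeff 0)
    (fun m₁ m₂ ω => by
      change (pairZero k (m₁.1.1 + m₂.1.1) _).coeff 0 - (pairInf k (m₁.1.2.1 + m₂.1.2.1) _).coeff 0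
        = _
      simp only [pairZero, pairInf, gramPair_add_left, HahnSeries.coeff_add]
      abel)
    (fun c m ω => by
      change (pairZero k (c • m.1.1) _).coeff 0 - (pairInf k (c • m.1.2.1) _).coeff 0 = _
      simp only [pairZero, pairInf, gramPair_smul_left, HahnSeries.coeff_smul, smul_sub])
    (fun m ω₁ ω₂ => by
      simp only [pairZero, pairInf, map_add, gramPair_add_right, HahnSeries.coeff_add]
      abel)
    (fun c m ω => by
      simp only [pairZero, pairInf, map_smul, gramPair_smul_right, HahnSeries.coeff_smul,
        smul_sub])

theorem pairAux_apply (k : ℕ) (m : Cocycle k) (ω : Sec k) : pairAux k m ω =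
    (pairZero k m.1.1 (secZero k ω)).coeff 0 - (pairInf k m.1.2.1 (secInf k ω)).coeff 0 := rfl

theorem pairAux_coboundary (k : ℕ) (φ ω : Sec k) : pairAux k (coboundary k φ) ω = 0 := by
  rw [pairAux_apply]
  change (pairZero k (secZero k φ) (secZero k ω)).coeff 0
    - (pairInf k (secInf k φ) (secInf k ω)).coeff 0 = 0
  rw [pairZero_sec, pairInf_sec, coeff_expandZero, coeff_expandInf, neg_zero, sub_self]

theorem pairAux_nabla (k : ℕ) (m : Cocycle k) (φ : Sec k) : pairAux k m (nabla k φ) = 0 := by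
  have e0 := congrArg (fun f => HahnSeries.coeff f 0) (pairZero_nabla k m.1.1 (secZero k φ))
  have e1 := congrArg (fun f => HahnSeries.coeff f 0) (pairInf_nabla k m.1.2.1 (secInf k φ))
  rw [m.2.1, nablaZero_secZero, pairZero_sec] at e0
  rw [m.2.2, nablaInf_secInf, pairInf_sec] at e1
  simp only [HahnSeries.coeff_add, HahnSeries.coeff_neg, const_euler, coeff_expandZero,
    coeff_expandInf, neg_zero] at e0 e1
  rw [pairAux_apply]
  linear_combination e0 - e1

/-- The de Rham intersection pairing `H¹_{dR,c} ⊗ H¹_{dR} → ℂ`. -/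
def deRhamPair (k : ℕ) : H1c k →ₗ[ℂ] H1dR k →ₗ[ℂ] ℂ :=
  (LinearMap.range (coboundary k)).liftQ
    (LinearMap.flip ((LinearMap.range (nabla k)).liftQ (pairAux k).flip (by
      rintro _ ⟨φ, rfl⟩
      exact LinearMap.ext fun m => pairAux_nabla k m φ)))
    (by
      rintro _ ⟨φ, rfl⟩
      refine LinearMap.ext fun y => ?_
      induction y using Submodule.Quotient.induction_on with
      | _ ω => exact pairAux_coboundary k φ ω)

theorem deRhamPair_mk (k : ℕ) (m : Cocycle k) (ω : Sec k) :
    deRhamPair k (Submodule.Quotient.mk m) (Submodule.Quotient.mk ω) = pairAux k m ω := rfl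

/-- A class with compact support that vanishes in cohomology is orthogonal to the middle
cohomology. -/
theorem deRhamPair_ker (k : ℕ) (x : H1c k) (hx : forget k x = 0) (y : H1mid k) :
    deRhamPair k x y = 0 := by
  obtain ⟨_, y', rfl⟩ := y
  induction x using Submodule.Quotient.induction_on with
  | _ m =>
  induction y' using Submodule.Quotient.induction_on with
  | _ n =>
  obtain ⟨φ, hφ⟩ := (Submodule.Quotient.mk_eq_zero _).mp hx
  have hm : (Submodule.Quotient.mk m : H1c k) = Submodule.Quotient.mk (m - coboundary k φ) := by
    rw [Submodule.Quotient.eq]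
    exact ⟨φ, by rw [sub_sub_cancel]⟩
  change deRhamPair k (Submodule.Quotient.mk m) (Submodule.Quotient.mk n.1.2.2) = 0
  rw [hm, deRhamPair_mk]
  set m' := m - coboundary k φ with hm'
  have hz : m'.1.2.2 = 0 := by
    change m.1.2.2 - nabla k φ = 0
    rw [hφ]
    exact sub_self _
  have e0 := congrArg (fun f => HahnSeries.coeff f 0) (pairZero_nabla k m'.1.1 n.1.1)
  have e1 := congrArg (fun f => HahnSeries.coeff f 0) (pairInf_nabla k m'.1.2.1 n.1.2.1)
  have z0 : ∀ g, pairZero k 0 g = 0 := fun g => by simp [pairZero, gramPair, dotProduct]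
  have z1 : ∀ g, pairInf k 0 g = 0 := fun g => by simp [pairInf, gramPair, dotProduct]
  rw [m'.2.1, n.2.1, hz, map_zero, z0, zero_add] at e0
  rw [m'.2.2, n.2.2, hz, map_zero, z1, zero_add] at e1
  simp only [HahnSeries.coeff_neg, const_euler, neg_zero] at e0 e1
  rw [pairAux_apply, e0, e1, sub_zero]

/-- The pairing `H¹_{dR,c} ⊗ H¹_{dR,mid} → ℂ`, restricted from `deRhamPair`. -/
def deRhamPairMid (k : ℕ) : H1c k →ₗ[ℂ] H1mid k →ₗ[ℂ] ℂ :=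
  (deRhamPair k).compl₂ (H1mid k).subtype

theorem ker_forget_le (k : ℕ) :
    LinearMap.ker (forget k) ≤ LinearMap.ker (deRhamPairMid k) := fun x hx =>
  LinearMap.mem_ker.mpr (LinearMap.ext fun y => deRhamPair_ker k x (LinearMap.mem_ker.mp hx) y)

/-- The de Rham intersection pairing on middle cohomology: a class in the first variable is lifted
to cohomology with compact support. -/
def midPair (k : ℕ) : H1mid k →ₗ[ℂ] H1mid k →ₗ[ℂ] ℂ :=
  (LinearMap.ker (forget k)).liftQ (deRhamPairMid k) (ker_forget_le k) ∘ₗ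
    (forget k).quotKerEquivRange.symm.toLinearMap

theorem midPair_apply (k : ℕ) (x y : H1c k) :
    midPair k ⟨forget k x, x, rfl⟩ ⟨forget k y, y, rfl⟩ = deRhamPair k x (forget k y) := by
  have h : (forget k).quotKerEquivRange.symm ⟨forget k x, x, rfl⟩ = Submodule.Quotient.mk x := by
    rw [LinearEquiv.symm_apply_eq]
    rfl
  rw [midPair, LinearMap.comp_apply, LinearEquiv.coe_coe, h]
  rfl

/-- The class `ω_i` of `z^i v₀^k dz/z`. -/
def omega (k i : ℕ) : H1dR k := Submodule.Quotient.mk (Pi.single 0 (T i))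

/-- The power series `∑ ((2n-1)!!)³ / (2^(5n) n!) w^n`. With `w = 4/t²`, the function
`4 w^(-1/2) I₀(t) K₀(t)` of the modified Bessel functions has this asymptotic expansion
as `t → ∞`. -/
def besselSeries : PowerSeries ℂ :=
  PowerSeries.mk fun n => ((2 * n - 1).doubleFactorial : ℂ) ^ 3 / (2 ^ (5 * n) * n.factorial)

/-- The constants `γ_{k,i}`: if `4 ∣ k`, the coefficient of `w^i` in
`2^k (I₀(t) K₀(t))^(k/2) ∼ w^(k/4) (∑ ((2n-1)!!)³ / (2^(5n) n!) w^n)^(k/2)`, and `0` otherwise. -/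
def gammaConst (k i : ℕ) : ℂ :=
  if 4 ∣ k ∧ k / 4 ≤ i then PowerSeries.coeff (i - k / 4) (besselSeries ^ (k / 2)) else 0

/-- The classes `ω_i - γ_{k,i} ω_{k/4}`, which are the `ω_i` if `k` is not a multiple of `4`. -/
def omegaMid (k i : ℕ) : H1dR k := omega k i - gammaConst k i • omega k (k / 4)

/-- The integer `k' = ⌊(k-1)/2⌋` for `k ≥ 1`. -/
def kHalf (k : ℕ) : ℕ := (k - 1) / 2

/-- The index set: `{1, …, k'}`, without `k/4` if `4 ∣ k`. -/
abbrev MidIndex (k : ℕ) : Type := {i : ℕ // 1 ≤ i ∧ i ≤ kHalf k ∧ 4 * i ≠ k}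

end Cohomology

end SymKl

end

/-! Give `z^n u_a` the degree `2n + a`, so that `v₁` counts as `z^(1/2) v₀`. Then `z ∇_{∂/∂z}` is
the sum of the Euler operator, of degree 0, and of a symbol of degree 1, the derivation `v₀ ↦ v₁`,
`v₁ ↦ z v₀`. Solving `∇ m = ω` at infinity is successive approximation by decreasing degree,
governed by this symbol.

For odd `k` the symbol is invertible and every form has a formal primitive at infinity. For `k = 2p`
its kernel is spanned by the `z^n (v₁² - z v₀²)^p`, and its cokernel is a line in each even degree.
The kernel lifts to a true eigensection `Q` with eigenvalue `p/2`, the `p`-th power of a section of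
`Sym²` whose `v₁²`-coefficient is the Bessel series (`exists_horizontal`). Pairing with `Q` detects
the cokernel. Since `z^n Q` has eigenvalue `n + p/2`, the defect can be removed in every degree
except `p`; for `4 ∣ k` the coefficient of `w^(-k/4)` in `⟨ω, Q⟩` is therefore an obstruction, and
its value on `ω_i` is `γ_{k,i}`. This explains `ω'_i` (`exists_nablaInf_eq_of_bessel`).

At `z = 0` the residue is nilpotent, so forms of order at least 1 have primitives of order at least
1; pairing with a horizontal section that starts with `u_k` shows that `ω_0` is obstructed.

The primitive of `ω'_i` at 0 contributes nothing to the pairing with `ω'_j`, at least for `i + j ≤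
k' + 1`, and the one at infinity contributes its coefficient of `z^(-j) u_k`, of degree `k - 2j`.
The primitive has degree at most `2i`, hence the zeros for `i + j ≤ k'`; on the antidiagonal the
coefficient is a leading one. For odd `k` it comes from a two-term recursion (`leadingCoeff_odd`),
for even `k` from pairing with `Q` (`leadingCoeff_even`), where the self-pairing of `(v₁² - z
v₀²)^p` brings in the central binomial coefficient.

The non-zero antidiagonal gives linear independence. For spanning, the same degree reductions show
that `ω_0, …, ω_{k'}` generate `H¹_dR`, and a combination in the middle cohomology must satisfy both
obstruction equations, which makes it a combination of the `ω'_i`. -/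

noncomputable section

namespace SymKl

open LaurentPolynomial

/-! ### Extension of coordinate vectors by zero, and the connection on them -/

section Extension

variable {K : Type*} [CommRing K]

/-- The extension by zero to all integers of a vector indexed by `0, …, k`. -/
def extendZero {k : ℕ} (f : Fin (k + 1) → K) (a : ℤ) : K :=
  if h : 0 ≤ a ∧ a ≤ k then f ⟨a.toNat, by omega⟩ else 0

theorem extendZero_fin {k : ℕ} (f : Fin (k + 1) → K) (a : Fin (k + 1)) :
    extendZero f (a : ℕ) = f a := by
  rw [extendZero, dif_pos (by omega)]
  congr

theorem extendZero_of_notMem {k : ℕ} (f : Fin (k + 1) → K) {a : ℤ} (h : a < 0 ∨ (k : ℤ) < a) :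
    extendZero f a = 0 := by
  rw [extendZero, dif_neg (by omega)]

theorem sum_ite_extendZero {k : ℕ} (f : Fin (k + 1) → K) (t : ℤ) (h : ℤ → K) :
    ∑ a : Fin (k + 1), (if ((a : ℕ) : ℤ) = t then h (a : ℕ) * f a else 0) =
      h t * extendZero f t := by
  by_cases ht : 0 ≤ t ∧ t ≤ k
  · obtain ⟨m, rfl⟩ := Int.eq_ofNat_of_zero_le ht.1
    have hm : m < k + 1 := by omega
    rw [Finset.sum_eq_single (⟨m, hm⟩ : Fin (k + 1))]
    · rw [if_pos rfl]
      congr 1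
      exact (extendZero_fin f ⟨m, hm⟩).symm
    · intro b _ hb
      rw [if_neg]
      intro h'
      exact hb (Fin.ext (by simpa using h'))
    · simp
  · rw [extendZero_of_notMem f (by omega), mul_zero]
    refine Finset.sum_eq_zero fun a _ => if_neg ?_
    omega

theorem mulVec_connMat (k : ℕ) (φ : Rz →+* K) (f : Fin (k + 1) → K) (b : Fin (k + 1)) :
    ((connMat k).map φ).mulVec f b =
      ((k : K) - (b : ℕ) + 1) * extendZero f ((b : ℕ) - 1)
        + ((b : ℕ) + 1) * φ z * extendZero f ((b : ℕ) + 1) := by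
  have e := sum_ite_extendZero f ((b : ℕ) - 1) (fun a => (k : K) - (a : ℤ))
  have e' := sum_ite_extendZero f ((b : ℕ) + 1) (fun a => ((a : ℤ) : K) * φ z)
  push_cast at e e'
  rw [show (k : K) - (b : ℕ) + 1 = k - ((b : ℕ) - 1) by ring, ← e, ← e', Matrix.mulVec, dotProduct,
    ← Finset.sum_add_distrib]
  refine Finset.sum_congr rfl fun a _ => ?_
  have ha : (a : ℕ) ≤ k := by omega
  simp only [Matrix.map_apply, connMat, symConn, kl2Conn_eq, Matrix.of_apply, Matrix.cons_val',
    Matrix.cons_val_zero, Matrix.cons_val_one, Matrix.cons_val_fin_one, mul_zero, add_zero,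
    ite_self, zero_add, mul_one]
  by_cases h1 : (b : ℕ) = a + 1
  · rw [if_pos h1, if_neg (by omega), if_pos (by omega), if_neg (by omega)]
    simp [ha]
  · rw [if_neg h1, if_neg (show ¬ ((a : ℕ) : ℤ) = (b : ℕ) - 1 by omega)]
    by_cases h2 : (b : ℕ) + 1 = a
    · rw [if_pos h2, if_pos (by omega)]
      simp
    · rw [if_neg h2, if_neg (by omega)]
      simp

/-- No boundary cases remain: a non-zero neighbour of an index outside `0, …, k` occurs only at `b =
-1` and `b = k + 1`, where its factor, `b + 1` or `k - b + 1`, vanishes. -/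
theorem extendZero_connOp [Module ℂ K] [SMulCommClass ℂ K K] (k : ℕ) (δ : K →ₗ[ℂ] K)
    (φ : Rz →+* K) (f : Fin (k + 1) → K) (b : ℤ) :
    extendZero (connOp δ ((connMat k).map φ) f) b =
      δ (extendZero f b) + ((k : K) - b + 1) * extendZero f (b - 1)
        + (b + 1) * φ z * extendZero f (b + 1) := by
  by_cases hb : 0 ≤ b ∧ b ≤ k
  · obtain ⟨m, rfl⟩ := Int.eq_ofNat_of_zero_le hb.1
    have hm : m < k + 1 := by omega
    have e := extendZero_fin (connOp δ ((connMat k).map φ) f) ⟨m, hm⟩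
    have e' := extendZero_fin f ⟨m, hm⟩
    simp only at e e'
    rw [e, e', add_assoc]
    change δ _ + ((connMat k).map φ).mulVec f _ = _
    rw [mulVec_connMat]
    simp
  · rw [extendZero_of_notMem _ (by omega), extendZero_of_notMem f (a := b) (by omega), map_zero,
      zero_add]
    rcases lt_or_ge b 0 with h | h
    · rw [extendZero_of_notMem f (a := b - 1) (by omega)]
      rcases (show b ≤ -1 by omega).lt_or_eq with h' | rfl
      · rw [extendZero_of_notMem f (a := b + 1) (by omega)]
        simp
      · simp
    · rw [extendZero_of_notMem f (a := b + 1) (by omega)]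
      rcases (show (k : ℤ) + 1 ≤ b by omega).lt_or_eq with h' | rfl
      · rw [extendZero_of_notMem f (a := b - 1) (by omega)]
        simp
      · simp

end Extension

/-! ### Sections as arrays of coefficients; the degree and order filtrations -/

section Arrays

/-- An array `c` stands for the formal sum `∑ c a n • zⁿ u_a`. -/
abbrev Arr : Type := ℤ → ℤ → ℂ

/-- The connection `z ∇_{∂/∂z}` of `Sym^k Kl₂` on arrays of coefficients. -/
def arrNabla (k : ℕ) : Arr →ₗ[ℂ] Arr where
  toFun c a n := n * c a n + (k - a + 1) * c (a - 1) n + (a + 1) * c (a + 1) (n - 1)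
  map_add' c c' := by
    ext a n
    simp only [Pi.add_apply]
    ring
  map_smul' r c := by
    ext a n
    simp only [Pi.smul_apply, smul_eq_mul, RingHom.id_apply]
    ring

theorem arrNabla_apply (k : ℕ) (c : Arr) (a n : ℤ) :
    arrNabla k c a n = n * c a n + (k - a + 1) * c (a - 1) n + (a + 1) * c (a + 1) (n - 1) := rfl

/-- The coefficients of an algebraic section. -/
def secArr {k : ℕ} : Sec k →ₗ[ℂ] Arr where
  toFun f a n := (extendZero f a).coeff n
  map_add' f g := by
    ext a n
    simp only [extendZero, Pi.add_apply]
    split_ifs <;> simp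
  map_smul' r f := by
    ext a n
    simp only [extendZero, Pi.smul_apply]
    split_ifs <;> simp

/-- The coefficients of a formal section at `z = 0`. -/
def zeroArr {k : ℕ} : Formal k →ₗ[ℂ] Arr where
  toFun f a n := (extendZero f a).coeff n
  map_add' f g := by
    ext a n
    simp only [extendZero, Pi.add_apply]
    split_ifs <;> simp
  map_smul' r f := by
    ext a n
    simp only [extendZero, Pi.smul_apply]
    split_ifs <;> simp

/-- The coefficients of a formal section at `z = ∞`. -/
def infArr {k : ℕ} : Formal k →ₗ[ℂ] Arr where
  toFun f a n := (extendZero f a).coeff (-n)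
  map_add' f g := by
    ext a n
    simp only [extendZero, Pi.add_apply]
    split_ifs <;> simp
  map_smul' r f := by
    ext a n
    simp only [extendZero, Pi.smul_apply]
    split_ifs <;> simp

variable {k : ℕ}

theorem secArr_apply (f : Sec k) (a n : ℤ) : secArr f a n = (extendZero f a).coeff n := rfl

theorem zeroArr_apply (f : Formal k) (a n : ℤ) : zeroArr f a n = (extendZero f a).coeff n := rfl

theorem infArr_apply (f : Formal k) (a n : ℤ) : infArr f a n = (extendZero f a).coeff (-n) := rfl

theorem zeroArr_secZero (f : Sec k) : zeroArr (secZero k f) = secArr f := by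
  ext a n
  rw [zeroArr_apply, secArr_apply, extendZero, extendZero]
  split_ifs
  · exact coeff_expandZero _ _
  · simp

theorem infArr_secInf (f : Sec k) : infArr (secInf k f) = secArr f := by
  ext a n
  rw [infArr_apply, secArr_apply, extendZero, extendZero]
  split_ifs
  · exact (coeff_expandInf _ _).trans (by rw [neg_neg])
  · simp

theorem coeff_intCast_mul_ls (m : ℤ) (f : LaurentSeries ℂ) (n : ℤ) :
    ((m : LaurentSeries ℂ) * f).coeff n = m * f.coeff n := by
  rw [← map_intCast (HahnSeries.C : ℂ →+* LaurentSeries ℂ), HahnSeries.C_apply,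
    HahnSeries.single_zero_mul_eq_smul, HahnSeries.coeff_smul, smul_eq_mul]

theorem zeroArr_nablaZero (f : Formal k) : zeroArr (nablaZero k f) = arrNabla k (zeroArr f) := by
  ext a n
  rw [zeroArr_apply, nablaZero, extendZero_connOp, arrNabla_apply, expandZero_T,
    HahnSeries.coeff_add, HahnSeries.coeff_add, coeff_lsEuler]
  have e1 : ((k : LaurentSeries ℂ) - a + 1) = ((k - a + 1 : ℤ) : LaurentSeries ℂ) := by
    push_cast
    rfl
  have e2 : ((a : LaurentSeries ℂ) + 1) = ((a + 1 : ℤ) : LaurentSeries ℂ) := by push_cast; rfl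
  rw [e1, e2, mul_assoc, coeff_intCast_mul_ls, coeff_intCast_mul_ls, HahnSeries.coeff_single_mul]
  simp only [zeroArr_apply]
  push_cast
  ring

theorem infArr_nablaInf (f : Formal k) : infArr (nablaInf k f) = arrNabla k (infArr f) := by
  ext a n
  rw [infArr_apply, nablaInf, extendZero_connOp, arrNabla_apply, expandInf_T,
    HahnSeries.coeff_add, HahnSeries.coeff_add, LinearMap.neg_apply, HahnSeries.coeff_neg,
    coeff_lsEuler]
  have e1 : ((k : LaurentSeries ℂ) - a + 1) = ((k - a + 1 : ℤ) : LaurentSeries ℂ) := by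
    push_cast
    rfl
  have e2 : ((a : LaurentSeries ℂ) + 1) = ((a + 1 : ℤ) : LaurentSeries ℂ) := by push_cast; rfl
  rw [e1, e2, mul_assoc, coeff_intCast_mul_ls, coeff_intCast_mul_ls, HahnSeries.coeff_single_mul]
  simp only [infArr_apply]
  rw [show -(n - 1) = -n - -1 by ring]
  push_cast
  ring

theorem secArr_nabla (f : Sec k) : secArr (nabla k f) = arrNabla k (secArr f) := by
  rw [← zeroArr_secZero, ← nablaZero_secZero, zeroArr_nablaZero, zeroArr_secZero]

/-- The array is supported on the indices `0 ≤ a ≤ k`. -/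
def RowSupp (k : ℕ) : Submodule ℂ Arr where
  carrier := {c | ∀ a n, a < 0 ∨ (k : ℤ) < a → c a n = 0}
  zero_mem' := fun _ _ _ => rfl
  add_mem' h h' a n ha := by rw [Pi.add_apply, Pi.add_apply, h a n ha, h' a n ha, add_zero]
  smul_mem' r c h a n ha := by rw [Pi.smul_apply, Pi.smul_apply, h a n ha, smul_zero]

/-- The arrays of degree at most `d`, where `zⁿ u_a` has degree `2n + a`. -/
def DegLE (d : ℤ) : Submodule ℂ Arr where
  carrier := {c | ∀ a n, d < 2 * n + a → c a n = 0}
  zero_mem' := fun _ _ _ => rfl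
  add_mem' h h' a n ha := by rw [Pi.add_apply, Pi.add_apply, h a n ha, h' a n ha, add_zero]
  smul_mem' r c h a n ha := by rw [Pi.smul_apply, Pi.smul_apply, h a n ha, smul_zero]

/-- The arrays of order at least `N` in `z`. -/
def OrdGE (N : ℤ) : Submodule ℂ Arr where
  carrier := {c | ∀ a n, n < N → c a n = 0}
  zero_mem' := fun _ _ _ => rfl
  add_mem' h h' a n ha := by rw [Pi.add_apply, Pi.add_apply, h a n ha, h' a n ha, add_zero]
  smul_mem' r c h a n ha := by rw [Pi.smul_apply, Pi.smul_apply, h a n ha, smul_zero]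

theorem DegLE.mono {d d' : ℤ} (h : d ≤ d') : DegLE d ≤ DegLE d' :=
  fun _ hc a n hn => hc a n (by omega)

theorem OrdGE.mono {N N' : ℤ} (h : N ≤ N') : OrdGE N' ≤ OrdGE N :=
  fun _ hc a n hn => hc a n (by omega)

theorem arrNabla_mem_rowSupp {c : Arr} (hc : c ∈ RowSupp k) : arrNabla k c ∈ RowSupp k := by
  intro a n ha
  rw [arrNabla_apply, hc a n ha]
  rcases ha with ha | ha
  · rw [hc (a - 1) n (by omega)]
    rcases (show a ≤ -1 by omega).lt_or_eq with h' | rfl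
    · rw [hc (a + 1) _ (by omega)]
      simp
    · simp
  · rw [hc (a + 1) _ (by omega)]
    rcases (show (k : ℤ) + 1 ≤ a by omega).lt_or_eq with h' | rfl
    · rw [hc (a - 1) n (by omega)]
      simp
    · simp

/-- The Euler term preserves the degree `2n + a`, while `u_(a-1) ↦ u_a` and `z^(n-1) u_(a+1) ↦ z^n
u_a` raise it by one. These two terms form the symbol. -/
theorem arrNabla_mem_degLE {d : ℤ} {c : Arr} (hc : c ∈ DegLE d) :
    arrNabla k c ∈ DegLE (d + 1) := by
  intro a n h
  rw [arrNabla_apply, hc a n (by omega), hc (a - 1) n (by omega), hc (a + 1) (n - 1) (by omega)]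
  simp

theorem arrNabla_mem_ordGE {N : ℤ} {c : Arr} (hc : c ∈ OrdGE N) : arrNabla k c ∈ OrdGE N := by
  intro a n h
  rw [arrNabla_apply, hc a n (by omega), hc (a - 1) n (by omega), hc (a + 1) (n - 1) (by omega)]
  simp

theorem infArr_mem_rowSupp (f : Formal k) : infArr f ∈ RowSupp k := fun a n ha => by
  rw [infArr_apply, extendZero_of_notMem f ha, HahnSeries.coeff_zero]

theorem secArr_mem_rowSupp (f : Sec k) : secArr f ∈ RowSupp k := fun a n ha => by
  rw [secArr_apply, extendZero_of_notMem f ha, AddMonoidAlgebra.coeff_zero, Finsupp.zero_apply]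

theorem infArr_fin (f : Formal k) (a : Fin (k + 1)) (n : ℤ) :
    infArr f (a : ℕ) n = (f a).coeff (-n) := by
  rw [infArr_apply, extendZero_fin]

theorem zeroArr_fin (f : Formal k) (a : Fin (k + 1)) (n : ℤ) :
    zeroArr f (a : ℕ) n = (f a).coeff n := by
  rw [zeroArr_apply, extendZero_fin]

theorem secArr_fin (f : Sec k) (a : Fin (k + 1)) (n : ℤ) :
    secArr f (a : ℕ) n = (f a).coeff n := by
  rw [secArr_apply, extendZero_fin]

theorem infArr_injective : Function.Injective (infArr : Formal k → Arr) := fun f g h => by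
  ext a n
  rw [← neg_neg n, ← infArr_fin, h, infArr_fin]

theorem zeroArr_injective : Function.Injective (zeroArr : Formal k → Arr) := fun f g h => by
  ext a n
  rw [← zeroArr_fin, h, zeroArr_fin]

theorem secArr_injective : Function.Injective (secArr : Sec k → Arr) := fun f g h => by
  ext a n
  rw [← secArr_fin, h, secArr_fin]

theorem eq_of_rowSupp {c c' : Arr} (hc : c ∈ RowSupp k) (hc' : c' ∈ RowSupp k)
    (h : ∀ (a : Fin (k + 1)) n, c (a : ℕ) n = c' (a : ℕ) n) : c = c' := by
  ext a n
  by_cases ha : a < 0 ∨ (k : ℤ) < a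
  · rw [hc a n ha, hc' a n ha]
  · have := h ⟨a.toNat, by omega⟩ n
    simpa [Int.toNat_of_nonneg (show 0 ≤ a by omega)] using this

/-- Since `a ≥ 0`, a bound on the degree bounds `n` from above, hence the pole order in `w = 1/z`.
-/
theorem exists_infArr_eq {d : ℤ} {c : Arr} (hc : c ∈ RowSupp k) (hd : c ∈ DegLE d) :
    ∃ f : Formal k, infArr f = c := by
  have hb : ∀ a : Fin (k + 1), BddBelow (Function.support fun n => c (a : ℕ) (-n)) := fun a =>
    ⟨-(|d| + 1), fun n hn => by
      by_contra hlt
      have := le_abs_self d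
      have := abs_nonneg d
      exact hn (hd _ _ (by omega))⟩
  refine ⟨fun a => HahnSeries.ofSuppBddBelow _ (hb a),
    eq_of_rowSupp (infArr_mem_rowSupp _) hc fun a n => ?_⟩
  rw [infArr_fin, HahnSeries.coeff_ofSuppBddBelow, neg_neg]

theorem exists_zeroArr_eq {N : ℤ} {c : Arr} (hc : c ∈ RowSupp k) (hN : c ∈ OrdGE N) :
    ∃ f : Formal k, zeroArr f = c := by
  have hb : ∀ a : Fin (k + 1), BddBelow (Function.support fun n => c (a : ℕ) n) := fun a =>
    ⟨N, fun n hn => by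
      by_contra hlt
      exact hn (hN _ _ (by omega))⟩
  refine ⟨fun a => HahnSeries.ofSuppBddBelow _ (hb a),
    eq_of_rowSupp (fun a n ha => ?_) hc fun a n => ?_⟩
  · rw [zeroArr_apply, extendZero_of_notMem _ ha, HahnSeries.coeff_zero]
  · rw [zeroArr_fin, HahnSeries.coeff_ofSuppBddBelow]

theorem exists_secArr_eq {N d : ℤ} {c : Arr} (hc : c ∈ RowSupp k) (hN : c ∈ OrdGE N)
    (hd : c ∈ DegLE d) : ∃ f : Sec k, secArr f = c := by
  have hf : ∀ a : Fin (k + 1), ∀ n, c (a : ℕ) n ≠ 0 → n ∈ Finset.Icc N |d| := fun a n hn => by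
    rw [Finset.mem_Icc]
    have := le_abs_self d
    have := abs_nonneg d
    constructor
    · by_contra h
      exact hn (hN _ _ (by omega))
    · by_contra h
      exact hn (hd _ _ (by omega))
  refine ⟨fun a => .ofCoeff (Finsupp.onFinset _ (c (a : ℕ)) (hf a)),
    eq_of_rowSupp (secArr_mem_rowSupp _) hc fun a n => ?_⟩
  rw [secArr_fin]
  rfl

theorem exists_secArr_mem (f : Sec k) : ∃ N d, secArr f ∈ OrdGE N ∧ secArr f ∈ DegLE d := by
  have h : ∀ a : Fin (k + 1), ∃ B : ℕ, ∀ n : ℤ, (f a).coeff n ≠ 0 → |n| ≤ B := fun a =>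
    ⟨∑ m ∈ (f a).coeff.support, m.natAbs, fun n hn => by
      rw [Int.abs_eq_natAbs]
      exact_mod_cast Finset.single_le_sum (f := Int.natAbs) (fun _ _ => Nat.zero_le _)
        (Finsupp.mem_support_iff.mpr hn)⟩
  choose B hB using h
  have hS : ∀ a n, secArr f a n ≠ 0 → |n| ≤ ((∑ a, B a : ℕ) : ℤ) ∧ a ≤ k := fun a n hn => by
    have ha : 0 ≤ a ∧ a ≤ k := by
      by_contra h
      exact hn (secArr_mem_rowSupp f a n (by omega))
    lift a to ℕ using ha.1
    rw [secArr_fin f ⟨a, by omega⟩] at hn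
    refine ⟨(hB _ n hn).trans ?_, ha.2⟩
    exact_mod_cast Finset.single_le_sum (f := B) (fun _ _ => Nat.zero_le _) (Finset.mem_univ _)
  refine ⟨-((∑ a, B a : ℕ) : ℤ), 2 * ((∑ a, B a : ℕ) : ℤ) + k, fun a n hn => ?_, fun a n hn => ?_⟩
  · by_contra h
    have := abs_le.mp (hS a n h).1
    omega
  · by_contra h
    have := abs_le.mp (hS a n h).1
    have := (hS a n h).2
    omega

end Arrays

/-! ### The eigensection at infinity and the Bessel series -/

section Horizontal

open scoped Differential

section Dehomogenized

theorem coeff_X_mul_derivative {K : Type*} [CommRing K] (f : Polynomial K) (n : ℕ) :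
    (Polynomial.X * Polynomial.derivative f).coeff n = n * f.coeff n := by
  cases n with
  | zero => simp
  | succ n =>
    rw [Polynomial.coeff_X_mul, Polynomial.coeff_derivative]
    push_cast
    ring

variable {K : Type*} [CommRing K] [Differential K]

/-- The connection `∇ v₀ = v₁`, `∇ v₁ = ζ v₀` on homogeneous polynomials of degree `k` in `v₀, v₁`,
dehomogenized at `v₀ = 1`. -/
def polyNabla (ζ k : K) (f : Polynomial K) : Polynomial K :=
  Differential.mapCoeffs f + Polynomial.C k * Polynomial.X * f
    + (Polynomial.C ζ - Polynomial.X ^ 2) * Polynomial.derivative f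

/-- This is the Leibniz rule for the product of `v₀^a f(v₁/v₀)` and `v₀^b g(v₁/v₀)`: one has `∇ v₀^a
= a X v₀^a` and `∇ X = ζ - X²` for `X = v₁/v₀`. -/
theorem polyNabla_mul (ζ a b : K) (f g : Polynomial K) :
    polyNabla ζ (a + b) (f * g) = polyNabla ζ a f * g + f * polyNabla ζ b g := by
  simp only [polyNabla, Derivation.leibniz, smul_eq_mul, Polynomial.derivative_mul, map_add]
  ring

theorem polyNabla_pow {ζ k c : K} {f : Polynomial K}
    (h : polyNabla ζ k f = Polynomial.C c * f) (n : ℕ) :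
    polyNabla ζ (n * k) (f ^ n) = Polynomial.C (n * c) * f ^ n := by
  induction n with
  | zero => simp [polyNabla]
  | succ n ih =>
    rw [pow_succ, Nat.cast_add_one, add_mul, one_mul, polyNabla_mul, ih, h, add_mul, one_mul,
      map_add]
    ring

theorem coeff_polyNabla_zero (ζ k : K) (f : Polynomial K) :
    (polyNabla ζ k f).coeff 0 = (f.coeff 0)′ + ζ * f.coeff 1 := by
  rw [polyNabla, sub_mul, pow_two, mul_assoc, mul_assoc]
  simp only [Polynomial.coeff_add, Polynomial.coeff_sub, Differential.coeff_mapCoeffs,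
    Polynomial.mul_coeff_zero, Polynomial.coeff_X_zero,
    Polynomial.coeff_derivative]
  simp

theorem coeff_polyNabla_succ (ζ k : K) (f : Polynomial K) (n : ℕ) :
    (polyNabla ζ k f).coeff (n + 1) = (f.coeff (n + 1))′ + (k - n) * f.coeff n
      + (n + 2) * ζ * f.coeff (n + 2) := by
  rw [polyNabla, sub_mul, pow_two, mul_assoc, mul_assoc]
  simp only [Polynomial.coeff_add, Polynomial.coeff_sub, Differential.coeff_mapCoeffs,
    Polynomial.coeff_C_mul, Polynomial.coeff_X_mul, coeff_X_mul_derivative,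
    Polynomial.coeff_derivative]
  push_cast
  ring

/-- The hypotheses are the coefficients of `X²`, `X` and `1` in `∇ q = c q`; the cubic terms cancel.
Read in this order, the first two determine `B` and `A` from `C`, and the last becomes a third-order
equation for `C` alone. -/
theorem polyNabla_quadratic {ζ c A B C : K} (hC : C′ = c * C - B)
    (hB : B′ = c * B - 2 * A - 2 * ζ * C) (hA : A′ = c * A - ζ * B) :
    polyNabla ζ 2 (Polynomial.C A + Polynomial.C B * Polynomial.X
      + Polynomial.C C * Polynomial.X ^ 2) =
    Polynomial.C c * (Polynomial.C A + Polynomial.C B * Polynomial.X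
      + Polynomial.C C * Polynomial.X ^ 2) := by
  have h1 : Differential.mapCoeffs (Polynomial.C A + Polynomial.C B * Polynomial.X
      + Polynomial.C C * Polynomial.X ^ 2) =
      Polynomial.C A′ + Polynomial.C B′ * Polynomial.X + Polynomial.C C′ * Polynomial.X ^ 2 := by
    simp only [map_add, Derivation.leibniz, Derivation.leibniz_pow,
      Differential.mapCoeffs_C, Differential.mapCoeffs_X, smul_eq_mul]
    ring
  rw [polyNabla, h1, hA, hB, hC]
  simp only [map_add, map_sub, map_mul, Polynomial.derivative_mul,
    Polynomial.derivative_C, Polynomial.derivative_X, Polynomial.derivative_X_pow, Polynomial.C_ofNat]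
  push_cast
  simp only [Polynomial.C_ofNat]
  ring

/-- A ring with an additive map that satisfies the Leibniz rule, as a differential ring. -/
abbrev differentialOfLeibniz {K : Type*} [CommRing K] (δ : K →+ K)
    (h : ∀ f g, δ (f * g) = δ f * g + f * δ g) : Differential K where
  deriv := Derivation.mk' δ.toIntLinearMap fun f g => by
    rw [AddMonoidHom.coe_toIntLinearMap, h, smul_eq_mul, smul_eq_mul]
    ring

end Dehomogenized

/-- The differential ring `ℂ((w))` with the derivation `z ∂/∂z = -w ∂/∂w`. -/
abbrev lsDifferential : Differential (LaurentSeries ℂ) :=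
  differentialOfLeibniz (-lsEuler : LaurentSeries ℂ →ₗ[ℂ] LaurentSeries ℂ).toAddMonoidHom
    fun f g => by
      change -lsEuler (f * g) = -lsEuler f * g + f * -lsEuler g
      rw [lsEuler_mul]
      ring

attribute [local instance] lsDifferential

theorem deriv_ls (f : LaurentSeries ℂ) : f′ = -lsEuler f := rfl

/-- The function `z = 1/w` in `ℂ((w))`. -/
abbrev zInf : LaurentSeries ℂ := HahnSeries.single (-1) 1

/-- The coefficients of a polynomial, as a formal section of `Sym^k Kl₂` at `∞`. -/
def polyFormal (k : ℕ) (f : Polynomial (LaurentSeries ℂ)) : Formal k := fun a => f.coeff a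

theorem extendZero_polyFormal {k : ℕ} {f : Polynomial (LaurentSeries ℂ)} (hf : f.natDegree ≤ k)
    (a : ℕ) : extendZero (polyFormal k f) a = f.coeff a := by
  rcases le_or_gt a k with h | h
  · exact extendZero_fin (polyFormal k f) ⟨a, by omega⟩
  · rw [extendZero_of_notMem _ (by omega), Polynomial.coeff_eq_zero_of_natDegree_lt (by omega)]

theorem nablaInf_polyFormal {k : ℕ} {f : Polynomial (LaurentSeries ℂ)} (hf : f.natDegree ≤ k) :
    nablaInf k (polyFormal k f) = polyFormal k (polyNabla zInf k f) := by
  ext1 b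
  rw [← extendZero_fin (nablaInf k _) b, nablaInf, extendZero_connOp, expandInf_T,
    LinearMap.neg_apply, polyFormal]
  obtain ⟨b, hb⟩ := b
  cases b with
  | zero =>
    have e := extendZero_polyFormal hf 1
    have e' := extendZero_polyFormal hf 0
    simp only [Nat.cast_zero, Nat.cast_one] at e e'
    rw [extendZero_of_notMem (a := ((0 : ℕ) : ℤ) - 1) _ (by simp), coeff_polyNabla_zero, deriv_ls]
    simp [e, e']
  | succ b =>
    have e := extendZero_polyFormal hf (b + 2)
    have e' := extendZero_polyFormal hf b
    have e'' := extendZero_polyFormal hf (b + 1)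
    simp only [coeff_polyNabla_succ, deriv_ls]
    rw [e'', show ((b + 1 : ℕ) : ℤ) - 1 = b by push_cast; ring, e',
      show ((b + 1 : ℕ) : ℤ) + 1 = (b + 2 : ℕ) by push_cast; ring, e]
    push_cast
    ring

/-- The Bessel series as a formal Laurent series in `w`. -/
abbrev besselLaurent : LaurentSeries ℂ := HahnSeries.ofPowerSeries ℤ ℂ besselSeries

theorem coeff_ofPowerSeries_of_neg (f : PowerSeries ℂ) {n : ℤ} (hn : n < 0) :
    (HahnSeries.ofPowerSeries ℤ ℂ f).coeff n = 0 :=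
  (PowerSeries.coeff_coe f n).trans (if_pos hn)

theorem coeff_ofPowerSeries (f : PowerSeries ℂ) (n : ℕ) :
    (HahnSeries.ofPowerSeries ℤ ℂ f).coeff n = PowerSeries.coeff n f := by
  rw [HahnSeries.ofPowerSeries_apply_coeff]

theorem coeff_besselSeries_succ (n : ℕ) : (2 * n + 1 : ℂ) ^ 3 * PowerSeries.coeff n besselSeries =
    32 * (n + 1) * PowerSeries.coeff (n + 1) besselSeries := by
  rw [besselSeries, PowerSeries.coeff_mk, PowerSeries.coeff_mk]
  have h : ((2 * (n + 1) - 1).doubleFactorial : ℂ) = (2 * n + 1) * (2 * n - 1).doubleFactorial := by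
    -- At `n = 0` the subtraction `2 * n - 1` truncates to 0, and the convention `0!! = 1` saves the
    -- identity.
    cases n with
    | zero => simp
    | succ n =>
      rw [show 2 * (n + 1 + 1) - 1 = (2 * n + 1) + 2 by omega, Nat.doubleFactorial_add_two,
        show 2 * (n + 1) - 1 = 2 * n + 1 by omega]
      push_cast
      ring
  rw [h, Nat.factorial_succ]
  have h1 : (n.factorial : ℂ) ≠ 0 := Nat.cast_ne_zero.mpr n.factorial_ne_zero
  have h2 : (n + 1 : ℂ) ≠ 0 := Nat.cast_add_one_ne_zero n
  push_cast
  field_simp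
  ring

/-- Valid for all integers, so that Laurent coefficients can be compared uniformly: at `n = -1` the
factor `n + 1` kills the constant coefficient of the series. -/
theorem coeff_besselLaurent_succ (n : ℤ) : (2 * n + 1 : ℂ) ^ 3 * besselLaurent.coeff n =
    32 * (n + 1) * besselLaurent.coeff (n + 1) := by
  rcases lt_or_ge n 0 with h | h
  · rw [coeff_ofPowerSeries_of_neg _ h]
    rcases (show n ≤ -1 by omega).lt_or_eq with h' | rfl
    · rw [coeff_ofPowerSeries_of_neg _ (by omega)]
      simp
    · simp
  · lift n to ℕ using h
    rw [coeff_ofPowerSeries, show (n : ℤ) + 1 = (n + 1 : ℕ) by push_cast; rfl, coeff_ofPowerSeries]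
    exact_mod_cast coeff_besselSeries_succ n

theorem coeff_C_mul_ls (c : ℂ) (f : LaurentSeries ℂ) (n : ℤ) :
    (HahnSeries.C c * f).coeff n = c * f.coeff n := by
  rw [HahnSeries.C_apply, HahnSeries.single_zero_mul_eq_smul, HahnSeries.coeff_smul, smul_eq_mul]

/-- The symmetric square of `Kl₂` has at `∞` a section `q` with `∇ q = q / 2` whose coefficient on
`v₁²` is the Bessel series. -/
theorem exists_quadratic_section : ∃ A B : LaurentSeries ℂ,
    polyNabla zInf 2 (Polynomial.C A + Polynomial.C B * Polynomial.X
      + Polynomial.C besselLaurent * Polynomial.X ^ 2) =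
    Polynomial.C (HahnSeries.C (1 / 2)) * (Polynomial.C A + Polynomial.C B * Polynomial.X
      + Polynomial.C besselLaurent * Polynomial.X ^ 2) := by
  set c : LaurentSeries ℂ := HahnSeries.C (1 / 2 : ℂ) with hc
  have hc2 : c * 2 = 1 := by
    rw [hc, ← map_ofNat (HahnSeries.C : ℂ →+* LaurentSeries ℂ), ← map_mul]
    norm_num
  -- `B` and `A` are forced by the `v₁²`- and `v₀v₁`-coefficients of `∇ q = q / 2`.
  obtain ⟨B, hB⟩ : ∃ B, B = c * besselLaurent + lsEuler besselLaurent := ⟨_, rfl⟩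
  obtain ⟨A, hA⟩ : ∃ A, A = c * (c * B + lsEuler B - 2 * zInf * besselLaurent) := ⟨_, rfl⟩
  -- What remains is the `v₀²`-coefficient, a third-order equation whose coefficients are the Bessel
  -- recurrence up to a constant factor.
  have key : -lsEuler A + zInf * B = c * A := by
    ext n
    have e : ∀ f : LaurentSeries ℂ, 2 * zInf * f = HahnSeries.C 2 * (zInf * f) := fun f => by
      rw [map_ofNat, mul_assoc]
    have hBn : ∀ m, B.coeff m = (1 / 2 + m) * besselLaurent.coeff m := fun m => by
      rw [hB, HahnSeries.coeff_add, hc, coeff_C_mul_ls, coeff_lsEuler]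
      ring
    have hAn : A.coeff n = 1 / 2 * ((1 / 2 + n) * ((1 / 2 + n) * besselLaurent.coeff n)
        - 2 * besselLaurent.coeff (n + 1)) := by
      rw [hA, hc, e, coeff_C_mul_ls, HahnSeries.coeff_sub, HahnSeries.coeff_add,
        coeff_C_mul_ls, coeff_C_mul_ls, coeff_lsEuler, hBn, HahnSeries.coeff_single_mul,
        sub_neg_eq_add]
      ring
    rw [HahnSeries.coeff_add, HahnSeries.coeff_neg, coeff_lsEuler, hc, coeff_C_mul_ls, hAn,
      HahnSeries.coeff_single_mul, sub_neg_eq_add, hBn]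
    have := coeff_besselLaurent_succ n
    push_cast
    linear_combination (-1 / 16) * this
  refine ⟨A, B, ?_⟩
  refine polyNabla_quadratic ?_ ?_ ?_
  · rw [deriv_ls, hB]
    ring
  · rw [deriv_ls, hA]
    linear_combination (c * B + lsEuler B - 2 * zInf * besselLaurent) * hc2
  · rw [deriv_ls]
    linear_combination key

/-- Take the `k/2`-th power of the quadratic section: eigenvalues add up to `k/4`, and the leading
coefficient in `v₁` is multiplicative. Thus `w^(k/4) Q` is horizontal, up to the root of `w`. -/
theorem exists_horizontal {k : ℕ} (hk : Even k) : ∃ Q : Formal k,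
    nablaInf k Q = ((k : ℂ) / 4) • Q ∧
      Q (Fin.last k) = HahnSeries.ofPowerSeries ℤ ℂ (besselSeries ^ (k / 2)) := by
  obtain ⟨A, B, h⟩ := exists_quadratic_section
  obtain ⟨p, rfl⟩ := hk
  set q := Polynomial.C A + Polynomial.C B * Polynomial.X
      + Polynomial.C besselLaurent * Polynomial.X ^ 2 with hq
  have hd : q.natDegree ≤ 2 := by rw [hq]; compute_degree
  have hd' : (q ^ p).natDegree ≤ p + p := by
    refine (Polynomial.natDegree_pow_le_of_le p hd).trans (by omega)
  refine ⟨polyFormal (p + p) (q ^ p), ?_, ?_⟩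
  · rw [nablaInf_polyFormal hd', show ((p + p : ℕ) : LaurentSeries ℂ) = p * 2 by push_cast; ring,
      polyNabla_pow h]
    ext1 a
    rw [polyFormal, Polynomial.coeff_C_mul, ← map_natCast (HahnSeries.C : ℂ →+* LaurentSeries ℂ),
      ← map_mul, HahnSeries.C_apply,
      HahnSeries.single_zero_mul_eq_smul, Pi.smul_apply]
    congr 1
    push_cast
    ring
  · rw [polyFormal, Fin.val_last, ← two_mul, mul_comm 2 p,
      Polynomial.coeff_pow_of_natDegree_le hd, Nat.mul_div_cancel _ (by omega), map_pow]
    congr 1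
    rw [hq]
    simp

end Horizontal

/-! ### Inverting the symbol at infinity and the residue at zero, degree by degree -/

section Rows

/-- The factor `k - b + 1` is non-zero for `b ≤ N ≤ k`, so the equation at `b` yields `c (b - 1)`
from `c (b + 1)`. Only the equation at `b = 0` is given up. -/
theorem exists_row_down (k N : ℕ) (hN : N ≤ k) (g : ℤ → ℂ) : ∃ c : ℤ → ℂ,
    (∀ a : ℤ, a < 0 ∨ (N : ℤ) ≤ a → c a = 0) ∧
      ∀ b : ℤ, 1 ≤ b → b ≤ N → (k - b + 1) * c (b - 1) + (b + 1) * c (b + 1) = g b := by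
  induction N generalizing g with
  | zero => exact ⟨0, fun _ _ => rfl, fun b h1 h2 => absurd h1 (by simp at h2; omega)⟩
  | succ N ih =>
    have hne : (k - N : ℂ) ≠ 0 := sub_ne_zero.mpr (by exact_mod_cast (by omega : k ≠ N))
    set x := g (N + 1) / (k - N) with hx
    -- The entry `x` at `N` contributes `N * x` to the equation at `N - 1`, which is subtracted
    -- beforehand.
    obtain ⟨c, hc, hg⟩ := ih (by omega) (Function.update g (N - 1) (g (N - 1) - N * x))
    refine ⟨Function.update c N x, fun a ha => ?_, fun b h1 h2 => ?_⟩
    · rw [Function.update_of_ne (by push_cast at ha; omega), hc a (by push_cast at ha; omega)]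
    · push_cast at h2
      rcases h2.lt_or_eq with h2 | rfl
      · rw [Function.update_of_ne (by omega)]
        by_cases hb : b = N - 1
        · subst hb
          have := hg _ h1 (by omega)
          rw [Function.update_self, sub_add_cancel, hc N (by omega)] at this
          rw [sub_add_cancel, Function.update_self]
          push_cast at this ⊢
          linear_combination this
        · rw [Function.update_of_ne (by omega), hg b h1 (by omega), Function.update_of_ne hb]
      · rw [add_sub_cancel_right, Function.update_self, Function.update_of_ne (by omega),
          hc _ (by omega), hx]
        push_cast
        field_simp
        ring

/-- The reflection `a ↦ k - a` exchanges the two coefficients of the symbol; now the equation at `b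
= k` is the one given up. -/
theorem exists_row_up (k : ℕ) (g : ℤ → ℂ) : ∃ c : ℤ → ℂ,
    (∀ a : ℤ, a < 0 ∨ (k : ℤ) < a → c a = 0) ∧
      ∀ b : ℤ, 0 ≤ b → b < k → (k - b + 1) * c (b - 1) + (b + 1) * c (b + 1) = g b := by
  obtain ⟨c, hc, hg⟩ := exists_row_down k k le_rfl (fun b => g (k - b))
  refine ⟨fun a => c (k - a), fun a ha => hc _ (by omega), fun b h1 h2 => ?_⟩
  have := hg (k - b) (by omega) (by omega)
  rw [sub_sub_cancel] at this
  beta_reduce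
  rw [← this, show (k : ℤ) - (b - 1) = k - b + 1 by ring, show (k : ℤ) - (b + 1) = k - b - 1 by ring]
  push_cast
  ring

/-- On `z^n u_a` the leading part of the connection at `z = 0` is `n` plus a nilpotent operator, so
it is solved upwards in `b`, dividing by `n`. -/
theorem exists_row_of_ne_zero (k : ℕ) (g : ℤ → ℂ) {n : ℂ} (hn : n ≠ 0) : ∃ c : ℤ → ℂ,
    (∀ a : ℤ, a < 0 ∨ (k : ℤ) < a → c a = 0) ∧
      ∀ b : ℤ, 0 ≤ b → b ≤ k → n * c b + (k - b + 1) * c (b - 1) = g b := by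
  suffices h : ∀ N : ℕ, ∃ c : ℤ → ℂ, (∀ a : ℤ, a < 0 ∨ (N : ℤ) ≤ a → c a = 0) ∧
      ∀ b : ℤ, 0 ≤ b → b < N → n * c b + (k - b + 1) * c (b - 1) = g b by
    obtain ⟨c, hc, hg⟩ := h (k + 1)
    exact ⟨c, fun a ha => hc a (by push_cast; omega), fun b h0 h1 => hg b h0 (by push_cast; omega)⟩
  intro N
  induction N with
  | zero => exact ⟨0, fun _ _ => rfl, fun b h1 h2 => absurd h1 (by simp at h2; omega)⟩
  | succ N ih =>
    obtain ⟨c, hc, hg⟩ := ih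
    refine ⟨Function.update c N ((g N - (k - N + 1) * c (N - 1)) / n), fun a ha => ?_,
      fun b h1 h2 => ?_⟩
    · rw [Function.update_of_ne (by push_cast at ha; omega), hc a (by push_cast at ha; omega)]
    · rw [Function.update_of_ne (a := b - 1) (by push_cast at h2; omega)]
      push_cast at h2
      rcases (show b ≤ N by omega).lt_or_eq with h2 | rfl
      · rw [Function.update_of_ne (by omega), hg b h1 h2]
      · rw [Function.update_self]
        push_cast
        field_simp
        ring

variable {k : ℕ} {d : ℤ} {c : Arr}

/-- Reduction of the part of top degree to a multiple of a power of `z`. -/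
theorem exists_homogeneous_down {N : ℕ} (hN : N ≤ k)
    (h0 : ∀ b n, (N : ℤ) < b → 2 * n + b = d → c b n = 0) :
    ∃ m ∈ RowSupp k, m ∈ DegLE (d - 1) ∧ (∀ a n, m a n ≠ 0 → a < N ∧ 2 * n + a = d - 1) ∧
      ∀ b n : ℤ, 1 ≤ b → 2 * n + b = d → (c - arrNabla k m) b n = 0 := by
  -- Only the `b` congruent to `d` modulo 2 matter; for the others the quotient is rounded and the
  -- equation is never used.
  obtain ⟨s, hs, hg⟩ := exists_row_down k N hN (fun b => c b ((d - b) / 2))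
  refine ⟨fun a n => if 2 * n + a = d - 1 then s a else 0, fun a n ha => ?_, fun a n ha => ?_,
    fun a n ha => ?_, fun b n h1 h2 => ?_⟩
  · simp only
    rw [hs a (by omega), ite_self]
  · exact if_neg (by omega)
  · by_contra h
    apply ha
    simp only
    split_ifs with h'
    · exact hs a (by omega)
    · rfl
  · rw [Pi.sub_apply, Pi.sub_apply, arrNabla_apply]
    rw [if_neg (by omega), if_pos (by omega), if_pos (by omega)]
    by_cases hb : b ≤ N
    · have := hg b h1 hb
      rw [show (d - b) / 2 = n by omega] at this
      rw [← this]
      ring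
    · rw [h0 b n (by omega) h2, hs (b - 1) (by omega), hs (b + 1) (by omega)]
      ring

/-- The mirror image of `exists_homogeneous_down`: the part of top degree is reduced to its
`u_k`-coefficient instead of its `u_0`-coefficient. -/
theorem exists_homogeneous_up (k : ℕ) (d : ℤ) (c : Arr) :
    ∃ m ∈ RowSupp k, m ∈ DegLE (d - 1) ∧
      ∀ b n : ℤ, 0 ≤ b → b < k → 2 * n + b = d → (c - arrNabla k m) b n = 0 := by
  obtain ⟨s, hs, hg⟩ := exists_row_up k (fun b => c b ((d - b) / 2))
  refine ⟨fun a n => if 2 * n + a = d - 1 then s a else 0, fun a n ha => ?_, fun a n ha => ?_,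
    fun b n h1 h1' h2 => ?_⟩
  · simp only
    rw [hs a (by omega), ite_self]
  · exact if_neg (by omega)
  · rw [Pi.sub_apply, Pi.sub_apply, arrNabla_apply]
    rw [if_neg (by omega), if_pos (by omega), if_pos (by omega)]
    have := hg b h1 h1'
    rw [show (d - b) / 2 = n by omega] at this
    rw [← this]
    ring

theorem sub_arrNabla_mem_degLE {m : Arr} (hd : c ∈ DegLE d) (hm : m ∈ DegLE (d - 1)) :
    c - arrNabla k m ∈ DegLE d := by
  have := arrNabla_mem_degLE (k := k) hm
  rw [sub_add_cancel] at this
  exact sub_mem hd this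

theorem mem_degLE_pred (hc : c ∈ RowSupp k) (hd : c ∈ DegLE d)
    (h : ∀ b n : ℤ, 0 ≤ b → b ≤ k → 2 * n + b = d → c b n = 0) : c ∈ DegLE (d - 1) := by
  intro a n ha
  by_cases h1 : 2 * n + a = d
  · by_cases h2 : 0 ≤ a ∧ a ≤ k
    · exact h a n h2.1 h2.2 h1
    · exact hc a n (by omega)
  · exact hd a n (by omega)

/-- A parity argument makes the leftover coefficient absent: `z^n u_0` has even degree, which
settles odd `d`, and for odd `k` the degree of `z^n u_k` is odd, which settles even `d`. -/
theorem exists_step_of_odd (h : Odd d ∨ Odd k) (hc : c ∈ RowSupp k) (hd : c ∈ DegLE d) :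
    ∃ m ∈ RowSupp k, m ∈ DegLE (d - 1) ∧ c - arrNabla k m ∈ DegLE (d - 1) := by
  by_cases hodd : Odd d
  · obtain ⟨m, hm, hmd, -, h0⟩ := exists_homogeneous_down (d := d) le_rfl
      (fun b n hb _ => hc b n (Or.inr hb))
    refine ⟨m, hm, hmd, mem_degLE_pred (sub_mem hc (arrNabla_mem_rowSupp hm))
      (sub_arrNabla_mem_degLE hd hmd) fun b n hb _ hn => h0 b n ?_ hn⟩
    obtain ⟨e, he⟩ := hodd
    omega
  · obtain ⟨e, he⟩ := h.resolve_left hodd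
    rw [Int.not_odd_iff_even] at hodd
    obtain ⟨e', he'⟩ := hodd
    obtain ⟨m, hm, hmd, h0⟩ := exists_homogeneous_up k d c
    refine ⟨m, hm, hmd, mem_degLE_pred (sub_mem hc (arrNabla_mem_rowSupp hm))
      (sub_arrNabla_mem_degLE hd hmd) fun b n hb hb' hn => h0 b n hb ?_ hn⟩
    omega

/-- The hypothesis on `arrNabla k c` puts the degree `d` part of `c` in the kernel of the symbol.
There the coefficient at `k - j - 2` is determined by that at `k - j`, and the one at `k - 1`
vanishes, so everything depends on the `u_k`-coefficient. -/
theorem mem_degLE_pred_of_arrNabla (hc : c ∈ RowSupp k) (hd : c ∈ DegLE d)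
    (hn : arrNabla k c ∈ DegLE d) (h0 : ∀ n, 2 * n + k = d → c k n = 0) : c ∈ DegLE (d - 1) := by
  have key : ∀ j : ℕ, ∀ n, 2 * n + ((k : ℤ) - j) = d → c (k - j) n = 0 := by
    intro j
    induction j using Nat.strong_induction_on with
    | _ j ih =>
    intro n hjn
    match j with
    | 0 => simpa using h0 n (by simpa using hjn)
    | 1 =>
      have e := hn k n (by push_cast at hjn; omega)
      rw [arrNabla_apply, hd k n (by push_cast at hjn; omega), hc (k + 1) _ (by omega)] at e
      push_cast at e ⊢
      linear_combination e
    | j + 2 =>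
      have e := hn (k - j - 1) n (by push_cast at hjn; omega)
      have i := ih j (by omega) (n - 1) (by push_cast at hjn; omega)
      rw [arrNabla_apply, hd _ n (by push_cast at hjn; omega), sub_add_cancel, i,
        show (k : ℤ) - j - 1 - 1 = k - (j + 2 : ℕ) by push_cast; ring] at e
      have h2 : (j + 2 : ℂ) ≠ 0 := by exact_mod_cast (by omega : j + 2 ≠ 0)
      refine (mul_eq_zero.mp (?_ : (j + 2 : ℂ) * _ = 0)).resolve_left h2
      push_cast at e ⊢
      linear_combination e
  refine mem_degLE_pred hc hd fun b n hb hb' hbn => ?_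
  have := key (k - b).toNat n (by omega)
  rwa [Int.toNat_of_nonneg (by omega), sub_sub_cancel] at this

end Rows

/-! ### The duality pairing and degrees -/

section Pairing

/-- The value `⟨u_a, u_(k-a)⟩` of the duality pairing. -/
def pairWeight (k a : ℕ) : ℂ := (-1) ^ a * (a.factorial * (k - a).factorial) / k.factorial

variable {k : ℕ}

theorem gramMat_apply (a b : Fin (k + 1)) :
    gramMat k a b = if b = a.rev then C (pairWeight k a) else 0 := by
  have ha : (a : ℕ) ≤ k := by omega
  rw [gramMat, symGram, Matrix.of_apply, kl2Gram_zero_one, kl2Gram_one_zero]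
  by_cases h : b = a.rev
  · have hb : (b : ℕ) = k - a := by rw [h, Fin.val_rev]; omega
    rw [if_pos h, if_pos (by omega), hb, ← map_pow, ← map_pow, ← map_mul, ← map_mul, pairWeight]
    congr 1
    rw [one_pow]
    ring
  · rw [if_neg h, if_neg]
    intro h'
    refine h (Fin.ext ?_)
    rw [Fin.val_rev]
    omega

theorem gramPair_gramMat (φ : Rz →+* LaurentSeries ℂ) (hφ : ∀ c, φ (C c) = HahnSeries.C c)
    (f g : Formal k) : gramPair ((gramMat k).map φ) f g =
      ∑ a : Fin (k + 1), HahnSeries.C (pairWeight k a) * (f a * g a.rev) := by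
  rw [gramPair, dotProduct]
  refine Finset.sum_congr rfl fun a _ => ?_
  rw [Matrix.mulVec, dotProduct, Finset.sum_eq_single a.rev]
  · rw [Matrix.map_apply, gramMat_apply, if_pos rfl, hφ]
    ring
  · intro b _ hb
    rw [Matrix.map_apply, gramMat_apply, if_neg hb, map_zero, zero_mul]
  · simp

theorem pairInf_eq (f g : Formal k) :
    pairInf k f g = ∑ a : Fin (k + 1), HahnSeries.C (pairWeight k a) * (f a * g a.rev) := by
  refine gramPair_gramMat _ (fun c => ?_) f g
  rw [← mul_one (C c), ← T_zero, ← smul_eq_C_mul, expandInf_smul, expandInf_T, neg_zero,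
    smul_single_ls, HahnSeries.C_apply]

theorem pairZero_eq (f g : Formal k) :
    pairZero k f g = ∑ a : Fin (k + 1), HahnSeries.C (pairWeight k a) * (f a * g a.rev) := by
  refine gramPair_gramMat _ (fun c => ?_) f g
  rw [← mul_one (C c), ← T_zero, ← smul_eq_C_mul, expandZero_smul, expandZero_T,
    smul_single_ls, HahnSeries.C_apply]

theorem coeff_sum_ls {ι : Type*} (s : Finset ι) (f : ι → LaurentSeries ℂ) (n : ℤ) :
    (∑ i ∈ s, f i).coeff n = ∑ i ∈ s, (f i).coeff n :=
  map_sum (HahnSeries.coeff.addMonoidHom n) f s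

theorem coeff_mul_ls_of_lt {f g : LaurentSeries ℂ} {i j n : ℤ} (hf : ∀ m < i, f.coeff m = 0)
    (hg : ∀ m < j, g.coeff m = 0) (hn : n < i + j) : (f * g).coeff n = 0 := by
  rw [HahnSeries.coeff_mul]
  refine Finset.sum_eq_zero fun x hx => ?_
  rw [Finset.mem_antidiagonal] at hx
  rcases lt_or_ge x.1 i with h | h
  · rw [hf _ h, zero_mul]
  · rw [hg _ (by omega), mul_zero]

theorem coeff_mul_ls_add {f g : LaurentSeries ℂ} {i j : ℤ} (hf : ∀ m < i, f.coeff m = 0)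
    (hg : ∀ m < j, g.coeff m = 0) : (f * g).coeff (i + j) = f.coeff i * g.coeff j := by
  rw [HahnSeries.coeff_mul, Finset.sum_eq_single (i, j)]
  · rintro x hx hne
    rw [Finset.mem_antidiagonal] at hx
    rcases lt_trichotomy x.1 i with h | h | h
    · rw [hf _ h, zero_mul]
    · exact absurd (Prod.ext h (by omega)) hne
    · rw [hg _ (by omega), mul_zero]
  · intro h
    rw [Finset.mem_antidiagonal] at h
    by_cases h1 : f.coeff i = 0
    · rw [h1, zero_mul]
    · by_cases h2 : g.coeff j = 0
      · rw [h2, mul_zero]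
      · exact absurd ⟨h1, h2, rfl⟩ h

theorem infArr_coeff (f : Formal k) (a : Fin (k + 1)) (n : ℤ) :
    (f a).coeff n = infArr f (a : ℕ) (-n) := by
  rw [infArr_fin, neg_neg]

theorem infArr_coeff_rev (f : Formal k) (a : Fin (k + 1)) (n : ℤ) :
    (f a.rev).coeff n = infArr f (k - (a : ℕ)) (-n) := by
  rw [infArr_coeff, Fin.val_rev, show ((k + 1 - ((a : ℕ) + 1) : ℕ) : ℤ) = k - (a : ℕ) by omega]

/-- The pairing matches `z^n u_a` with `z^m u_(k-a)`, whose degrees add up to `k + 2(n + m)`, and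
gives a multiple of `w^(-(n+m))`. -/
theorem coeff_pairInf_of_lt {f g : Formal k} {d e t : ℤ} (hf : infArr f ∈ DegLE d)
    (hg : infArr g ∈ DegLE e) (h : d + e < k - 2 * t) : (pairInf k f g).coeff t = 0 := by
  rw [pairInf_eq, coeff_sum_ls]
  refine Finset.sum_eq_zero fun a _ => ?_
  -- The `+ 1` turns the floor into a ceiling: these are the smallest orders in `w` that the degree
  -- bounds allow.
  rw [coeff_C_mul_ls, coeff_mul_ls_of_lt (i := ((a : ℕ) - d + 1) / 2)
    (j := (k - (a : ℕ) - e + 1) / 2) (fun m hm => ?_) (fun m hm => ?_) (by omega), mul_zero]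
  · rw [infArr_coeff]
    exact hf _ _ (by omega)
  · rw [infArr_coeff_rev]
    exact hg _ _ (by omega)

theorem sum_range_even (p : ℕ) (h : ℕ → ℂ) (h0 : ∀ a, Odd a → h a = 0) :
    ∑ a ∈ Finset.range (2 * p + 1), h a = ∑ r ∈ Finset.range (p + 1), h (2 * r) := by
  induction p with
  | zero => simp
  | succ p ih =>
    rw [show 2 * (p + 1) + 1 = (2 * p + 1) + 1 + 1 by ring, Finset.sum_range_succ,
      Finset.sum_range_succ, ih, h0 _ ⟨p, rfl⟩, add_zero, Finset.sum_range_succ _ (p + 1)]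
    rfl

/-- At this extreme coefficient only the parts of top degree meet. Both degrees are even, so only
even `a = 2 r` contribute. -/
theorem coeff_pairInf_top {p : ℕ} {f g : Formal (2 * p)} {D : ℤ} (hf : infArr f ∈ DegLE (2 * D))
    (hg : infArr g ∈ DegLE (2 * p)) : (pairInf (2 * p) f g).coeff (-D) =
      ∑ r ∈ Finset.range (p + 1), pairWeight (2 * p) (2 * r)
        * (infArr f (2 * r) (D - r) * infArr g (2 * p - 2 * r) r) := by
  set h : ℕ → ℂ := fun a => if Even a then pairWeight (2 * p) a
    * (infArr f a (D - a / 2) * infArr g (2 * p - a) (a / 2)) else 0 with hh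
  have e : (pairInf (2 * p) f g).coeff (-D) = ∑ a ∈ Finset.range (2 * p + 1), h a := by
    rw [pairInf_eq, coeff_sum_ls, ← Fin.sum_univ_eq_sum_range]
    refine Finset.sum_congr rfl fun a _ => ?_
    have hf' : ∀ m < ((a : ℕ) - 2 * D + 1) / 2, (f a).coeff m = 0 := fun m hm => by
      rw [infArr_coeff]
      exact hf _ _ (by omega)
    have hg' : ∀ m < (1 - ((a : ℕ) : ℤ)) / 2, (g a.rev).coeff m = 0 := fun m hm => by
      rw [infArr_coeff_rev]
      exact hg _ _ (by push_cast; omega)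
    rw [coeff_C_mul_ls, hh]
    simp only
    split_ifs with ha
    · obtain ⟨r, hr⟩ := ha
      have h1 := coeff_mul_ls_add hf' hg'
      rw [show ((a : ℕ) - 2 * D + 1) / 2 + (1 - ((a : ℕ) : ℤ)) / 2 = -D by omega] at h1
      rw [h1, infArr_coeff, infArr_coeff_rev,
        show -((((a : ℕ) : ℤ) - 2 * D + 1) / 2) = D - ((a : ℕ) : ℤ) / 2 by omega,
        show -((1 - ((a : ℕ) : ℤ)) / 2) = ((a : ℕ) : ℤ) / 2 by omega]
      push_cast
      rfl
    · rw [Nat.not_even_iff_odd] at ha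
      obtain ⟨r, hr⟩ := ha
      -- For odd `a` both order bounds are rounded up, so the product starts at `w^(1 - D)`.
      rw [coeff_mul_ls_of_lt hf' hg' (by omega), mul_zero]
  rw [e, sum_range_even p h fun a ha => if_neg (Nat.not_even_iff_odd.mpr ha)]
  refine Finset.sum_congr rfl fun r _ => ?_
  simp only [hh]
  rw [if_pos (even_two_mul r)]
  push_cast
  rw [Int.mul_ediv_cancel_left _ two_ne_zero]

end Pairing

/-! ### Multiplication by powers of `z` -/

section Shift

/-- Multiplication by `zⁿ` on formal sections at `∞`. -/
def zShift {k : ℕ} (n : ℤ) (f : Formal k) : Formal k := fun a => HahnSeries.single (-n) 1 * f a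

variable {k : ℕ}

theorem infArr_zShift (n : ℤ) (f : Formal k) (a m : ℤ) :
    infArr (zShift n f) a m = infArr f a (m - n) := by
  rw [infArr_apply, infArr_apply, extendZero, extendZero]
  split_ifs with h
  · rw [zShift, HahnSeries.coeff_single_mul, one_mul]
    congr 1
    ring
  · simp

theorem zShift_mem_degLE {n d : ℤ} {f : Formal k} (hf : infArr f ∈ DegLE d) :
    infArr (zShift n f) ∈ DegLE (d + 2 * n) := fun a m h => by
  rw [infArr_zShift]
  exact hf _ _ (by omega)

theorem nablaInf_zShift {c : ℂ} {f : Formal k} (hf : nablaInf k f = c • f) (n : ℤ) :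
    nablaInf k (zShift n f) = (n + c) • zShift n f := by
  apply infArr_injective
  have e : ∀ a m, arrNabla k (infArr f) a m = c * infArr f a m := fun a m => by
    rw [← infArr_nablaInf, hf, map_smul, Pi.smul_apply, Pi.smul_apply, smul_eq_mul]
  ext a m
  have := e a (m - n)
  rw [infArr_nablaInf, map_smul, Pi.smul_apply, Pi.smul_apply, smul_eq_mul, arrNabla_apply,
    infArr_zShift, infArr_zShift, infArr_zShift]
  rw [arrNabla_apply] at this
  rw [show m - 1 - n = m - n - 1 by ring]
  push_cast at this
  linear_combination this

end Shift

/-! ### A central binomial sum: the self-pairing of the kernel of the symbol -/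

section CentralBinom

/-- The square of the generating function `(1 - 4x)^(-1/2)` is `(1 - 4x)^(-1)`. Here the sum
weighted by the first index is computed twice, by symmetry and by the recurrence of central binomial
coefficients. -/
theorem sum_centralBinom_mul_centralBinom (n : ℕ) :
    ∑ x ∈ Finset.HasAntidiagonal.antidiagonal n, (x.1.centralBinom : ℂ) * x.2.centralBinom = 4 ^ n := by
  induction n with
  | zero => simp
  | succ n ih =>
    set s : ℂ := ∑ x ∈ Finset.HasAntidiagonal.antidiagonal (n + 1), (x.1.centralBinom : ℂ) * x.2.centralBinom
      with hs
    set e : ℂ := ∑ x ∈ Finset.HasAntidiagonal.antidiagonal (n + 1),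
      (x.1 : ℂ) * (x.1.centralBinom * x.2.centralBinom) with he
    -- Exchanging the two indices shows that the first index averages to `m / 2`.
    have symm : ∀ (m : ℕ), 2 * ∑ x ∈ Finset.HasAntidiagonal.antidiagonal m,
        (x.1 : ℂ) * (x.1.centralBinom * x.2.centralBinom) =
        m * ∑ x ∈ Finset.HasAntidiagonal.antidiagonal m, (x.1.centralBinom : ℂ) * x.2.centralBinom := fun m => by
      rw [two_mul]
      nth_rewrite 2 [← Finset.Nat.sum_antidiagonal_swap]
      rw [← Finset.sum_add_distrib, Finset.mul_sum]
      refine Finset.sum_congr rfl fun x hx => ?_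
      rw [← Finset.HasAntidiagonal.mem_antidiagonal.mp hx]
      simp only [Prod.fst_swap, Prod.snd_swap]
      push_cast
      ring
    have h1 := symm (n + 1)
    have h2 : e = 2 * (n + 1) * 4 ^ n := by
      rw [he, Finset.Nat.sum_antidiagonal_succ, ← ih]
      have : ∀ x ∈ Finset.HasAntidiagonal.antidiagonal n,
          ((x.1 + 1 : ℕ) : ℂ) * ((x.1 + 1).centralBinom * x.2.centralBinom) =
          4 * ((x.1 : ℂ) * (x.1.centralBinom * x.2.centralBinom))
            + 2 * (x.1.centralBinom * x.2.centralBinom) := fun x _ => by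
        have := congrArg (Nat.cast (R := ℂ)) (Nat.succ_mul_centralBinom_succ x.1)
        push_cast at this ⊢
        linear_combination (x.2.centralBinom : ℂ) * this
      rw [Finset.sum_congr rfl this, Finset.sum_add_distrib, ← Finset.mul_sum, ← Finset.mul_sum]
      have := symm n
      simp only [Nat.cast_zero, zero_mul, zero_add]
      linear_combination 2 * this
    have hn : ((n + 1 : ℕ) : ℂ) ≠ 0 := Nat.cast_ne_zero.mpr n.succ_ne_zero
    apply mul_left_cancel₀ hn
    rw [← h1, ← he, h2]
    push_cast
    ring

theorem pairWeight_mul_choose_sq (p r : ℕ) (hr : r ≤ p) :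
    pairWeight (2 * p) (2 * r) * (p.choose r * p.choose r) =
      (r.centralBinom : ℂ) * (p - r).centralBinom / p.centralBinom := by
  obtain ⟨s, rfl⟩ := Nat.exists_eq_add_of_le hr
  have cb : ∀ n : ℕ, (n.centralBinom : ℂ) = (2 * n).factorial / (n.factorial * n.factorial) := by
    intro n
    rw [Nat.centralBinom_eq_two_mul_choose, Nat.cast_choose ℂ (by omega),
      show 2 * n - n = n by omega]
  have hf : ∀ n : ℕ, (n.factorial : ℂ) ≠ 0 := fun n => Nat.cast_ne_zero.mpr n.factorial_ne_zero
  rw [cb, cb, cb, Nat.cast_choose ℂ hr, pairWeight, Even.neg_one_pow (even_two_mul r),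
    show r + s - r = s by omega, show 2 * (r + s) - 2 * r = 2 * s by omega]
  have := hf r
  have := hf s
  have := hf (r + s)
  have := hf (2 * (r + s))
  have := hf (2 * s)
  have := hf (2 * r)
  field_simp

/-- Up to the sign `(-1)^p`, this is the self-pairing of `(v₁² - z v₀²)^p`, the part of top degree
of the eigensection, with the power of `z` left out. -/
theorem sum_pairWeight_mul_choose_sq (p : ℕ) :
    ∑ r ∈ Finset.range (p + 1), pairWeight (2 * p) (2 * r) * (p.choose r * p.choose r) =
      4 ^ p / (p.centralBinom : ℂ) := by
  rw [← sum_centralBinom_mul_centralBinom, Finset.Nat.sum_antidiagonal_eq_sum_range_succ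
    (fun i j => (i.centralBinom : ℂ) * j.centralBinom), Finset.sum_div]
  exact Finset.sum_congr rfl fun r hr =>
    pairWeight_mul_choose_sq p r (by rw [Finset.mem_range] at hr; omega)

end CentralBinom

/-! ### Pairing with the eigensection; the approximation step in even degree -/

section Bessel

/-- The eigensection at `∞` of `Sym^(2p) Kl₂` with eigenvalue `p/2`, normalized by powers of the
Bessel series. -/
def IsBesselSection (p : ℕ) (Q : Formal (2 * p)) : Prop :=
  nablaInf (2 * p) Q = ((p : ℂ) / 2) • Q ∧
    Q (Fin.last (2 * p)) = HahnSeries.ofPowerSeries ℤ ℂ (besselSeries ^ p)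

theorem exists_isBesselSection (p : ℕ) : ∃ Q, IsBesselSection p Q := by
  obtain ⟨Q, h1, h2⟩ := exists_horizontal (even_two_mul p)
  refine ⟨Q, ?_, ?_⟩
  · rw [h1]
    congr 1
    push_cast
    ring
  · rw [h2, Nat.mul_div_cancel_left _ two_pos]

theorem constantCoeff_besselSeries_pow (p : ℕ) : PowerSeries.coeff 0 (besselSeries ^ p) = 1 := by
  rw [PowerSeries.coeff_zero_eq_constantCoeff_apply, map_pow,
    ← PowerSeries.coeff_zero_eq_constantCoeff_apply, besselSeries, PowerSeries.coeff_mk]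
  simp

variable {p : ℕ} {Q : Formal (2 * p)}

namespace IsBesselSection

theorem arr_last (hQ : IsBesselSection p Q) (n : ℤ) : infArr Q (2 * p) n =
    (HahnSeries.ofPowerSeries ℤ ℂ (besselSeries ^ p)).coeff (-n) := by
  rw [← hQ.2, infArr_coeff, neg_neg, Fin.val_last]
  push_cast
  rfl

theorem arr_last_zero (hQ : IsBesselSection p Q) : infArr Q (2 * p) 0 = 1 := by
  rw [hQ.arr_last, neg_zero]
  exact (coeff_ofPowerSeries _ 0).trans (constantCoeff_besselSeries_pow p)

theorem recurrence (hQ : IsBesselSection p Q) (a n : ℤ) : n * infArr Q a n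
    + (2 * p - a + 1) * infArr Q (a - 1) n + (a + 1) * infArr Q (a + 1) (n - 1) =
      p / 2 * infArr Q a n := by
  have e := congrFun (congrFun (infArr_nablaInf Q) a) n
  rw [hQ.1, map_smul, Pi.smul_apply, Pi.smul_apply, smul_eq_mul, arrNabla_apply] at e
  rw [e]
  push_cast
  ring

/-- The `u_(2p)`-coefficient is a power series in `w`, hence of degree at most `2p`. The eigenvalue
equation at `a` expresses the coefficient at `a - 1` through those at `a` and `a + 1`, so the bound
descends. -/
theorem mem_degLE (hQ : IsBesselSection p Q) : infArr Q ∈ DegLE (2 * p) := by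
  have key : ∀ j : ℕ, ∀ n : ℤ, (2 * p : ℤ) < 2 * n + (2 * p - j) → infArr Q (2 * p - j) n = 0 := by
    intro j
    induction j using Nat.strong_induction_on with
    | _ j ih =>
    intro n hn
    match j with
    | 0 =>
      rw [Nat.cast_zero, sub_zero, hQ.arr_last,
        coeff_ofPowerSeries_of_neg _ (by push_cast at hn; omega)]
    | j + 1 =>
      have e := hQ.recurrence (2 * p - j) n
      have e1 : infArr Q (2 * p - j + 1) (n - 1) = 0 := by
        match j with
        | 0 => exact infArr_mem_rowSupp Q _ _ (Or.inr (by push_cast; omega))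
        | j + 1 =>
          have := ih j (by omega) (n - 1) (by push_cast at hn; omega)
          rwa [show (2 * p : ℤ) - (j + 1 : ℕ) + 1 = 2 * p - j by push_cast; ring]
      rw [ih j (by omega) n (by push_cast at hn; omega), e1,
        show (2 * p : ℤ) - j - 1 = 2 * p - (j + 1 : ℕ) by push_cast; ring] at e
      have h2 : (j + 1 : ℂ) ≠ 0 := Nat.cast_add_one_ne_zero j
      refine (mul_eq_zero.mp (?_ : (j + 1 : ℂ) * _ = 0)).resolve_left h2
      push_cast at e ⊢
      linear_combination e
  intro a n h
  by_cases ha : a ≤ 2 * p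
  · have := key (2 * p - a).toNat n (by omega)
    rwa [Int.toNat_of_nonneg (by omega), sub_sub_cancel] at this
  · exact infArr_mem_rowSupp Q _ _ (Or.inr (by push_cast; omega))

/-- The part of top degree lies in the kernel of the symbol and starts with `u_(2p)`, so it is `(v₁²
- z v₀²)^p`. -/
theorem arr_top (hQ : IsBesselSection p Q) (r : ℕ) :
    infArr Q (2 * p - 2 * r) r = (-1) ^ r * p.choose r := by
  induction r with
  | zero => simp [hQ.arr_last_zero]
  | succ r ih =>
    rcases lt_or_ge r p with h | h
    · have e := hQ.recurrence (2 * p - 2 * r - 1) (r + 1)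
      -- The monomial compared has degree `2p + 1`, so the Euler term and the eigenvalue term drop
      -- out and the symbol alone remains.
      rw [hQ.mem_degLE (2 * p - 2 * r - 1) _ (by omega), sub_add_cancel, add_sub_cancel_right, ih,
        show (2 * p : ℤ) - 2 * r - 1 - 1 = 2 * p - 2 * (r + 1 : ℕ) by push_cast; ring] at e
      have h1 := congrArg (Nat.cast (R := ℂ)) (Nat.choose_succ_right_eq p r)
      push_cast [Nat.cast_sub h.le] at h1
      have h2 : (r + 1 : ℂ) ≠ 0 := Nat.cast_add_one_ne_zero r
      apply mul_left_cancel₀ h2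
      push_cast at e ⊢
      linear_combination e / 2 + (-1) ^ r * h1
    · rw [infArr_mem_rowSupp Q _ _ (Or.inl (by push_cast; omega)),
        Nat.choose_eq_zero_of_lt (by omega)]
      simp

/-- Leibniz rule with `z ∂/∂z = -w ∂/∂w`. At `t = -p/2` the right side vanishes: this coefficient is
the obstruction to being in the image of the connection. -/
theorem coeff_pairInf_nablaInf (hQ : IsBesselSection p Q) (f : Formal (2 * p)) (t : ℤ) :
    (pairInf (2 * p) (nablaInf (2 * p) f) Q).coeff t =
      -(t + p / 2) * (pairInf (2 * p) f Q).coeff t := by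
  have e := congrArg (fun g => HahnSeries.coeff g t) (pairInf_nabla (2 * p) f Q)
  rw [hQ.1] at e
  simp only [pairInf, gramPair_smul_right, HahnSeries.coeff_add, HahnSeries.coeff_smul,
    HahnSeries.coeff_neg, coeff_lsEuler, smul_eq_mul] at e ⊢
  linear_combination e

theorem coeff_pairInf_zShift (hQ : IsBesselSection p Q) (n : ℤ) :
    (pairInf (2 * p) (zShift n Q) Q).coeff (-(n + p)) = (-1) ^ p * 4 ^ p / (p.centralBinom : ℂ) := by
  have hd := zShift_mem_degLE (n := n) hQ.mem_degLE
  rw [show (2 * p : ℤ) + 2 * n = 2 * (n + p) by ring] at hd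
  rw [coeff_pairInf_top hd hQ.mem_degLE, mul_div_assoc, ← sum_pairWeight_mul_choose_sq,
    Finset.mul_sum]
  refine Finset.sum_congr rfl fun r hr => ?_
  rw [Finset.mem_range] at hr
  obtain ⟨s, rfl⟩ := Nat.exists_eq_add_of_le (show r ≤ p by omega)
  have e := hQ.arr_top s
  rw [show (2 * (r + s : ℕ) : ℤ) - 2 * s = 2 * r by push_cast; ring] at e
  rw [infArr_zShift, show n + ((r + s : ℕ) : ℤ) - r - n = s by push_cast; ring, e, hQ.arr_top,
    show (r + s).choose s = (r + s).choose r from Nat.choose_symm_add.symm]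
  ring

end IsBesselSection

theorem bessel_norm_ne_zero (p : ℕ) : (-1 : ℂ) ^ p * 4 ^ p / (p.centralBinom : ℂ) ≠ 0 :=
  div_ne_zero (mul_ne_zero (pow_ne_zero _ (by norm_num)) (pow_ne_zero _ (by norm_num)))
    (Nat.cast_ne_zero.mpr p.centralBinom_ne_zero)

/-- Pairing with `Q` detects the cokernel of the symbol. The section `Z` has degree `2D` and
eigenvalue `D - p/2`; if this is non-zero, a multiple of `Z` removes the defect, and otherwise the
defect is assumed to be zero. The rest of the degree `2D` part is then in the image of the symbol.
-/
theorem exists_step_of_even (hQ : IsBesselSection p Q) {D : ℤ} {f : Formal (2 * p)}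
    (hd : infArr f ∈ DegLE (2 * D))
    (h : 2 * D ≠ p ∨ (pairInf (2 * p) f Q).coeff (-D) = 0) :
    ∃ m ∈ RowSupp (2 * p), m ∈ DegLE (2 * D) ∧
      infArr f - arrNabla (2 * p) m ∈ DegLE (2 * D - 1) := by
  set κ : ℂ := (-1) ^ p * 4 ^ p / (p.centralBinom : ℂ) with hκ
  have hκ0 : κ ≠ 0 := bessel_norm_ne_zero p
  set ψ : ℂ := (pairInf (2 * p) f Q).coeff (-D) with hψ
  set Z := zShift (D - p) Q with hZ
  have hZd : infArr Z ∈ DegLE (2 * D) := by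
    have := zShift_mem_degLE (n := D - p) hQ.mem_degLE
    rwa [show (2 * p : ℤ) + 2 * (D - p) = 2 * D by ring] at this
  -- `κ` is the pairing of `Z` with `Q` in the relevant coefficient, so `μ` is chosen to make `∇ (μ
  -- • Z)` carry all of `ψ`.
  obtain ⟨μ, hμ⟩ : ∃ μ : ℂ, (D - p / 2) * μ = ψ / κ := by
    rcases h with h | h
    · have : (D - p / 2 : ℂ) ≠ 0 := by
        intro h0
        apply h
        have : (2 * D : ℂ) = p := by linear_combination 2 * h0
        exact_mod_cast this
      exact ⟨ψ / κ / (D - p / 2), mul_div_cancel₀ _ this⟩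
    · exact ⟨0, by rw [h]; simp⟩
  have hZn : nablaInf (2 * p) (μ • Z) = (ψ / κ) • Z := by
    rw [map_smul, hZ, nablaInf_zShift hQ.1, smul_smul, ← hμ]
    congr 1
    push_cast
    ring
  set g := f - nablaInf (2 * p) (μ • Z) with hg
  have hgd : infArr g ∈ DegLE (2 * D) := by
    rw [hg, hZn, map_sub, map_smul]
    exact sub_mem hd (Submodule.smul_mem _ _ hZd)
  have hgψ : (pairInf (2 * p) g Q).coeff (-D) = 0 := by
    have e := hQ.coeff_pairInf_zShift (D - p)
    rw [sub_add_cancel, ← hZ, ← hκ] at e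
    have : pairInf (2 * p) g Q = pairInf (2 * p) f Q + (-(ψ / κ)) • pairInf (2 * p) Z Q := by
      rw [hg, hZn, sub_eq_add_neg, ← neg_smul (ψ / κ) Z]
      simp only [pairInf, gramPair_add_left, gramPair_smul_left]
    rw [this, HahnSeries.coeff_add, HahnSeries.coeff_smul, e, ← hψ, smul_eq_mul, neg_mul,
      div_mul_cancel₀ _ hκ0, add_neg_cancel]
  obtain ⟨m, hm, hmd, h0⟩ := exists_homogeneous_up (2 * p) (2 * D) (infArr g)
  obtain ⟨m', rfl⟩ := exists_infArr_eq hm hmd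
  rw [← infArr_nablaInf, ← map_sub] at h0
  set r := g - nablaInf (2 * p) m' with hr
  have hrd : infArr r ∈ DegLE (2 * D) := by
    rw [hr, map_sub, infArr_nablaInf]
    exact sub_arrNabla_mem_degLE hgd hmd
  -- Subtracting `∇ m'` does not disturb the vanishing, because `m'` has degree at most `2D - 1` and
  -- cannot reach `w^(-D)` when paired with `Q`.
  have hrψ : (pairInf (2 * p) r Q).coeff (-D) = 0 := by
    have e : pairInf (2 * p) r Q =
        pairInf (2 * p) g Q + (-1 : ℂ) • pairInf (2 * p) (nablaInf (2 * p) m') Q := by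
      rw [hr, sub_eq_add_neg, ← neg_one_smul ℂ (nablaInf (2 * p) m')]
      simp only [pairInf, gramPair_add_left, gramPair_smul_left]
    rw [e, HahnSeries.coeff_add, HahnSeries.coeff_smul, hgψ, hQ.coeff_pairInf_nablaInf,
      coeff_pairInf_of_lt hmd hQ.mem_degLE (by push_cast; omega)]
    simp
  -- Only the `u_(2p)`-coefficient of `r` survives in top degree, and its partner in `Q` is a sign;
  -- vanishing of the pairing thus forces it to vanish.
  have htop : infArr r (2 * p) (D - p) = 0 := by
    rw [coeff_pairInf_top hrd hQ.mem_degLE, Finset.sum_eq_single p] at hrψ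
    · have hw : pairWeight (2 * p) (2 * p) ≠ 0 :=
        by simp [pairWeight, Nat.factorial_ne_zero]
      rw [hQ.arr_top, Nat.choose_self, Nat.cast_one, mul_one] at hrψ
      exact (mul_eq_zero.mp ((mul_eq_zero.mp hrψ).resolve_left hw)).resolve_right
        (pow_ne_zero _ (by norm_num))
    · intro s hs hsp
      rw [Finset.mem_range] at hs
      rw [h0 _ _ (by omega) (by push_cast; omega) (by ring), zero_mul, mul_zero]
    · simp
  refine ⟨infArr (m' + μ • Z), infArr_mem_rowSupp _, ?_, ?_⟩
  · rw [map_add, map_smul]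
    exact add_mem (DegLE.mono (by omega) hmd) (Submodule.smul_mem _ _ hZd)
  · rw [← infArr_nablaInf, ← map_sub, map_add,
      add_comm (nablaInf (2 * p) m'), ← sub_sub, ← hg, ← hr]
    refine mem_degLE_pred (infArr_mem_rowSupp _) hrd fun b n hb hb' hbn => ?_
    rcases hb'.lt_or_eq with h' | rfl
    · exact h0 b n hb h' hbn
    · push_cast at hbn ⊢
      rwa [show n = D - p by omega]

end Bessel

/-! ### Formal primitives by successive approximation -/

section Completeness

/-- Successive approximation along a filtration given by a weight function. -/
theorem exists_eq_of_approx {k : ℕ} (w : ℤ → ℤ → ℤ) (D : Arr →ₗ[ℂ] Arr)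
    (hD : ∀ (j : ℤ) (c : Arr), (∀ a n, w a n < j → c a n = 0) →
      ∀ a n, w a n < j - 1 → D c a n = 0)
    (j₀ : ℤ) (step : ∀ (j : ℤ) (c : Arr), j₀ ≤ j → c ∈ RowSupp k →
      (∀ a n, w a n < j → c a n = 0) → ∃ m ∈ RowSupp k, (∀ a n, w a n < j → m a n = 0) ∧
        c - D m ∈ RowSupp k ∧ ∀ a n, w a n < j + 1 → (c - D m) a n = 0)
    {c : Arr} (hc : c ∈ RowSupp k) (hcw : ∀ a n, w a n < j₀ → c a n = 0) :
    ∃ m ∈ RowSupp k, (∀ a n, w a n < j₀ → m a n = 0) ∧ D m = c := by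
  -- The step is stated for every array, with a junk value outside its domain, so that one choice
  -- function serves the whole iteration.
  have step' : ∀ (j : ℕ) (c : Arr), ∃ m : Arr, c ∈ RowSupp k →
      (∀ a n, w a n < j₀ + j → c a n = 0) → m ∈ RowSupp k ∧
        (∀ a n, w a n < j₀ + j → m a n = 0) ∧
        c - D m ∈ RowSupp k ∧ ∀ a n, w a n < j₀ + j + 1 → (c - D m) a n = 0 := by
    intro j c
    by_cases h : c ∈ RowSupp k ∧ ∀ a n, w a n < j₀ + j → c a n = 0
    · obtain ⟨m, h1, h2, h3, h4⟩ := step (j₀ + j) c (by omega) h.1 h.2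
      exact ⟨m, fun _ _ => ⟨h1, h2, h3, h4⟩⟩
    · exact ⟨0, fun h1 h2 => absurd ⟨h1, h2⟩ h⟩
  choose Φ hΦ using step'
  let r : ℕ → Arr := fun j => Nat.rec c (fun j c => c - D (Φ j c)) j
  have hr : ∀ j, r j ∈ RowSupp k ∧ ∀ a n, w a n < j₀ + j → r j a n = 0 := by
    intro j
    induction j with
    | zero => exact ⟨hc, fun a n h => hcw a n (by simpa using h)⟩
    | succ j ih =>
      have := hΦ j (r j) ih.1 ih.2
      exact ⟨this.2.2.1, fun a n h => this.2.2.2 a n (by push_cast at h; omega)⟩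
  have hm := fun j => hΦ j (r j) (hr j).1 (hr j).2
  have hsum : ∀ N, D (∑ i ∈ Finset.range N, Φ i (r i)) = c - r N := by
    intro N
    induction N with
    | zero => simp [r]
    | succ N ih =>
      rw [Finset.sum_range_succ, map_add, ih]
      change _ = c - (r N - D (Φ N (r N)))
      abel
  have happ : ∀ (f : ℕ → Arr) (s : Finset ℕ) (a n : ℤ),
      (∑ i ∈ s, f i) a n = ∑ i ∈ s, f i a n := fun f s a n => by
    rw [Finset.sum_apply, Finset.sum_apply]
  -- The infinite sum of corrections: the correction at stage `i` vanishes in weight below `j₀ + i`,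
  -- so each entry is a finite sum.
  let m : Arr := fun a n => ∑ i ∈ Finset.range (w a n - j₀ + 1).toNat, Φ i (r i) a n
  have hmN : ∀ (N : ℕ) a n, w a n < j₀ + N → (m - ∑ i ∈ Finset.range N, Φ i (r i)) a n = 0 := by
    intro N a n h
    rw [Pi.sub_apply, Pi.sub_apply, happ, sub_eq_zero]
    refine Finset.sum_subset (Finset.range_subset_range.mpr (by omega)) fun i _ hi => ?_
    rw [Finset.mem_range] at hi
    exact (hm i).2.1 a n (by omega)
  refine ⟨m, fun a n h => Finset.sum_eq_zero fun i _ => (hm i).1 a n h, fun a n h => ?_, ?_⟩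
  · have := hmN 0 a n (by simpa using h)
    simpa using this
  · ext a n
    -- The margin 2 makes up for the loss of one weight under `D`, the inequality being strict.
    set N := (w a n - j₀ + 2).toNat with hN
    have e := hD _ _ (hmN N) a n (by omega)
    rw [map_sub, hsum, Pi.sub_apply, Pi.sub_apply, Pi.sub_apply, Pi.sub_apply,
      (hr N).2 a n (by omega), sub_zero] at e
    exact sub_eq_zero.mp e

variable {k : ℕ}

theorem exists_arrNabla_eq_of_degLE {d₀ : ℤ} (step : ∀ d ≤ d₀, ∀ c ∈ RowSupp k, c ∈ DegLE d →
      ∃ m ∈ RowSupp k, m ∈ DegLE d ∧ c - arrNabla k m ∈ DegLE (d - 1))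
    {c : Arr} (hc : c ∈ RowSupp k) (hd : c ∈ DegLE d₀) :
    ∃ m ∈ RowSupp k, m ∈ DegLE d₀ ∧ arrNabla k m = c := by
  obtain ⟨m, h1, h2, h3⟩ := exists_eq_of_approx (k := k) (fun a n => -(2 * n + a)) (arrNabla k)
    (fun j c h a n ha => arrNabla_mem_degLE (k := k) (d := -j)
      (fun a n ha => h a n (by omega)) a n (by omega)) (-d₀)
    (fun j c hj hc h => by
      obtain ⟨m, h1, h2, h3⟩ := step (-j) (by omega) c hc (fun a n ha => h a n (by omega))
      exact ⟨m, h1, fun a n ha => h2 a n (by omega), sub_mem hc (arrNabla_mem_rowSupp h1),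
        fun a n ha => h3 a n (by omega)⟩) hc (fun a n ha => hd a n (by omega))
  exact ⟨m, h1, fun a n ha => h2 a n (by omega), h3⟩

/-- On the coefficient of `z^N`, modulo higher order, the connection acts as `N` plus a nilpotent
operator, which is invertible. -/
theorem exists_row_step {N : ℤ} (hN : N ≠ 0) {c : Arr} (hc : c ∈ RowSupp k) (hcN : c ∈ OrdGE N) :
    ∃ m ∈ RowSupp k, (∀ a n, n ≠ N → m a n = 0) ∧ c - arrNabla k m ∈ OrdGE (N + 1) := by
  obtain ⟨s, hs, hg⟩ := exists_row_of_ne_zero k (fun b => c b N) (Int.cast_ne_zero.mpr hN)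
  have hm : (fun a n => if n = N then s a else 0 : Arr) ∈ RowSupp k := fun a n ha => by
    simp only
    rw [hs a ha, ite_self]
  refine ⟨fun a n => if n = N then s a else 0, hm, fun a n h => if_neg h, fun b n hn => ?_⟩
  rcases (show n ≤ N by omega).lt_or_eq with h | rfl
  · exact sub_mem hcN (arrNabla_mem_ordGE fun a n ha => if_neg (by omega)) b n h
  · by_cases hb : 0 ≤ b ∧ b ≤ k
    · rw [Pi.sub_apply, Pi.sub_apply, arrNabla_apply, if_pos rfl, if_pos rfl, if_neg (by omega)]
      have := hg b hb.1 hb.2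
      rw [← this]
      ring
    · exact sub_mem hc (arrNabla_mem_rowSupp hm) b n (by omega)

theorem exists_arrNabla_eq_of_ordGE {N : ℤ} (hN : 1 ≤ N) {c : Arr} (hc : c ∈ RowSupp k)
    (hcN : c ∈ OrdGE N) : ∃ m ∈ RowSupp k, m ∈ OrdGE N ∧ arrNabla k m = c :=
  exists_eq_of_approx (k := k) (fun _ n => n) (arrNabla k)
    (fun j c h a n ha => arrNabla_mem_ordGE (k := k) (N := j) h a n (by omega)) N
    (fun j c hj hc h => by
      obtain ⟨m, h1, h2, h3⟩ := exists_row_step (N := j) (by omega) hc h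
      exact ⟨m, h1, fun a n ha => h2 a n (by omega), sub_mem hc (arrNabla_mem_rowSupp h1), h3⟩)
    hc hcN

theorem zeroArr_mem_rowSupp (f : Formal k) : zeroArr f ∈ RowSupp k := fun a n ha => by
  rw [zeroArr_apply, extendZero_of_notMem f ha, HahnSeries.coeff_zero]

theorem exists_nablaZero_eq {N : ℤ} (hN : 1 ≤ N) {f : Formal k} (hf : zeroArr f ∈ OrdGE N) :
    ∃ m : Formal k, zeroArr m ∈ OrdGE N ∧ nablaZero k m = f := by
  obtain ⟨m, h1, h2, h3⟩ := exists_arrNabla_eq_of_ordGE hN (zeroArr_mem_rowSupp f) hf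
  obtain ⟨m, rfl⟩ := exists_zeroArr_eq h1 h2
  exact ⟨m, h2, zeroArr_injective (by rw [zeroArr_nablaZero, h3])⟩

theorem exists_nablaInf_eq_of_odd (hk : Odd k) {d : ℤ} {f : Formal k} (hf : infArr f ∈ DegLE d) :
    ∃ m : Formal k, infArr m ∈ DegLE d ∧ nablaInf k m = f := by
  obtain ⟨m, h1, h2, h3⟩ := exists_arrNabla_eq_of_degLE (fun e _ c hc hd => by
    obtain ⟨m, h1, h2, h3⟩ := exists_step_of_odd (Or.inr hk) hc hd
    exact ⟨m, h1, DegLE.mono (by omega) h2, h3⟩) (infArr_mem_rowSupp f) hf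
  obtain ⟨m, rfl⟩ := exists_infArr_eq h1 h2
  exact ⟨m, h2, infArr_injective (by rw [infArr_nablaInf, h3])⟩

theorem exists_step_of_bessel {p : ℕ} {Q : Formal (2 * p)} (hQ : IsBesselSection p Q) {d : ℤ}
    {f : Formal (2 * p)} (hd : infArr f ∈ DegLE d)
    (h : d ≠ p ∨ ∀ D : ℤ, 2 * D = p → (pairInf (2 * p) f Q).coeff (-D) = 0) :
    ∃ m : Formal (2 * p), infArr m ∈ DegLE d ∧
      infArr (f - nablaInf (2 * p) m) ∈ DegLE (d - 1) := by
  obtain ⟨m, h1, h2, h3⟩ : ∃ m ∈ RowSupp (2 * p), m ∈ DegLE d ∧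
      infArr f - arrNabla (2 * p) m ∈ DegLE (d - 1) := by
    rcases Int.even_or_odd d with ⟨D, rfl⟩ | ho
    · rw [← two_mul] at *
      refine exists_step_of_even hQ hd ?_
      by_cases hp : 2 * D = p
      · exact Or.inr ((h.resolve_left (not_not.mpr hp)) D hp)
      · exact Or.inl hp
    · obtain ⟨m, h1, h2, h3⟩ := exists_step_of_odd (Or.inl ho) (infArr_mem_rowSupp f) hd
      exact ⟨m, h1, DegLE.mono (by omega) h2, h3⟩
  obtain ⟨m, rfl⟩ := exists_infArr_eq h1 h2
  exact ⟨m, h2, by rwa [map_sub, infArr_nablaInf]⟩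

/-- Degree `p` is the only obstructed one. Finitely many steps descend past it, each preserving the
hypothesis because `⟨∇ m, Q⟩` has no coefficient at `-p/2`. Below `p`, the infinite approximation
runs unconditionally. -/
theorem exists_nablaInf_eq_of_bessel {p : ℕ} {Q : Formal (2 * p)} (hQ : IsBesselSection p Q)
    {d : ℤ} {f : Formal (2 * p)} (hd : infArr f ∈ DegLE d)
    (h : ∀ D : ℤ, 2 * D = p → (pairInf (2 * p) f Q).coeff (-D) = 0) :
    ∃ m : Formal (2 * p), infArr m ∈ DegLE d ∧ nablaInf (2 * p) m = f := by
  -- `N` bounds the number of steps needed to get below degree `p`.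
  obtain ⟨N, hN⟩ : ∃ N : ℕ, d - p < N := ⟨(d - p).toNat + 1, by omega⟩
  induction N generalizing d f with
  | zero =>
    obtain ⟨m, h1, h2, h3⟩ := exists_arrNabla_eq_of_degLE (fun e he c hc hce => by
      obtain ⟨g, rfl⟩ := exists_infArr_eq hc hce
      obtain ⟨m, h1, h2⟩ := exists_step_of_bessel hQ hce (Or.inl (by push_cast at hN; omega))
      exact ⟨infArr m, infArr_mem_rowSupp m, h1, by rwa [map_sub, infArr_nablaInf] at h2⟩)
      (infArr_mem_rowSupp f) hd
    obtain ⟨m, rfl⟩ := exists_infArr_eq h1 h2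
    exact ⟨m, h2, infArr_injective (by rw [infArr_nablaInf, h3])⟩
  | succ N ih =>
    obtain ⟨m, h1, h2⟩ := exists_step_of_bessel hQ hd (Or.inr h)
    obtain ⟨m', h1', h2'⟩ := ih h2 (fun D hD => by
      have e : pairInf (2 * p) (f - nablaInf (2 * p) m) Q =
          pairInf (2 * p) f Q + (-1 : ℂ) • pairInf (2 * p) (nablaInf (2 * p) m) Q := by
        rw [sub_eq_add_neg, ← neg_one_smul ℂ (nablaInf (2 * p) m)]
        simp only [pairInf, gramPair_add_left, gramPair_smul_left]
      have hp : (p : ℂ) = 2 * D := by exact_mod_cast hD.symm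
      rw [e, HahnSeries.coeff_add, HahnSeries.coeff_smul, h D hD, hQ.coeff_pairInf_nablaInf, hp]
      push_cast
      rw [mul_div_cancel_left₀ _ two_ne_zero]
      simp) (by push_cast at hN; omega)
    refine ⟨m + m', ?_, ?_⟩
    · rw [map_add]
      exact add_mem h1 (DegLE.mono (by omega) h1')
    · rw [map_add, h2']
      abel

/-- A formal horizontal section at `z = 0`, with leading term `u_k`. -/
theorem exists_horizontal_zero (k : ℕ) : ∃ h : Formal k, nablaZero k h = 0 ∧
    zeroArr h ∈ OrdGE 0 ∧ zeroArr h k 0 = 1 := by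
  let e : Formal k := Pi.single (Fin.last k) 1
  have he : ∀ a n, zeroArr e a n = if a = k ∧ n = 0 then 1 else 0 := by
    intro a n
    by_cases ha : a < 0 ∨ (k : ℤ) < a
    · rw [zeroArr_mem_rowSupp e a n ha, if_neg (by omega)]
    · lift a to ℕ using by omega
      have := zeroArr_fin e ⟨a, by omega⟩ n
      simp only at this
      rw [this]
      by_cases h : a = k
      · subst h
        have : (⟨a, by omega⟩ : Fin (a + 1)) = Fin.last a := rfl
        simp [e, this, HahnSeries.coeff_one]
      · have : (⟨a, by omega⟩ : Fin (k + 1)) ≠ Fin.last k := fun h' => h (congrArg Fin.val h')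
        simp [e, this, h]
  have hN : zeroArr (nablaZero k e) ∈ OrdGE 1 := by
    intro a n hn
    -- In effect `∇ u_k = k z u_(k-1)` has order 1 in `z`, so `u_k` can be corrected by a primitive
    -- of order 1.
    rw [zeroArr_nablaZero, arrNabla_apply, he, he, he, if_neg (by omega : ¬ (a + 1 = k ∧ n - 1 = 0))]
    by_cases h0 : n = 0
    · subst h0
      by_cases ha : a - 1 = k
      · have : (a : ℂ) = k + 1 := by exact_mod_cast (by omega : a = k + 1)
        rw [this]
        simp
      · simp [ha]
    · rw [if_neg (by omega), if_neg (by omega)]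
      simp
  obtain ⟨m, hm, hme⟩ := exists_nablaZero_eq le_rfl hN
  refine ⟨e - m, by rw [map_sub, hme, sub_self], ?_, ?_⟩
  · rw [map_sub]
    refine sub_mem (fun a n hn => ?_) (OrdGE.mono (by omega) hm)
    rw [he, if_neg (by omega)]
  · rw [map_sub, Pi.sub_apply, Pi.sub_apply, he, hm _ _ (by omega)]
    simp

end Completeness

/-! ### The classes `ω_0, …, ω_{k'}` generate `H¹_dR` -/

section Generators

variable {k : ℕ}

theorem mk_sub_nabla (ω φ : Sec k) :
    (Submodule.Quotient.mk (ω - nabla k φ) : H1dR k) = Submodule.Quotient.mk ω := by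
  rw [Submodule.Quotient.eq, sub_sub_cancel_left]
  exact neg_mem ⟨φ, rfl⟩

theorem secArr_sub_nabla (ω φ : Sec k) :
    secArr (ω - nabla k φ) = secArr ω - arrNabla k (secArr φ) := by
  rw [map_sub, secArr_nabla]

theorem exists_mk_eq_ordGE_zero (ω : Sec k) : ∃ ω' : Sec k, secArr ω' ∈ OrdGE 0 ∧
    (Submodule.Quotient.mk ω' : H1dR k) = Submodule.Quotient.mk ω := by
  suffices h : ∀ (N : ℕ) (ω : Sec k), secArr ω ∈ OrdGE (-N) → ∃ ω' : Sec k, secArr ω' ∈ OrdGE 0 ∧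
      (Submodule.Quotient.mk ω' : H1dR k) = Submodule.Quotient.mk ω by
    obtain ⟨N, _, hN, -⟩ := exists_secArr_mem ω
    exact h N.natAbs ω (OrdGE.mono (by omega) hN)
  intro N
  induction N with
  | zero => exact fun ω h => ⟨ω, by simpa using h, rfl⟩
  | succ N ih =>
    intro ω h
    obtain ⟨m, h1, h2, h3⟩ := exists_row_step (by omega) (secArr_mem_rowSupp ω) h
    obtain ⟨φ, rfl⟩ := exists_secArr_eq (N := -((N + 1 : ℕ) : ℤ)) (d := k) h1
      (fun a n hn => h2 a n (by omega)) (fun a n hn => by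
        by_cases hn' : n = -((N + 1 : ℕ) : ℤ)
        · exact h1 a n (Or.inr (by omega))
        · exact h2 a n hn')
    rw [← secArr_sub_nabla] at h3
    obtain ⟨ω', h4, h5⟩ := ih _ (OrdGE.mono (by push_cast; omega) h3)
    exact ⟨ω', h4, h5.trans (mk_sub_nabla ω φ)⟩

theorem exists_step_of_le (hk : 1 ≤ k) {d : ℤ} (hkd : k ≤ d) {ω : Sec k} (hd : secArr ω ∈ DegLE d) :
    ∃ m ∈ RowSupp k, m ∈ DegLE d ∧ secArr ω - arrNabla k m ∈ DegLE (d - 1) := by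
  rcases Nat.even_or_odd' k with ⟨p, rfl | rfl⟩
  · obtain ⟨Q, hQ⟩ := exists_isBesselSection p
    rw [← infArr_secInf] at hd ⊢
    -- As `k = 2p ≥ 1`, one has `p < 2p ≤ d`, so the obstructed degree is not met.
    obtain ⟨m, h1, h2⟩ := exists_step_of_bessel hQ hd (Or.inl (by push_cast at hkd; omega))
    exact ⟨infArr m, infArr_mem_rowSupp m, h1, by rwa [map_sub, infArr_nablaInf] at h2⟩
  · obtain ⟨m, h1, h2, h3⟩ := exists_step_of_odd (Or.inr (odd_two_mul_add_one p))
      (secArr_mem_rowSupp ω) hd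
    exact ⟨m, h1, DegLE.mono (by omega) h2, h3⟩

/-- The formal step at infinity becomes algebraic by truncation. Only degrees `d` and `d - 1` of the
correction matter for the degree `d` part of the form, and since `d ≥ k` these involve no negative
power of `z`. -/
theorem exists_mk_eq_degLE (hk : 1 ≤ k) {ω : Sec k} (hω : secArr ω ∈ OrdGE 0) :
    ∃ ω' : Sec k, secArr ω' ∈ OrdGE 0 ∧ secArr ω' ∈ DegLE (k - 1) ∧
      (Submodule.Quotient.mk ω' : H1dR k) = Submodule.Quotient.mk ω := by
  obtain ⟨_, d, -, hd⟩ := exists_secArr_mem ω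
  obtain ⟨N, hN⟩ : ∃ N : ℕ, d ≤ k - 1 + N := ⟨(d - k + 1).toNat, by omega⟩
  replace hd := DegLE.mono hN hd
  clear hN
  induction N generalizing ω with
  | zero => exact ⟨ω, hω, by simpa using hd, rfl⟩
  | succ N ih =>
    obtain ⟨m, h1, h2, h3⟩ := exists_step_of_le hk (by push_cast; omega) hd
    set d : ℤ := k - 1 + (N + 1 : ℕ) with hdef
    have hkd : (k : ℤ) ≤ d := by omega
    -- The discarded part has degree at most `d - 2`, so it changes `∇` only in degree at most `d -
    -- 1`; the kept part has `n ≥ 0`, as `2n + a ≥ k - 1` and `a ≤ k`.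
    set m' : Arr := fun a n => if d - 1 ≤ 2 * n + a then m a n else 0 with hm'
    have hm1 : m' ∈ RowSupp k := fun a n ha => by
      rw [hm']
      simp only
      rw [h1 a n ha, ite_self]
    have hm2 : m' ∈ OrdGE 0 := fun a n hn => by
      by_cases ha : a ≤ k
      · exact if_neg (by omega)
      · exact hm1 a n (by omega)
    have hm3 : m' ∈ DegLE d := fun a n hn => by
      rw [hm']
      simp only
      rw [h2 a n hn, ite_self]
    have hm4 : m - m' ∈ DegLE (d - 2) := fun a n hn => by
      rw [Pi.sub_apply, Pi.sub_apply, hm']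
      simp only
      rw [if_pos (by omega), sub_self]
    obtain ⟨φ, hφ⟩ := exists_secArr_eq hm1 hm2 hm3
    have e : secArr (ω - nabla k φ) = (secArr ω - arrNabla k m) + arrNabla k (m - m') := by
      rw [secArr_sub_nabla, hφ, map_sub]
      abel
    have h4 : secArr (ω - nabla k φ) ∈ DegLE (d - 1) := by
      rw [e]
      exact add_mem h3 (DegLE.mono (by omega) (arrNabla_mem_degLE hm4))
    have h5 : secArr (ω - nabla k φ) ∈ OrdGE 0 := by
      rw [secArr_sub_nabla, hφ]
      exact sub_mem hω (arrNabla_mem_ordGE hm2)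
    obtain ⟨ω', h6, h7, h8⟩ := ih h5 (DegLE.mono (by rw [hdef]; push_cast; omega) h4)
    exact ⟨ω', h6, h7, h8.trans (mk_sub_nabla ω φ)⟩

theorem secArr_single (i a n : ℤ) :
    secArr (Pi.single 0 (T i) : Sec k) a n = if a = 0 ∧ n = i then 1 else 0 := by
  by_cases ha : a < 0 ∨ (k : ℤ) < a
  · rw [secArr_mem_rowSupp _ a n ha, if_neg (by omega)]
  · lift a to ℕ using by omega
    have := secArr_fin (Pi.single 0 (T i) : Sec k) ⟨a, by omega⟩ n
    simp only at this
    rw [this]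
    by_cases h : a = 0
    · subst h
      have : (⟨0, by omega⟩ : Fin (k + 1)) = 0 := rfl
      rw [this, Pi.single_eq_same, T_apply]
      simp [eq_comm]
    · have : (⟨a, by omega⟩ : Fin (k + 1)) ≠ 0 := fun h' => h (congrArg Fin.val h')
      simp [this, h]

/-- Each degree is cleared of everything but `u_0`, leaving a multiple of `z^D u_0` in even degree
`2D` and nothing in odd degree. The bound `d ≤ k` keeps the recursion on rows solvable. -/
theorem mk_mem_span_omega (d : ℕ) (hd : d ≤ k) {ω : Sec k} (hω : secArr ω ∈ OrdGE 0)
    (hωd : secArr ω ∈ DegLE (d - 1)) : (Submodule.Quotient.mk ω : H1dR k) ∈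
      Submodule.span ℂ (omega k '' {i | 2 * i + 1 ≤ d}) := by
  induction d generalizing ω with
  | zero =>
    have : ω = 0 := secArr_injective (by
      ext a n
      rw [map_zero]
      by_cases ha : a < 0
      · exact secArr_mem_rowSupp ω a n (Or.inl ha)
      · by_cases hn : n < 0
        · exact hω a n hn
        · exact hωd a n (by push_cast; omega))
    rw [this]
    exact zero_mem _
  | succ d ih =>
    rw [Nat.cast_succ, add_sub_cancel_right] at hωd
    obtain ⟨m, h1, h2, h3, h4⟩ := exists_homogeneous_down (d := d) (c := secArr ω)
      (show d ≤ k by omega) (fun b n hb hbn => hω b n (by omega))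
    -- The correction lives on `a < d` in degree `d - 1`, so its powers of `z` are non-negative and
    -- it is algebraic.
    have hm : m ∈ OrdGE 0 := fun a n hn => by
      by_contra h
      have := h3 a n h
      omega
    obtain ⟨φ, rfl⟩ := exists_secArr_eq h1 hm h2
    rw [← secArr_sub_nabla] at h4
    set r := ω - nabla k φ with hr
    have hr0 : secArr r ∈ OrdGE 0 := by
      rw [hr, secArr_sub_nabla]
      exact sub_mem hω (arrNabla_mem_ordGE hm)
    have hrd : secArr r ∈ DegLE d := by
      rw [hr, secArr_sub_nabla]
      exact sub_arrNabla_mem_degLE hωd h2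
    rw [← mk_sub_nabla ω φ, ← hr]
    have hsub : Submodule.span ℂ (omega k '' {i | 2 * i + 1 ≤ d}) ≤
        Submodule.span ℂ (omega k '' {i | 2 * i + 1 ≤ d + 1}) :=
      Submodule.span_mono (Set.image_mono fun i hi => Nat.le_succ_of_le hi)
    rcases Nat.even_or_odd' d with ⟨D, hD | hD⟩
    · set x := secArr r 0 D with hx
      set s : Sec k := x • (Pi.single 0 (T D) : Sec k) with hs
      have hsa : ∀ a n, secArr s a n = if a = 0 ∧ n = D then x else 0 := fun a n => by
        rw [hs, map_smul, Pi.smul_apply, Pi.smul_apply, secArr_single]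
        simp
      have e : (Submodule.Quotient.mk r : H1dR k) =
          Submodule.Quotient.mk (r - s) + x • omega k D := by
        rw [omega, ← Submodule.Quotient.mk_smul, ← hs, ← Submodule.Quotient.mk_add, sub_add_cancel]
      rw [e]
      refine add_mem (hsub (ih (by omega) (fun a n hn => ?_) ?_)) (Submodule.smul_mem _ _
        (Submodule.subset_span ⟨D, by simp [hD], rfl⟩))
      · rw [map_sub, Pi.sub_apply, Pi.sub_apply, hr0 a n hn, hsa, if_neg (by omega), sub_zero]
      · refine mem_degLE_pred (secArr_mem_rowSupp _) (fun a n hn => ?_) fun b n hb hb' hbn => ?_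
        · rw [map_sub, Pi.sub_apply, Pi.sub_apply, hrd a n hn, hsa, if_neg (by omega), sub_zero]
        · rw [map_sub, Pi.sub_apply, Pi.sub_apply, hsa]
          by_cases hb0 : b = 0
          · have hnD : n = D := by omega
            subst hb0 hnD
            rw [if_pos ⟨rfl, rfl⟩, hx, sub_self]
          · rw [if_neg (by omega), h4 b n (by omega) hbn, sub_zero]
    · refine hsub (ih (by omega) hr0 (mem_degLE_pred (secArr_mem_rowSupp _) hrd
        fun b n hb hb' hbn => h4 b n ?_ hbn))
      omega

theorem exists_eq_sum_omega (hk : 1 ≤ k) (y : H1dR k) :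
    ∃ x : ℕ → ℂ, y = ∑ i ∈ Finset.range (kHalf k + 1), x i • omega k i := by
  induction y using Submodule.Quotient.induction_on with
  | _ ω =>
  obtain ⟨ω₁, h1, e1⟩ := exists_mk_eq_ordGE_zero ω
  obtain ⟨ω₂, h2, h3, e2⟩ := exists_mk_eq_degLE hk h1
  have h := mk_mem_span_omega k le_rfl h2 h3
  rw [e2, e1] at h
  have hset : {i | 2 * i + 1 ≤ k} = ((Finset.range (kHalf k + 1) : Finset ℕ) : Set ℕ) := by
    ext i
    simp only [Set.mem_ofPred_eq, Finset.coe_range, Set.mem_Iio, kHalf]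
    omega
  rw [hset] at h
  obtain ⟨x, hx⟩ := (Submodule.mem_span_image_finset_iff_exists_fun' ℂ).mp h
  exact ⟨x, hx.symm⟩

end Generators

/-! ### Residues against formal sections -/

section Residues

variable {k : ℕ}

theorem secInf_single (i : ℤ) (a : Fin (k + 1)) :
    secInf k (Pi.single 0 (T i)) a = if a = 0 then HahnSeries.single (-i) 1 else 0 := by
  change expandInf ((Pi.single 0 (T i) : Sec k) a) = _
  split_ifs with h
  · rw [h, Pi.single_eq_same, expandInf_T]
  · rw [Pi.single_eq_of_ne h, map_zero]

theorem secZero_single (i : ℤ) (a : Fin (k + 1)) :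
    secZero k (Pi.single 0 (T i)) a = if a = 0 then HahnSeries.single i 1 else 0 := by
  change expandZero ((Pi.single 0 (T i) : Sec k) a) = _
  split_ifs with h
  · rw [h, Pi.single_eq_same, expandZero_T]
  · rw [Pi.single_eq_of_ne h, map_zero]

theorem pairWeight_zero (k : ℕ) : pairWeight k 0 = 1 := by
  simp [pairWeight, Nat.factorial_ne_zero]

theorem pairWeight_self (k : ℕ) : pairWeight k k = (-1) ^ k := by
  simp [pairWeight, Nat.factorial_ne_zero]

theorem coeff_pairInf_single_left (i t : ℤ) (g : Formal k) :
    (pairInf k (secInf k (Pi.single 0 (T i))) g).coeff t = (g (Fin.last k)).coeff (t + i) := by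
  rw [pairInf_eq, Finset.sum_eq_single 0]
  · rw [secInf_single, if_pos rfl, coeff_C_mul_ls, Fin.val_zero, pairWeight_zero, one_mul,
      HahnSeries.coeff_single_mul, one_mul, sub_neg_eq_add, Fin.rev_zero]
  · intro a _ ha
    rw [secInf_single, if_neg ha, zero_mul, mul_zero]
  · simp

theorem coeff_pairInf_single_right (i t : ℤ) (f : Formal k) :
    (pairInf k f (secInf k (Pi.single 0 (T i)))).coeff t =
      (-1) ^ k * (f (Fin.last k)).coeff (t + i) := by
  rw [pairInf_eq, Finset.sum_eq_single (Fin.last k)]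
  · rw [secInf_single, Fin.rev_last, if_pos rfl, coeff_C_mul_ls, Fin.val_last, pairWeight_self,
      mul_comm (f _), HahnSeries.coeff_single_mul, one_mul, sub_neg_eq_add]
  · intro a _ ha
    rw [secInf_single, if_neg, mul_zero, mul_zero]
    rwa [Fin.rev_eq_iff, Fin.rev_zero]
  · simp

theorem coeff_pairZero_single_right (i t : ℤ) (f : Formal k) :
    (pairZero k f (secZero k (Pi.single 0 (T i)))).coeff t =
      (-1) ^ k * (f (Fin.last k)).coeff (t - i) := by
  rw [pairZero_eq, Finset.sum_eq_single (Fin.last k)]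
  · rw [secZero_single, Fin.rev_last, if_pos rfl, coeff_C_mul_ls, Fin.val_last, pairWeight_self,
      mul_comm (f _), HahnSeries.coeff_single_mul, one_mul]
  · intro a _ ha
    rw [secZero_single, if_neg, mul_zero, mul_zero]
    rwa [Fin.rev_eq_iff, Fin.rev_zero]
  · simp

theorem pairAux_single (m : Cocycle k) (j : ℤ) : pairAux k m (Pi.single 0 (T j)) =
    (-1) ^ k * (zeroArr m.1.1 k (-j) - infArr m.1.2.1 k (-j)) := by
  have e1 := zeroArr_fin m.1.1 (Fin.last k) (-j)
  have e2 := infArr_fin m.1.2.1 (Fin.last k) (-j)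
  rw [Fin.val_last] at e1 e2
  rw [pairAux_apply, coeff_pairZero_single_right, coeff_pairInf_single_right, e1, e2, zero_sub,
    zero_add, neg_neg]
  ring

/-- The residue at `0` of the pairing of a formal section with an algebraic one-form. -/
def resZero (h : Formal k) : Sec k →ₗ[ℂ] ℂ where
  toFun ω := (pairZero k h (secZero k ω)).coeff 0
  map_add' ω ω' := by
    simp only [pairZero, map_add, gramPair_add_right, HahnSeries.coeff_add]
  map_smul' c ω := by
    simp only [pairZero, map_smul, gramPair_smul_right, HahnSeries.coeff_smul, RingHom.id_apply]

/-- A coefficient at `∞` of the pairing of an algebraic section with a formal one. -/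
def resInf (g : Formal k) (t : ℤ) : Sec k →ₗ[ℂ] ℂ where
  toFun ω := (pairInf k (secInf k ω) g).coeff t
  map_add' ω ω' := by
    simp only [pairInf, map_add, gramPair_add_left, HahnSeries.coeff_add]
  map_smul' c ω := by
    simp only [pairInf, map_smul, gramPair_smul_left, HahnSeries.coeff_smul, RingHom.id_apply]

/-- For horizontal `h`, the function `⟨h, ∇ g⟩` is the Euler derivative of `⟨h, g⟩` and has no
constant term. -/
theorem resZero_eq_zero {h : Formal k} (hh : nablaZero k h = 0) {ω : Sec k} {g : Formal k}
    (hg : secZero k ω = nablaZero k g) : resZero h ω = 0 := by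
  have e := congrArg (fun f => HahnSeries.coeff f 0) (pairZero_nabla k h g)
  have z0 : pairZero k 0 g = 0 := by simp [pairZero, gramPair, dotProduct]
  simp only [hh, z0, zero_add, const_euler] at e
  change (pairZero k h (secZero k ω)).coeff 0 = 0
  rw [hg, e]

/-- A class in the middle cohomology has formal primitives at `0` and at `∞`, for each
representative. -/
theorem exists_primitives_of_mem_H1mid {ω : Sec k}
    (h : (Submodule.Quotient.mk ω : H1dR k) ∈ H1mid k) :
    ∃ g g' : Formal k, secZero k ω = nablaZero k g ∧ secInf k ω = nablaInf k g' := by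
  obtain ⟨x, hx⟩ := h
  induction x using Submodule.Quotient.induction_on with
  | _ m =>
  obtain ⟨φ, hφ⟩ := (Submodule.Quotient.eq _).mp
    (hx : (Submodule.Quotient.mk m.1.2.2 : H1dR k) = Submodule.Quotient.mk ω)
  replace hφ : nabla k φ = m.1.2.2 - ω := hφ
  refine ⟨m.1.1 - secZero k φ, m.1.2.1 - secInf k φ, ?_, ?_⟩
  · rw [map_sub, nablaZero_secZero, m.2.1, hφ, map_sub, sub_sub_cancel]
  · rw [map_sub, nablaInf_secInf, m.2.2, hφ, map_sub, sub_sub_cancel]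

end Residues

/-! ### The classes `ω'_i` and their formal primitives -/

section Classes

variable {k : ℕ}

theorem gammaConst_two_mul {p : ℕ} {D : ℤ} (hD : 2 * D = p) (i : ℕ) :
    gammaConst (2 * p) i =
      (HahnSeries.ofPowerSeries ℤ ℂ (besselSeries ^ p)).coeff (-D + i) := by
  have h4 : 4 ∣ 2 * p := by omega
  rw [gammaConst, Nat.mul_div_cancel_left _ two_pos]
  split_ifs with h
  · rw [show -D + (i : ℤ) = (i - 2 * p / 4 : ℕ) by omega, coeff_ofPowerSeries]
  · rw [coeff_ofPowerSeries_of_neg]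
    omega

theorem gammaConst_quarter (h4 : 4 ∣ k) : gammaConst k (k / 4) = 1 := by
  rw [gammaConst, if_pos ⟨h4, le_rfl⟩, Nat.sub_self, constantCoeff_besselSeries_pow]

/-- The representative of `omegaMid k i`. -/
def omegaForm (k i : ℕ) : Sec k :=
  (Pi.single 0 (T (i : ℤ)) : Sec k) - gammaConst k i • (Pi.single 0 (T ((k / 4 : ℕ) : ℤ)) : Sec k)

theorem mk_omegaForm (k i : ℕ) :
    (Submodule.Quotient.mk (omegaForm k i) : H1dR k) = omegaMid k i := rfl

theorem secArr_omegaForm (i : ℕ) (a n : ℤ) : secArr (omegaForm k i) a n =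
    (if a = 0 ∧ n = i then 1 else 0)
      - gammaConst k i * (if a = 0 ∧ n = (k / 4 : ℕ) then 1 else 0) := by
  rw [omegaForm, map_sub, map_smul, Pi.sub_apply, Pi.sub_apply, Pi.smul_apply, Pi.smul_apply,
    secArr_single, secArr_single, smul_eq_mul]

theorem gammaConst_eq_zero {i : ℕ} (h : ¬ (4 ∣ k ∧ k / 4 ≤ i)) : gammaConst k i = 0 := if_neg h

theorem omegaForm_mem_ordGE (hk : 1 ≤ k) {i : ℕ} (hi : 1 ≤ i) :
    secArr (omegaForm k i) ∈ OrdGE 1 := fun a n hn => by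
  rw [secArr_omegaForm, if_neg (by omega)]
  by_cases h : 4 ∣ k ∧ k / 4 ≤ i
  · rw [if_neg (by omega)]
    simp
  · rw [gammaConst_eq_zero h]
    simp

theorem omegaForm_mem_degLE (i : ℕ) : secArr (omegaForm k i) ∈ DegLE (2 * i) := fun a n hn => by
  rw [secArr_omegaForm, if_neg (by omega)]
  by_cases h : 4 ∣ k ∧ k / 4 ≤ i
  · rw [if_neg (by omega)]
    simp
  · rw [gammaConst_eq_zero h]
    simp

theorem coeff_pairInf_omegaForm {p : ℕ} {Q : Formal (2 * p)} (hQ : IsBesselSection p Q) (i : ℕ)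
    (t : ℤ) : (pairInf (2 * p) (secInf (2 * p) (omegaForm (2 * p) i)) Q).coeff t =
      (HahnSeries.ofPowerSeries ℤ ℂ (besselSeries ^ p)).coeff (t + i)
        - gammaConst (2 * p) i
          * (HahnSeries.ofPowerSeries ℤ ℂ (besselSeries ^ p)).coeff (t + (2 * p / 4 : ℕ)) := by
  change resInf Q t (omegaForm (2 * p) i) = _
  rw [omegaForm, map_sub, map_smul, smul_eq_mul, ← hQ.2]
  congr 1
  · exact coeff_pairInf_single_left _ _ _
  · congr 1
    exact coeff_pairInf_single_left _ _ _

/-- The constants `γ` are made for this: the obstruction of `ω_i` is `γ_{k,i}` and that of `ω_{k/4}`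
is 1, so they cancel in `ω'_i`. -/
theorem exists_nablaInf_eq_omegaForm (i : ℕ) :
    ∃ m : Formal k, infArr m ∈ DegLE (2 * i) ∧ nablaInf k m = secInf k (omegaForm k i) := by
  have hd : infArr (secInf k (omegaForm k i)) ∈ DegLE (2 * i) := by
    rw [infArr_secInf]
    exact omegaForm_mem_degLE i
  rcases Nat.even_or_odd' k with ⟨p, rfl | rfl⟩
  · obtain ⟨Q, hQ⟩ := exists_isBesselSection p
    refine exists_nablaInf_eq_of_bessel hQ hd fun D hD => ?_
    have h4 : 4 ∣ 2 * p := by omega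
    rw [coeff_pairInf_omegaForm hQ, ← gammaConst_two_mul hD, ← gammaConst_two_mul hD,
      gammaConst_quarter h4, mul_one, sub_self]
  · exact exists_nablaInf_eq_of_odd (odd_two_mul_add_one p) hd

theorem exists_cocycle (hk : 1 ≤ k) {i : ℕ} (hi : 1 ≤ i) : ∃ m : Cocycle k,
    m.1.2.2 = omegaForm k i ∧ zeroArr m.1.1 ∈ OrdGE 1 ∧ infArr m.1.2.1 ∈ DegLE (2 * i) := by
  have h0 : zeroArr (secZero k (omegaForm k i)) ∈ OrdGE 1 := by
    rw [zeroArr_secZero]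
    exact omegaForm_mem_ordGE hk hi
  obtain ⟨m₀, h1, h2⟩ := exists_nablaZero_eq le_rfl h0
  obtain ⟨m, h3, h4⟩ := exists_nablaInf_eq_omegaForm (k := k) i
  exact ⟨⟨(m₀, m, omegaForm k i), h2, h4⟩, rfl, h1, h3⟩

/-- The primitive at 0 has positive order and meets only non-negative powers of `z`, so the residue
there is zero; at infinity the correction by `ω_{k/4}` does not contribute either. -/
theorem pairAux_omegaForm (hk : 1 ≤ k) {i j : ℕ} (hj : 1 ≤ j) (hj4 : 4 * j ≠ k)
    (hij : i + j ≤ kHalf k + 1) {m : Cocycle k} (h0 : zeroArr m.1.1 ∈ OrdGE 1)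
    (hd : infArr m.1.2.1 ∈ DegLE (2 * i)) :
    pairAux k m (omegaForm k j) = -(-1) ^ k * infArr m.1.2.1 k (-j) := by
  rw [omegaForm, map_sub, map_smul, pairAux_single, pairAux_single, h0 _ _ (by omega),
    h0 _ _ (by omega)]
  by_cases h : 4 ∣ k ∧ k / 4 ≤ j
  · rw [hd k (-((k / 4 : ℕ) : ℤ)) (by simp only [kHalf] at hij; omega)]
    simp
  · rw [gammaConst_eq_zero h]
    simp

end Classes

/-! ### Leading coefficients of the primitives at infinity -/

section Values

/-- The leading coefficient of the primitive of `ω_i` at `∞` for odd symmetric powers. -/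
theorem leadingCoeff_odd {q i : ℕ} {m : Formal (2 * q + 1)} (hd : infArr m ∈ DegLE (2 * i))
    (hm : nablaInf (2 * q + 1) m = secInf (2 * q + 1) (omegaForm (2 * q + 1) i)) :
    infArr m (2 * q + 1 : ℕ) (i - 1 - q) =
      (-2) ^ q * (q.factorial / (2 * q + 1).doubleFactorial : ℂ) := by
  have hn : arrNabla (2 * q + 1) (infArr m) = secArr (omegaForm (2 * q + 1) i) := by
    rw [← infArr_nablaInf, hm, infArr_secInf]
  -- For odd `k` no monomial `z^n u_k` has the even degree `2i`, so the degree `2i` part of `m`,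
  -- which lies in the kernel of the symbol, vanishes.
  have hd' : infArr m ∈ DegLE (2 * i - 1) := mem_degLE_pred_of_arrNabla (infArr_mem_rowSupp m) hd
    (by rw [hn]; exact omegaForm_mem_degLE i) (fun n h => by push_cast at h; omega)
  -- The degree `2i` part of `∇ m = ω_i`: the symbol alone, applied to the degree `2i - 1` part of
  -- `m`.
  have hrec : ∀ s : ℕ, (2 * q + 1 - 2 * s + 1) * infArr m (2 * s - 1) (i - s)
      + (2 * s + 1) * infArr m (2 * s + 1) (i - s - 1) = if s = 0 then 1 else 0 := fun s => by
    have e := congrFun (congrFun hn (2 * s)) (i - s)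
    rw [arrNabla_apply, hd' _ _ (by omega), secArr_omegaForm, gammaConst_eq_zero (by omega)] at e
    push_cast at e
    rw [zero_mul, sub_zero, mul_zero, zero_add] at e
    rw [e]
    refine if_congr ?_ rfl rfl
    omega
  -- The recursion starts at `a = 1` with value 1 and reaches `a = k` at `s = q`, where the falling
  -- factorial becomes `q!`.
  have key : ∀ s : ℕ, s ≤ q → infArr m (2 * s + 1) (i - s - 1) * (2 * s + 1).doubleFactorial =
      (-2) ^ s * q.descFactorial s := by
    intro s
    induction s with
    | zero =>
      intro _
      have e := hrec 0
      rw [infArr_mem_rowSupp m _ _ (Or.inl (by simp)), if_pos rfl] at e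
      simpa using e
    | succ s ih =>
      intro hs
      have e := hrec (s + 1)
      have ih := ih (by omega)
      rw [if_neg (by omega), show (2 : ℤ) * (s + 1 : ℕ) - 1 = 2 * s + 1 by push_cast; ring,
        show (i : ℤ) - (s + 1 : ℕ) = i - s - 1 by push_cast; ring] at e
      rw [show (i : ℤ) - (s + 1 : ℕ) - 1 = i - s - 1 - 1 by push_cast; ring,
        show 2 * (s + 1) + 1 = (2 * s + 1) + 2 by ring, Nat.doubleFactorial_add_two,
        Nat.descFactorial_succ]
      push_cast [Nat.cast_sub (show s ≤ q by omega)] at e ⊢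
      linear_combination ((2 * s + 1).doubleFactorial : ℂ) * e - 2 * (q - s) * ih
  have h := key q le_rfl
  rw [Nat.descFactorial_self] at h
  have h0 : ((2 * q + 1).doubleFactorial : ℂ) ≠ 0 :=
    Nat.cast_ne_zero.mpr (Nat.doubleFactorial_pos _).ne'
  rw [← mul_div_assoc, eq_div_iff h0, ← h]
  push_cast
  rw [show (i : ℤ) - 1 - q = i - q - 1 by ring]

theorem centralBinom_mul_factorial (p : ℕ) : ((p + 1).centralBinom : ℂ) * (p + 1).factorial =
    2 ^ (p + 1) * (2 * p + 1).doubleFactorial := by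
  have h1 := Nat.choose_mul_factorial_mul_factorial (show p + 1 ≤ 2 * (p + 1) by omega)
  rw [show 2 * (p + 1) - (p + 1) = p + 1 by omega, ← Nat.centralBinom_eq_two_mul_choose] at h1
  have h2 := Nat.factorial_eq_mul_doubleFactorial (2 * p + 1)
  rw [show 2 * p + 1 + 1 = 2 * (p + 1) by ring, Nat.doubleFactorial_two_mul] at h2
  rw [h2] at h1
  have h0 : ((p + 1).factorial : ℂ) ≠ 0 := Nat.cast_ne_zero.mpr (Nat.factorial_ne_zero _)
  apply mul_right_cancel₀ h0
  have h3 := congrArg (Nat.cast (R := ℂ)) h1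
  push_cast at h3 ⊢
  linear_combination h3

/-- The leading coefficient of the primitive of `ω_i` at `∞` for even symmetric powers. -/
theorem leadingCoeff_even {p i : ℕ} (hi : 2 * i ≠ p) {m : Formal (2 * p)}
    (hd : infArr m ∈ DegLE (2 * i))
    (hm : nablaInf (2 * p) m = secInf (2 * p) (omegaForm (2 * p) i)) :
    (i - p / 2) * infArr m (2 * p : ℕ) (i - p) * ((-1) ^ p * 4 ^ p) = p.centralBinom := by
  obtain ⟨Q, hQ⟩ := exists_isBesselSection p
  have hn : arrNabla (2 * p) (infArr m) = secArr (omegaForm (2 * p) i) := by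
    rw [← infArr_nablaInf, hm, infArr_secInf]
  set μ := infArr m (2 * p : ℕ) (i - p) with hμ
  -- `μ • Z` should be the leading term of `m`, since `Z` spans the kernel of the symbol in degree
  -- `2i` and its `u_k`-coefficient there is 1.
  set Z := zShift (i - p : ℤ) Q with hZ
  have hZd : infArr Z ∈ DegLE (2 * i) := by
    have := zShift_mem_degLE (n := (i : ℤ) - p) hQ.mem_degLE
    rwa [show (2 * p : ℤ) + 2 * (i - p) = 2 * i by ring] at this
  set g := m - μ • Z with hg
  -- `Z` is an eigensection, so `∇ g` still has degree at most `2i`; the `u_k`-coefficient of `g` in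
  -- that degree is zero by the choice of `μ`.
  have hgd : infArr g ∈ DegLE (2 * i - 1) := by
    refine mem_degLE_pred_of_arrNabla (infArr_mem_rowSupp g) ?_ ?_ fun n h => ?_
    · rw [hg, map_sub, map_smul]
      exact sub_mem hd (Submodule.smul_mem _ _ hZd)
    · rw [hg, map_sub, map_smul, map_sub, map_smul, hn, ← infArr_nablaInf Z, hZ,
        nablaInf_zShift hQ.1, map_smul, ← hZ]
      exact sub_mem (omegaForm_mem_degLE i)
        (Submodule.smul_mem _ _ (Submodule.smul_mem _ _ hZd))
    · have hni : n = i - p := by push_cast at h; omega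
      have e := hQ.arr_last_zero
      rw [hg, map_sub, map_smul, Pi.sub_apply, Pi.sub_apply, Pi.smul_apply, Pi.smul_apply, hZ,
        infArr_zShift, hni, sub_self, ← hμ]
      push_cast
      rw [e, smul_eq_mul, mul_one, sub_self]
  have e1 : (pairInf (2 * p) m Q).coeff (-i) =
      μ * ((-1) ^ p * 4 ^ p / (p.centralBinom : ℂ)) := by
    have e := hQ.coeff_pairInf_zShift ((i : ℤ) - p)
    rw [sub_add_cancel, ← hZ] at e
    have : pairInf (2 * p) m Q = pairInf (2 * p) g Q + μ • pairInf (2 * p) Z Q := by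
      simp only [pairInf]
      rw [← gramPair_smul_left, ← gramPair_add_left, hg, sub_add_cancel]
    rw [this, HahnSeries.coeff_add, HahnSeries.coeff_smul, e, smul_eq_mul,
      coeff_pairInf_of_lt hgd hQ.mem_degLE (by push_cast; omega), zero_add]
  -- Pairing `∇ m = ω'_i` with `Q` at `w^(-i)` determines `μ`: one side is the constant term 1 of
  -- the Bessel power, the other is `(i - p/2) μ` times the normalization of `Q`.
  have e2 := hQ.coeff_pairInf_nablaInf m (-i)
  rw [hm, e1, coeff_pairInf_omegaForm hQ, neg_add_cancel] at e2
  have e3 : (HahnSeries.ofPowerSeries ℤ ℂ (besselSeries ^ p)).coeff 0 = 1 :=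
    (coeff_ofPowerSeries _ 0).trans (constantCoeff_besselSeries_pow p)
  -- Either `γ` vanishes, or `k/4 < i` because `2i ≠ p`, and the coefficient has negative index.
  have e4 : gammaConst (2 * p) i * (HahnSeries.ofPowerSeries ℤ ℂ (besselSeries ^ p)).coeff
      (-(i : ℤ) + (2 * p / 4 : ℕ)) = 0 := by
    by_cases h : 4 ∣ 2 * p ∧ 2 * p / 4 ≤ i
    · rw [coeff_ofPowerSeries_of_neg _ (by omega), mul_zero]
    · rw [gammaConst_eq_zero h, zero_mul]
  rw [e3, e4, sub_zero] at e2
  have h0 : (p.centralBinom : ℂ) ≠ 0 := Nat.cast_ne_zero.mpr p.centralBinom_ne_zero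
  field_simp at e2
  push_cast at e2
  linear_combination -e2 / 2

end Values

/-! ### Basis and matrix of the intersection pairing -/

section Main

variable {k : ℕ}

/-- The asserted value of the pairing on the antidiagonal `i + j = k' + 1`. -/
def antidiagValue (k i : ℕ) : ℂ :=
  if Odd k then (-2) ^ kHalf k * ((kHalf k).factorial / k.doubleFactorial : ℂ)
  else (-1) ^ (kHalf k + 1) / (2 ^ kHalf k * ((kHalf k : ℂ) + 1 - 2 * i))
    * ((k - 1).doubleFactorial / (kHalf k + 1).factorial : ℂ)

theorem kHalf_sub_ne_zero (hk : 1 ≤ k) (hodd : ¬ Odd k) {i : ℕ} (hi : 4 * i ≠ k) :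
    (kHalf k : ℂ) + 1 - 2 * i ≠ 0 := by
  rw [Nat.not_odd_iff_even] at hodd
  obtain ⟨p, rfl⟩ := hodd
  rw [sub_ne_zero]
  exact_mod_cast (by simp only [kHalf]; omega : kHalf (p + p) + 1 ≠ 2 * i)

theorem antidiagValue_ne_zero (hk : 1 ≤ k) {i : ℕ} (hi : 4 * i ≠ k) : antidiagValue k i ≠ 0 := by
  have hf : ∀ n : ℕ, (n.factorial : ℂ) ≠ 0 := fun n => Nat.cast_ne_zero.mpr n.factorial_ne_zero
  have hd : ∀ n : ℕ, (n.doubleFactorial : ℂ) ≠ 0 := fun n =>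
    Nat.cast_ne_zero.mpr (Nat.doubleFactorial_pos n).ne'
  rw [antidiagValue]
  split_ifs with h
  · exact mul_ne_zero (pow_ne_zero _ (by norm_num)) (div_ne_zero (hf _) (hd _))
  · exact mul_ne_zero (div_ne_zero (pow_ne_zero _ (by norm_num)) (mul_ne_zero
      (pow_ne_zero _ two_ne_zero) (kHalf_sub_ne_zero hk h hi))) (div_ne_zero (hd _) (hf _))

theorem pairAux_antidiag (hk : 1 ≤ k) {i j : ℕ} (hi4 : 4 * i ≠ k) (hj : 1 ≤ j) (hj4 : 4 * j ≠ k)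
    (hij : i + j = kHalf k + 1) {m : Cocycle k} (hm : m.1.2.2 = omegaForm k i)
    (h0 : zeroArr m.1.1 ∈ OrdGE 1) (hd : infArr m.1.2.1 ∈ DegLE (2 * i)) :
    pairAux k m (omegaForm k j) = antidiagValue k i := by
  rw [pairAux_omegaForm hk hj hj4 hij.le h0 hd, antidiagValue]
  have hn : nablaInf k m.1.2.1 = secInf k (omegaForm k i) := by rw [m.2.2, hm]
  split_ifs with hodd
  · obtain ⟨q, rfl⟩ := hodd
    have hq : kHalf (2 * q + 1) = q := by simp only [kHalf]; omega
    have e := leadingCoeff_odd hd hn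
    rw [hq] at hij ⊢
    rw [show (i : ℤ) - 1 - q = -j by omega] at e
    rw [e, Odd.neg_one_pow (odd_two_mul_add_one q)]
    ring
  · have hne := kHalf_sub_ne_zero hk hodd hi4
    rw [Nat.not_odd_iff_even] at hodd
    obtain ⟨p, rfl⟩ := even_iff_exists_two_mul.mp hodd
    obtain ⟨s, rfl⟩ : ∃ s, p = s + 1 := ⟨p - 1, by omega⟩
    have hs : kHalf (2 * (s + 1)) = s := by simp only [kHalf]; omega
    have e := leadingCoeff_even (by omega) hd hn
    rw [hs] at hij hne ⊢
    -- On the antidiagonal `i + j = s + 1`, the coefficient in the residue is exactly the leading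
    -- one of `leadingCoeff_even`.
    rw [show (i : ℤ) - (s + 1 : ℕ) = -j by push_cast; omega] at e
    rw [Even.neg_one_pow (even_two_mul _), show 2 * (s + 1) - 1 = 2 * s + 1 by omega]
    have hc := centralBinom_mul_factorial s
    have hf : ((s + 1).factorial : ℂ) ≠ 0 := Nat.cast_ne_zero.mpr (Nat.factorial_ne_zero _)
    have h1 : (-1 : ℂ) ^ (s + 1) * (-1) ^ (s + 1) = 1 := by
      rw [← mul_pow]
      norm_num
    have h4 : (4 : ℂ) ^ (s + 1) = 2 ^ (s + 1) * 2 ^ (s + 1) := by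
      rw [← mul_pow]
      norm_num
    rw [h4] at e
    rw [div_mul_div_comm, eq_div_iff (mul_ne_zero (mul_ne_zero (pow_ne_zero _ two_ne_zero) hne) hf)]
    have h2 : (2 : ℂ) ^ (s + 1) ≠ 0 := pow_ne_zero _ two_ne_zero
    apply mul_left_cancel₀ h2
    generalize infArr m.1.2.1 ((2 * (s + 1) : ℕ) : ℤ) (-j) = μ at e ⊢
    push_cast at e
    have h2s : (2 : ℂ) ^ (s + 1) = 2 ^ s * 2 := pow_succ _ _
    rw [h2s] at e hc ⊢
    linear_combination (-1) ^ (s + 1) * ((s + 1).factorial : ℂ) * e + (-1) ^ (s + 1) * hc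
      - (s + 1).factorial * (i - (s + 1) / 2) * μ * (2 ^ s * 2) * (2 ^ s * 2) * h1

/-- The family of classes `omegaMid` in middle cohomology and its pairings. -/
theorem exists_midFamily (hk : 1 ≤ k) : ∃ v : MidIndex k → H1mid k,
    (∀ i, (v i : H1dR k) = omegaMid k i) ∧
    (∀ i j : MidIndex k, (i : ℕ) + j ≤ kHalf k → midPair k (v i) (v j) = 0) ∧
    (∀ i j : MidIndex k, (i : ℕ) + j = kHalf k + 1 → midPair k (v i) (v j) = antidiagValue k i) := by
  choose m hm h0 hd using fun i : MidIndex k => exists_cocycle hk i.2.1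
  have hv : ∀ i j, midPair k ⟨forget k (Submodule.Quotient.mk (m i)), _, rfl⟩
      ⟨forget k (Submodule.Quotient.mk (m j)), _, rfl⟩ = pairAux k (m i) (omegaForm k j) :=
    fun i j => by
      rw [midPair_apply, ← hm j]
      exact deRhamPair_mk k (m i) _
  refine ⟨fun i => ⟨forget k (Submodule.Quotient.mk (m i)), _, rfl⟩, fun i => ?_, fun i j hij => ?_,
    fun i j hij => ?_⟩
  · rw [← mk_omegaForm, ← hm i]
    rfl
  · rw [hv, pairAux_omegaForm hk j.2.1 j.2.2.2 (by omega) (h0 i) (hd i), hd i _ _ (by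
      simp only [kHalf] at hij; omega), mul_zero]
  · rw [hv, pairAux_antidiag hk i.2.2.2 j.2.1 j.2.2.2 hij (hm i) (h0 i) (hd i)]

/-- Pair a relation with the partner `k' + 1 - i` of its largest index `i`: smaller indices pair to
zero by triangularity, and the antidiagonal value is non-zero. -/
theorem linearIndependent_of_antidiag (hk : 1 ≤ k) {v : MidIndex k → H1mid k}
    (h0 : ∀ i j : MidIndex k, (i : ℕ) + j ≤ kHalf k → midPair k (v i) (v j) = 0)
    (h1 : ∀ i j : MidIndex k, (i : ℕ) + j = kHalf k + 1 → midPair k (v i) (v j) = antidiagValue k i) :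
    LinearIndependent ℂ v := by
  rw [linearIndependent_iff']
  intro s c hs
  by_contra! hc
  obtain ⟨i₁, hi₁, hci₁⟩ := hc
  obtain ⟨i, hi, hmax⟩ := (s.filter fun i => c i ≠ 0).exists_max_image (fun i => (i : ℕ))
    ⟨i₁, Finset.mem_filter.mpr ⟨hi₁, hci₁⟩⟩
  rw [Finset.mem_filter] at hi
  -- The reflection `i ↦ k' + 1 - i` preserves the index set: if `4 ∣ k`, then `k' + 1 = k/2` and
  -- the omitted `k/4` is fixed.
  have hj : 1 ≤ kHalf k + 1 - i ∧ kHalf k + 1 - i ≤ kHalf k ∧ 4 * (kHalf k + 1 - i) ≠ k := by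
    have := i.2
    simp only [kHalf] at this ⊢
    omega
  have e := congrArg (fun y => midPair k y (v ⟨_, hj⟩)) hs
  simp only [map_sum, map_smul, LinearMap.sum_apply, LinearMap.smul_apply, map_zero,
    LinearMap.zero_apply] at e
  rw [Finset.sum_eq_single i] at e
  · rw [h1 i ⟨_, hj⟩ (by have := i.2.2.1; simp only; omega), smul_eq_mul] at e
    exact (mul_ne_zero hi.2 (antidiagValue_ne_zero hk i.2.2.2)) e
  · intro l hl hli
    by_cases hcl : c l = 0
    · rw [hcl, zero_smul]
    · have h2 := hmax l (Finset.mem_filter.mpr ⟨hl, hcl⟩)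
      have h3 : (l : ℕ) ≠ i := fun h => hli (Subtype.ext h)
      rw [h0 l ⟨_, hj⟩ (by simp only; omega), smul_zero]
  · exact fun h => absurd hi.1 h

/-- The residue at 0 against the horizontal section with leading term `u_k` kills forms with a
primitive at 0. It is `±1` on `ω_0` and vanishes on `ω_i` for `i ≥ 1`, by order in `z`. -/
theorem coeff_zero_of_mem_H1mid {x : ℕ → ℂ}
    (h : ∑ i ∈ Finset.range (kHalf k + 1), x i • omega k i ∈ H1mid k) : x 0 = 0 := by
  have e : ∑ i ∈ Finset.range (kHalf k + 1), x i • omega k i = Submodule.Quotient.mk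
      (∑ i ∈ Finset.range (kHalf k + 1), x i • (Pi.single 0 (T (i : ℤ)) : Sec k)) := by
    simp only [omega, ← Submodule.mkQ_apply, map_sum, map_smul]
  rw [e] at h
  obtain ⟨g, -, hg, -⟩ := exists_primitives_of_mem_H1mid h
  obtain ⟨u, hu, hu0, hu1⟩ := exists_horizontal_zero k
  have hr := resZero_eq_zero hu hg
  have hval : ∀ i : ℕ, resZero u (Pi.single 0 (T (i : ℤ))) = if i = 0 then (-1) ^ k else 0 := by
    intro i
    have e1 := zeroArr_fin u (Fin.last k) (0 - i)
    rw [Fin.val_last] at e1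
    refine (coeff_pairZero_single_right _ _ _).trans ?_
    rw [← e1]
    split_ifs with hi
    · rw [hi, Nat.cast_zero, sub_zero, hu1, mul_one]
    · rw [hu0 _ _ (by omega), mul_zero]
  simp only [map_sum, map_smul, hval, smul_eq_mul, mul_ite, mul_zero] at hr
  rw [Finset.sum_ite_eq' _ 0, if_pos (by simp)] at hr
  exact (mul_eq_zero.mp hr).resolve_right (pow_ne_zero _ (by norm_num))

/-- The same at infinity for `4 ∣ k`: the coefficient of `w^(-k/4)` in the pairing with `Q` vanishes
on images of the connection, and its value on `ω_i` is `γ_{k,i}`. -/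
theorem sum_gammaConst_of_mem_H1mid {x : ℕ → ℂ}
    (h : ∑ i ∈ Finset.range (kHalf k + 1), x i • omega k i ∈ H1mid k) :
    ∑ i ∈ Finset.range (kHalf k + 1), x i * gammaConst k i = 0 := by
  by_cases h4 : 4 ∣ k
  · obtain ⟨e, rfl⟩ := h4
    obtain ⟨p, D, hp, hD⟩ : ∃ (p : ℕ) (D : ℤ), 4 * e = 2 * p ∧ 2 * D = p :=
      ⟨2 * e, e, by ring, by push_cast; rfl⟩
    rw [hp] at h ⊢
    have e' : ∑ i ∈ Finset.range (kHalf (2 * p) + 1), x i • omega (2 * p) i = Submodule.Quotient.mk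
        (∑ i ∈ Finset.range (kHalf (2 * p) + 1), x i • (Pi.single 0 (T (i : ℤ)) : Sec (2 * p))) := by
      simp only [omega, ← Submodule.mkQ_apply, map_sum, map_smul]
    rw [e'] at h
    obtain ⟨-, g, -, hg⟩ := exists_primitives_of_mem_H1mid h
    obtain ⟨Q, hQ⟩ := exists_isBesselSection p
    have hr : resInf Q (-D) (∑ i ∈ Finset.range (kHalf (2 * p) + 1),
        x i • (Pi.single 0 (T (i : ℤ)) : Sec (2 * p))) = 0 := by
      change (pairInf _ _ Q).coeff (-D) = 0
      have hpD : (p : ℂ) = 2 * D := by exact_mod_cast hD.symm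
      rw [hg, hQ.coeff_pairInf_nablaInf, hpD]
      push_cast
      rw [mul_div_cancel_left₀ _ two_ne_zero]
      simp
    have hval : ∀ i : ℕ, resInf Q (-D) (Pi.single 0 (T (i : ℤ))) = gammaConst (2 * p) i := by
      intro i
      refine (coeff_pairInf_single_left _ _ _).trans ?_
      rw [hQ.2, gammaConst_two_mul hD]
    simpa only [map_sum, map_smul, hval, smul_eq_mul] using hr
  · exact Finset.sum_eq_zero fun i _ => by rw [gammaConst_eq_zero (by tauto), mul_zero]

/-- The two obstruction equations suffice: `x 0 = 0`, and `∑ x_i γ_{k,i} = 0` allows each `ω_i` to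
be replaced by `ω'_i` at no cost. -/
theorem span_midFamily (hk : 1 ≤ k) {v : MidIndex k → H1mid k}
    (hv : ∀ i, (v i : H1dR k) = omegaMid k i) : ⊤ ≤ Submodule.span ℂ (Set.range v) := by
  rintro ⟨y, hy⟩ -
  obtain ⟨x, rfl⟩ := exists_eq_sum_omega hk y
  have hx0 := coeff_zero_of_mem_H1mid hy
  have hxγ := sum_gammaConst_of_mem_H1mid hy
  classical
  let u : ℕ → H1mid k := fun i =>
    if h : 1 ≤ i ∧ i ≤ kHalf k ∧ 4 * i ≠ k then x i • v ⟨i, h⟩ else 0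
  have hu : (⟨_, hy⟩ : H1mid k) = ∑ i ∈ Finset.range (kHalf k + 1), u i := by
    apply Subtype.ext
    rw [Submodule.coe_sum]
    have e : ∀ i ∈ Finset.range (kHalf k + 1), ((u i : H1mid k) : H1dR k) =
        x i • omega k i - (x i * gammaConst k i) • omega k (k / 4) := by
      intro i hi
      rw [Finset.mem_range] at hi
      by_cases h : 1 ≤ i ∧ i ≤ kHalf k ∧ 4 * i ≠ k
      · simp only [u]
        rw [dif_pos h, Submodule.coe_smul, hv, omegaMid, smul_sub, smul_smul]
      · simp only [u]
        rw [dif_neg h, Submodule.coe_zero]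
        by_cases hi0 : i = 0
        · rw [hi0, hx0]
          simp
        -- The omitted index costs nothing: `ω'_{k/4} = 0` because `γ_{k,k/4} = 1`.
        · have h4 : i = k / 4 := by omega
          rw [h4, gammaConst_quarter (by omega), mul_one, sub_self]
    rw [Finset.sum_congr rfl e, Finset.sum_sub_distrib, ← Finset.sum_smul, hxγ, zero_smul, sub_zero]
  rw [hu]
  refine sum_mem fun i _ => ?_
  simp only [u]
  split_ifs with h
  · exact Submodule.smul_mem _ _ (Submodule.subset_span ⟨_, rfl⟩)
  · exact zero_mem _

end Main

end SymKl

end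

theorem mainTheorem2 (k : ℕ) (hk : 1 ≤ k) :
    ∃ b : Module.Basis (SymKl.MidIndex k) ℂ (SymKl.H1mid k),
      (∀ i, (b i : SymKl.H1dR k) = SymKl.omegaMid k i) ∧
      (∀ i j : SymKl.MidIndex k, (i : ℕ) + j ≤ SymKl.kHalf k →
        SymKl.midPair k (b i) (b j) = 0) ∧
      (∀ i j : SymKl.MidIndex k, (i : ℕ) + j = SymKl.kHalf k + 1 →
        (Odd k → SymKl.midPair k (b i) (b j) =
          (-2) ^ SymKl.kHalf k * ((SymKl.kHalf k).factorial / k.doubleFactorial : ℂ)) ∧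
        (Even k → SymKl.midPair k (b i) (b j) =
          (-1) ^ (SymKl.kHalf k + 1) / (2 ^ SymKl.kHalf k * ((SymKl.kHalf k : ℂ) + 1 - 2 * i))
            * ((k - 1).doubleFactorial / (SymKl.kHalf k + 1).factorial : ℂ))) := by
  obtain ⟨v, hv, h0, h1⟩ := SymKl.exists_midFamily hk
  refine ⟨Module.Basis.mk (SymKl.linearIndependent_of_antidiag hk h0 h1)
    (SymKl.span_midFamily hk hv), ?_, ?_, ?_⟩
  · intro i
    rw [Module.Basis.mk_apply, hv]
  · intro i j hij
    rw [Module.Basis.mk_apply, Module.Basis.mk_apply, h0 i j hij]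
  · intro i j hij
    rw [Module.Basis.mk_apply, Module.Basis.mk_apply, h1 i j hij]
    exact ⟨fun h => if_pos h, fun h => if_neg (Nat.not_odd_iff_even.mpr h)⟩
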